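/- Let $k$ be a field of characteristic $\neq 2$, let $N\ge 2$, let $V$ be a finite-dimensional vector superspace over $k$ with homogeneous basis $(x_i)$, where $x_i$ has parity $\widehat{i}\in\mathbb Z/2$, let $R\subseteq V^{\otimes N}$ be a $\mathbb Z/2$-graded subspace, and let $A=A(V,R)=T(V)/(R)=\bigoplus_n A_n$ be the corresponding $N$-homogeneous superalgebra. *The superbialgebra* $\operatorname{end}A$. Let $R^{\perp}\subseteq (V^*)^{\otimes N}$ be the annihilator of $R$ under the pairing $\langle f_1\otimes\dots\otimes f_N,\,v_1\otimes\dots\otimes v_N\rangle=\pm f_1(v_1)\cdots f_N(v_N)$ (Koszul sign), let $A^!=A(V^*,R^\perp)$, and let $\operatorname{end}A=A^!\bullet A=A(V^*\otimes V,\,c(R^\perp\otimes R))$, where $c\colon (V^{*})^{\otimes N}\otimes V^{\otimes N}\to (V^*\otimes V)^{\otimes N}$ is the reordering isomorphism with its Koszul sign. Its generators are $z^i_j=x^i\otimes x_j$, of parity $\widehat{i}+\widehat{j}$, and it is a superbialgebra with $\Delta(z^i_j)=\sum_l z^i_l\otimes z^l_j$, $\varepsilon(z^i_j)=\delta^i_j$.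 The rule $x_j\mapsto\sum_i x_i\otimes z^i_j$ extends to superalgebra maps $A\to A\otimes\operatorname{end}A$ and $T(V)\to T(V)\otimes\operatorname{end}A$, which make each $A_n$ and each $V^{\otimes n}$ a right $\operatorname{end}A$-supercomodule. Let $A^{!*}_n$ be the subcomodule of $V^{\otimes n}$ given by $A^{!*}_n=V^{\otimes n}$ for $n<N$ and $A^{!*}_n=\bigcap_{i+j+N=n}V^{\otimes i}\otimes R\otimes V^{\otimes j}$ for $n\ge N$ (this is the linear dual of $A^!_n$). *Grothendieck ring and supercharacters.* Let $R_{\operatorname{end}A}=K_0$ of the category of finite-dimensional right $\operatorname{end}A$-supercomodules (with even comodule maps): it is generated by classes $[U]$ with relations $[U]=[U']+[U'']$ for short exact sequences $0\to U'\to U\to U''\to 0$, and multiplication is given by the (super) tensor product of comodules. For such a comodule $U$ with homogeneous basis $(u_i)$ and coaction $u_j\mapsto\sum_i u_i\otimes b^i_j$, the supercharacter is $\chi^s_U=\sum_i(-1)^{\widehat{i}}\,b^i_i\in(\operatorname{end}A)_{\bar 0}$. *Series.* Put $P_A(t)=\sum_{n\ge0}[A_n]t^n$ and $P_{A^{!*}}(t)=\sum_{n\ge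 0}[A^{!*}_n]t^n$. For a power series $P(t)=\sum_n a_nt^n$ put $P_N(t)=\sum_{n\equiv 0,1 \bmod N}(-1)^{n-(n \bmod N)}a_nt^n$, where $n\bmod N\in\{0,\dots,N-1\}$ is the remainder, and write $P_{A^{!*},N}=(P_{A^{!*}})_N$. Suppose that $A$ is $N$-Koszul, i.e. for every $i\ge 0$ the graded space $\operatorname{Tor}^A_i(k,k)$ is concentrated in degree $\nu_N(i)$, where $\nu_N(i)=\frac i2N$ for even $i$ and $\nu_N(i)=\frac{i-1}2N+1$ for odd $i$. Then $$P_A(t)\cdot P_{A^{!*},N}(-t)=1\qquad\text{in } R_{\operatorname{end}A}[[t]],$$ and $$\Bigl(\sum_{\ell\ge0}\chi^s_{A_\ell}t^\ell\Bigr)\cdot\Bigl(\sum_{m\equiv0,1\bmod N}(-1)^{m\bmod N}\chi^s_{A^{!*}_m}t^m\Bigr)=1\qquad\text{in }(\operatorname{end}A)_{\bar 0}[[t]].$$ -/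

import Mathlib

open scoped TensorProduct

universe u

namespace NKoszul

/-! ### Signs -/

section Signs

variable (k : Type u) [Field k]

/-- The sign `(-1) ^ r` for a parity `r`, as a scalar. -/
def sgn (r : ZMod 2) : k := if r = 0 then 1 else -1

@[simp] theorem sgn_zero : sgn k 0 = 1 := by simp [sgn]

theorem sgn_one : sgn k 1 = -1 := by simp [sgn]

theorem zmod_two_cases (r : ZMod 2) : r = 0 ∨ r = 1 := by
  revert r; decide

theorem sgn_add (r s : ZMod 2) : sgn k (r + s) = sgn k r * sgn k s := by
  have h : (1 : ZMod 2) + 1 = 0 := by decide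
  rcases zmod_two_cases r with rfl | rfl <;> rcases zmod_two_cases s with rfl | rfl <;>
    simp [sgn, h]

theorem sgn_mul_self (r : ZMod 2) : sgn k r * sgn k r = 1 := by
  rcases zmod_two_cases r with rfl | rfl <;> simp [sgn]

theorem zmod_two_add_self (r : ZMod 2) : r + r = 0 := by
  revert r; decide

theorem units_smul_eq {M : Type*} [AddCommGroup M] [Module k M] (r : ZMod 2) (x : M) :
    ((-1 : ℤˣ) ^ r) • x = sgn k r • x := by
  rcases zmod_two_cases r with rfl | rfl
  · simp [sgn]
  · simp [sgn]

end Signs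

/-! ### Homogeneous superalgebras `A(V, R)` -/

section Presentation

variable {k : Type u} [Field k] {ι : Type} {κ : Type}

/-- The parity of the basis tensor `x_{I 0} ⊗ ⋯ ⊗ x_{I (n-1)}`, where `x_i` has parity `p i`. -/
def tpar (p : ι → ZMod 2) {n : ℕ} (I : Fin n → ι) : ZMod 2 := ∑ a, p (I a)

/-- `V` is the superspace over `k` with a homogeneous basis `x_i` (`i : ι`), where `x_i` has parity
`p i`.  An `N`-tensor is given by its coordinates with respect to the basis tensors
`x_I = x_{I 0} ⊗ ⋯ ⊗ x_{I (N-1)}`.  A term of `HomRel k p N` is a `ℤ/2`-graded subspace `R` of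
`V^{⊗ N}`; it is the datum of the `N`-homogeneous superalgebra `A(V, R) = T(V)/(R)`. -/
structure HomRel (k : Type u) [Field k] {ι : Type} (p : ι → ZMod 2) (N : ℕ) where
  /-- the space of relations -/
  rel : Submodule k ((Fin N → ι) → k)
  /-- the homogeneous components of a relation are relations -/
  graded : ∀ r ∈ rel, ∀ s : ZMod 2, (fun I => if tpar p I = s then r I else 0) ∈ rel

namespace HomRel

variable {p : ι → ZMod 2} {N : ℕ}

/-- `R = 0`; the corresponding algebra is the tensor algebra `T(V) = A(V, 0)`. -/
def free (k : Type u) [Field k] (p : ι → ZMod 2) (N : ℕ) : HomRel k p N where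
  rel := ⊥
  graded := by
    rintro r hr s
    rw [Submodule.mem_bot] at hr ⊢
    subst hr
    funext I
    simp

theorem tpar_append {n m : ℕ} (I : Fin n → ι) (J : Fin m → ι) :
    tpar p (Fin.append I J) = tpar p I + tpar p J := by
  simp [tpar, Fin.sum_univ_add]

theorem tpar_cons {n : ℕ} (i : ι) (I : Fin n → ι) :
    tpar p (Fin.cons i I : Fin (n + 1) → ι) = p i + tpar p I := by
  simp [tpar, Fin.sum_univ_succ]

variable [Fintype ι]

/-- The two-sided ideal `(R)` of the tensor algebra `T(V)`, the free algebra on the `x_i`. -/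
noncomputable def ideal (R : HomRel k p N) : Ideal (FreeAlgebra k ι) :=
  (TwoSidedIdeal.span
    {x | ∃ r ∈ R.rel, x = ∑ I, r I • (List.ofFn fun a => FreeAlgebra.ι k (I a)).prod}).asIdeal

instance (R : HomRel k p N) : R.ideal.IsTwoSided := by
  unfold ideal; infer_instance

/-- The algebra `A(V, R) = T(V)/(R)`. -/
def Alg (R : HomRel k p N) : Type u := FreeAlgebra k ι ⧸ R.ideal

noncomputable instance (R : HomRel k p N) : Ring R.Alg :=
  inferInstanceAs (Ring (FreeAlgebra k ι ⧸ R.ideal))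

noncomputable instance (R : HomRel k p N) : Algebra k R.Alg :=
  inferInstanceAs (Algebra k (FreeAlgebra k ι ⧸ R.ideal))

/-- The canonical map `T(V) → A(V, R)`. -/
noncomputable def proj (R : HomRel k p N) : FreeAlgebra k ι →ₐ[k] R.Alg :=
  Ideal.Quotient.mkₐ k R.ideal

theorem proj_surjective (R : HomRel k p N) : Function.Surjective R.proj :=
  Ideal.Quotient.mkₐ_surjective k R.ideal

/-- The generator `x_i` of `A(V, R)`. -/
noncomputable def gen (R : HomRel k p N) (i : ι) : R.Alg := R.proj (FreeAlgebra.ι k i)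

/-- The monomial `x_I = x_{I 0} ⋯ x_{I (n-1)}` of `A(V, R)`. -/
noncomputable def mon (R : HomRel k p N) {n : ℕ} (I : Fin n → ι) : R.Alg :=
  (List.ofFn fun a => R.gen (I a)).prod

theorem mon_zero (R : HomRel k p N) (I : Fin 0 → ι) : R.mon I = 1 := by
  simp [mon]

theorem mon_cons (R : HomRel k p N) {n : ℕ} (i : ι) (I : Fin n → ι) :
    R.mon (Fin.cons i I : Fin (n + 1) → ι) = R.gen i * R.mon I := by
  simp [mon, List.ofFn_succ]

theorem proj_word (R : HomRel k p N) {n : ℕ} (I : Fin n → ι) :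
    R.proj (List.ofFn fun a => FreeAlgebra.ι k (I a)).prod = R.mon I := by
  rw [map_list_prod, List.map_ofFn]
  rfl

theorem sum_rel (R : HomRel k p N) {r : (Fin N → ι) → k} (hr : r ∈ R.rel) :
    ∑ I, r I • R.mon I = 0 := by
  have h : R.proj (∑ I, r I • (List.ofFn fun a => FreeAlgebra.ι k (I a)).prod) = 0 := by
    refine Ideal.Quotient.eq_zero_iff_mem.2 ?_
    exact TwoSidedIdeal.subset_span ⟨r, hr, rfl⟩
  rw [map_sum] at h
  simpa only [map_smul, proj_word] using h

/-- The universal property of `A(V, R)`. -/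
noncomputable def lift {C : Type*} [Ring C] [Algebra k C] (R : HomRel k p N) (f : ι → C)
    (h : ∀ r ∈ R.rel, ∑ I, r I • (List.ofFn fun a => f (I a)).prod = 0) : R.Alg →ₐ[k] C :=
  Ideal.Quotient.liftₐ R.ideal (FreeAlgebra.lift k f) (by
    intro x hx
    have h1 : x ∈ (TwoSidedIdeal.span
      {x | ∃ r ∈ R.rel, x = ∑ I, r I • (List.ofFn fun a => FreeAlgebra.ι k (I a)).prod}) := hx
    have h2 : TwoSidedIdeal.span
      {x | ∃ r ∈ R.rel, x = ∑ I, r I • (List.ofFn fun a => FreeAlgebra.ι k (I a)).prod} ≤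
        TwoSidedIdeal.ker (FreeAlgebra.lift k f) := by
      rw [TwoSidedIdeal.span_le]
      rintro _ ⟨r, hr, rfl⟩
      rw [SetLike.mem_coe, TwoSidedIdeal.mem_ker, map_sum, ← h r hr]
      refine Finset.sum_congr rfl fun I _ => ?_
      rw [map_smul, map_list_prod, List.map_ofFn]
      congr 3
      funext a
      simp
    exact (TwoSidedIdeal.mem_ker _).1 (h2 h1))

@[simp] theorem lift_gen {C : Type*} [Ring C] [Algebra k C] (R : HomRel k p N) (f : ι → C)
    (h : ∀ r ∈ R.rel, ∑ I, r I • (List.ofFn fun a => f (I a)).prod = 0) (i : ι) :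
    R.lift f h (R.gen i) = f i := by
  have : R.lift f h (R.gen i) = FreeAlgebra.lift k f (FreeAlgebra.ι k i) := rfl
  rw [this, FreeAlgebra.lift_ι_apply]

theorem span_mon (R : HomRel k p N) :
    Submodule.span k {x : R.Alg | ∃ (n : ℕ) (I : Fin n → ι), x = R.mon I} = ⊤ := by
  set S := Submodule.span k {x : R.Alg | ∃ (n : ℕ) (I : Fin n → ι), x = R.mon I} with hS
  have hgen : ∀ (i : ι) (x : R.Alg), x ∈ S → R.gen i * x ∈ S := by
    intro i x hx
    have : S ≤ S.comap (LinearMap.mulLeft k (R.gen i)) := by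
      conv_lhs => rw [hS]
      rw [Submodule.span_le]
      rintro _ ⟨n, I, rfl⟩
      refine Submodule.subset_span ⟨n + 1, Fin.cons i I, ?_⟩
      rw [mon_cons]; rfl
    exact this hx
  have key : ∀ y : FreeAlgebra k ι, ∀ x ∈ S, R.proj y * x ∈ S := by
    intro y
    induction y using FreeAlgebra.induction with
    | grade0 r =>
      intro x hx
      rw [AlgHom.commutes, ← Algebra.smul_def]
      exact S.smul_mem r hx
    | grade1 i => exact hgen i
    | mul a b ha hb =>
      intro x hx
      rw [map_mul, mul_assoc]
      exact ha _ (hb _ hx)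
    | add a b ha hb =>
      intro x hx
      rw [map_add, add_mul]
      exact S.add_mem (ha _ hx) (hb _ hx)
  refine eq_top_iff.2 fun x _ => ?_
  obtain ⟨y, rfl⟩ := R.proj_surjective x
  have h1 : (1 : R.Alg) ∈ S := Submodule.subset_span ⟨0, Fin.elim0, (R.mon_zero _).symm⟩
  simpa using key y 1 h1

/-- Two linear maps on `A(V, R)` agree if they agree on monomials. -/
theorem linearMap_ext {M : Type*} [AddCommGroup M] [Module k M] (R : HomRel k p N)
    {f g : R.Alg →ₗ[k] M} (h : ∀ (n : ℕ) (I : Fin n → ι), f (R.mon I) = g (R.mon I)) : f = g := by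
  refine LinearMap.ext_on R.span_mon ?_
  rintro _ ⟨n, I, rfl⟩
  exact h n I

theorem mon_append (R : HomRel k p N) {n m : ℕ} (I : Fin n → ι) (J : Fin m → ι) :
    R.mon (Fin.append I J) = R.mon I * R.mon J := by
  rw [mon, mon, mon, ← List.prod_append, ← List.ofFn_fin_append]
  congr 2
  funext a
  refine Fin.addCases (fun a => ?_) (fun a => ?_) a <;> simp

/-- The degree `n` component `A_n` of `A = A(V, R)`. -/
noncomputable def deg (R : HomRel k p N) (n : ℕ) : Submodule k R.Alg :=
  Submodule.span k {x | ∃ I : Fin n → ι, x = R.mon I}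

/-- The component of `A(V, R)` of parity `s`. -/
noncomputable def par (R : HomRel k p N) (s : ZMod 2) : Submodule k R.Alg :=
  Submodule.span k {x | ∃ (n : ℕ) (I : Fin n → ι), tpar p I = s ∧ x = R.mon I}

theorem mon_mem_deg (R : HomRel k p N) {n : ℕ} (I : Fin n → ι) : R.mon I ∈ R.deg n :=
  Submodule.subset_span ⟨I, rfl⟩

theorem mon_mem_par (R : HomRel k p N) {n : ℕ} (I : Fin n → ι) : R.mon I ∈ R.par (tpar p I) :=
  Submodule.subset_span ⟨n, I, rfl, rfl⟩

theorem gen_mem_par (R : HomRel k p N) (i : ι) : R.gen i ∈ R.par (p i) :=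
  Submodule.subset_span ⟨1, fun _ => i, by simp [tpar], by simp [mon]⟩

instance (R : HomRel k p N) : SetLike.GradedMonoid R.par where
  one_mem := Submodule.subset_span ⟨0, Fin.elim0, by simp [tpar], (R.mon_zero _).symm⟩
  mul_mem := by
    intro s t x y hx hy
    have h : R.par s * R.par t ≤ R.par (s + t) := by
      rw [par, par, Submodule.span_mul_span, Submodule.span_le]
      rintro _ ⟨_, ⟨n, I, hI, rfl⟩, _, ⟨m, J, hJ, rfl⟩, rfl⟩
      refine Submodule.subset_span ⟨n + m, Fin.append I J, ?_, ?_⟩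
      · rw [tpar_append, hI, hJ]
      · rw [mon_append]
    exact h (Submodule.mul_mem_mul hx hy)

theorem of_congr (R : HomRel k p N) {s t : ZMod 2} {x y : R.Alg} (hx : x ∈ R.par s)
    (hy : y ∈ R.par t) (hst : s = t) (hxy : x = y) :
    DirectSum.of (fun s => R.par s) s ⟨x, hx⟩ = DirectSum.of (fun s => R.par s) t ⟨y, hy⟩ := by
  subst hst hxy
  rfl

/-- The generator `x_i`, placed in the summand of its parity. -/
noncomputable def gradedGen (R : HomRel k p N) (i : ι) : DirectSum (ZMod 2) fun s => R.par s :=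
  DirectSum.of (fun s => R.par s) (p i) ⟨R.gen i, R.gen_mem_par i⟩

theorem prod_of (R : HomRel k p N) {n : ℕ} (I : Fin n → ι) :
    (List.ofFn fun a => R.gradedGen (I a)).prod =
    DirectSum.of (fun s => R.par s) (tpar p I) ⟨R.mon I, R.mon_mem_par I⟩ := by
  induction n with
  | zero =>
    simp only [List.ofFn_zero, List.prod_nil]
    rw [DirectSum.one_def]
    exact R.of_congr _ _ (by simp [tpar]) (R.mon_zero I).symm
  | succ n ih =>
    obtain ⟨i, J, rfl⟩ : ∃ i J, I = Fin.cons i J := ⟨I 0, Fin.tail I, (Fin.cons_self_tail I).symm⟩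
    rw [List.ofFn_succ, List.prod_cons]
    simp only [Fin.cons_succ, Fin.cons_zero]
    rw [ih J, gradedGen, DirectSum.of_mul_of]
    exact R.of_congr _ _ (tpar_cons i J).symm (R.mon_cons i J).symm

theorem sum_rel_component (R : HomRel k p N) {r : (Fin N → ι) → k} (hr : r ∈ R.rel) (s : ZMod 2) :
    ∑ I with tpar p I = s, r I • R.mon I = 0 := by
  rw [← R.sum_rel (R.graded r hr s), Finset.sum_filter]
  refine Finset.sum_congr rfl fun I _ => ?_
  split_ifs <;> simp

/-- The decomposition of `A(V, R)` into its even and odd parts. -/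
noncomputable def decomp (R : HomRel k p N) : R.Alg →ₐ[k] DirectSum (ZMod 2) fun s => R.par s :=
  R.lift R.gradedGen (by
    intro r hr
    simp only [prod_of]
    classical
    have h1 : ∀ I : Fin N → ι, r I • DirectSum.of (fun s => R.par s) (tpar p I)
        ⟨R.mon I, R.mon_mem_par I⟩ = ∑ s : ZMod 2, if h : tpar p I = s then
          DirectSum.of (fun s => R.par s) s
            (r I • ⟨R.mon I, h ▸ R.mon_mem_par I⟩) else 0 := by
      intro I
      rw [Finset.sum_eq_single (tpar p I)]
      · simp only [dif_pos]
        rw [← DirectSum.lof_eq_of k, ← DirectSum.lof_eq_of k, map_smul]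
      · intro s _ hs
        rw [dif_neg (Ne.symm hs)]
      · simp
    simp only [h1]
    rw [Finset.sum_comm]
    refine Finset.sum_eq_zero fun s _ => ?_
    have h2 : ∀ I : Fin N → ι, (if h : tpar p I = s then
          DirectSum.of (fun s => R.par s) s
            (r I • ⟨R.mon I, h ▸ R.mon_mem_par I⟩) else 0) =
        DirectSum.of (fun s => R.par s) s
          (if h : tpar p I = s then (r I • ⟨R.mon I, h ▸ R.mon_mem_par I⟩) else 0) := by
      intro I
      split_ifs <;> simp
    simp only [h2]
    rw [← map_sum, ← map_zero (DirectSum.of (fun s => R.par s) s)]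
    congr 1
    refine Subtype.ext ?_
    rw [AddSubmonoidClass.coe_finsetSum, ZeroMemClass.coe_zero, ← R.sum_rel_component hr s,
      Finset.sum_filter]
    refine Finset.sum_congr rfl fun I _ => ?_
    split_ifs <;> simp)

theorem decomp_mon (R : HomRel k p N) {n : ℕ} (I : Fin n → ι) :
    R.decomp (R.mon I) = DirectSum.of (fun s => R.par s) (tpar p I) ⟨R.mon I, R.mon_mem_par I⟩ := by
  rw [← prod_of, mon, map_list_prod, List.map_ofFn]
  congr 2
  funext a
  simp [decomp]

noncomputable instance (R : HomRel k p N) : GradedAlgebra R.par :=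
  GradedAlgebra.ofAlgHom R.par R.decomp
    (by
      refine AlgHom.toLinearMap_injective (R.linearMap_ext fun n I => ?_)
      simp [decomp_mon])
    (by
      rintro s ⟨x, hx⟩
      change R.decomp x = _
      induction hx using Submodule.span_induction with
      | mem x h =>
        obtain ⟨n, I, rfl, rfl⟩ := h
        exact R.decomp_mon I
      | zero => rw [map_zero]; exact (map_zero (DirectSum.of (fun s => R.par s) s)).symm
      | add x y hx hy h1 h2 =>
        rw [map_add, h1, h2, ← map_add]
        rfl
      | smul a x hx h =>
        rw [map_smul, h, ← DirectSum.lof_eq_of k, ← DirectSum.lof_eq_of k, ← map_smul]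
        rfl)

end HomRel

end Presentation

section Dual

variable {k : Type u} [Field k] {ι : Type} {κ : Type}

/-- The exponent of the Koszul sign of the reordering
`v_1 ⊗ ⋯ ⊗ v_n ⊗ w_1 ⊗ ⋯ ⊗ w_n ↦ (v_1 ⊗ w_1) ⊗ ⋯ ⊗ (v_n ⊗ w_n)` on basis tensors, that is,
the sum of the `|w_a| |v_b|` with `a < b`. -/
def shuffleSign (p : ι → ZMod 2) (q : κ → ZMod 2) {n : ℕ} (I : Fin n → ι) (J : Fin n → κ) :
    ZMod 2 :=
  ∑ a, ∑ b, if a < b then q (J a) * p (I b) else 0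

namespace HomRel

variable {p : ι → ZMod 2} {q : κ → ZMod 2} {N : ℕ}

/-- The relations `R^⊥ ⊆ (V^*)^{⊗ N}` of the dual `A^! = A(V^*, R^⊥)` of `A = A(V, R)`, in
coordinates with respect to the dual basis `x^i` of `V^*` (where `x^i` has the parity of `x_i`).
The pairing of `(V^*)^{⊗ N}` with `V^{⊗ N}` is
`⟨f_1 ⊗ ⋯ ⊗ f_N, v_1 ⊗ ⋯ ⊗ v_N⟩ = ± f_1(v_1) ⋯ f_N(v_N)` with the Koszul sign. -/
def perp [Fintype ι] (R : HomRel k p N) : HomRel k p N where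
  rel :=
    { carrier := {f | ∀ r ∈ R.rel, ∑ I, sgn k (shuffleSign p p I I) * (f I * r I) = 0}
      zero_mem' := by intro r _; simp
      add_mem' := by
        intro f g hf hg r hr
        simp only [Pi.add_apply, add_mul, mul_add, Finset.sum_add_distrib, hf r hr, hg r hr,
          add_zero]
      smul_mem' := by
        intro c f hf r hr
        have := congrArg (fun x => c * x) (hf r hr)
        simp only [Finset.mul_sum, mul_zero] at this
        rw [← this]
        refine Finset.sum_congr rfl fun I _ => ?_
        simp only [Pi.smul_apply, smul_eq_mul]
        ring }
  graded := by
    intro f hf s r hr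
    refine (Finset.sum_congr rfl fun I _ => ?_).trans (hf _ (R.graded r hr s))
    by_cases h : tpar p I = s <;> simp [h]

/-- The image of `f ⊗ r` under the reordering isomorphism
`V^{⊗ N} ⊗ V'^{⊗ N} → (V ⊗ V')^{⊗ N}` (with the Koszul sign), in coordinates. -/
def shuffle (p : ι → ZMod 2) (q : κ → ZMod 2) {N : ℕ} (f : (Fin N → ι) → k) (r : (Fin N → κ) → k) :
    (Fin N → ι × κ) → k := fun W =>
  sgn k (shuffleSign p q (fun a => (W a).1) (fun a => (W a).2)) *
    (f (fun a => (W a).1) * r (fun a => (W a).2))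

/-- The black product `A(V, R) • A(V', R')`, with generating space `V ⊗ V'` and with the image of
`R ⊗ R'` in `(V ⊗ V')^{⊗ N}` as its space of relations. -/
def black (R : HomRel k p N) (S : HomRel k q N) :
    HomRel k (fun x : ι × κ => p x.1 + q x.2) N where
  rel := Submodule.span k {g | ∃ f ∈ R.rel, ∃ r ∈ S.rel, g = shuffle p q f r}
  graded := by
    intro g hg s
    induction hg using Submodule.span_induction with
    | mem g hg =>
      obtain ⟨f, hf, r, hr, rfl⟩ := hg
      have key : (fun W : Fin N → ι × κ => if tpar (fun x : ι × κ => p x.1 + q x.2) W = s then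
          shuffle p q f r W else 0) = ∑ t : ZMod 2,
          shuffle p q (fun I => if tpar p I = t then f I else 0)
            (fun J => if tpar q J = s - t then r J else 0) := by
        funext W
        have h0 : tpar (fun x : ι × κ => p x.1 + q x.2) W =
            tpar p (fun a => (W a).1) + tpar q (fun a => (W a).2) := by
          simp [tpar, Finset.sum_add_distrib]
        rw [Finset.sum_apply, Finset.sum_eq_single (tpar p (fun a => (W a).1)), h0]
        · simp only [shuffle, if_true, eq_sub_iff_add_eq']
          split_ifs <;> simp
        · intro t _ ht
          simp [shuffle, Ne.symm ht]
        · simp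
      rw [key]
      exact Submodule.sum_mem _ fun t _ => Submodule.subset_span
        ⟨_, R.graded f hf t, _, S.graded r hr (s - t), rfl⟩
    | zero =>
      convert Submodule.zero_mem (Submodule.span k {g | ∃ f ∈ R.rel, ∃ r ∈ S.rel, g = shuffle p q f r}) using 1
      funext W
      simp
    | add g h _ _ h1 h2 =>
      convert Submodule.add_mem _ h1 h2 using 1
      funext W
      simp only [Pi.add_apply]
      split_ifs <;> simp
    | smul c g _ h1 =>
      convert Submodule.smul_mem _ c h1 using 1
      funext W
      simp only [Pi.smul_apply]
      split_ifs <;> simp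

/-- The exponent of the sign in `zcoef`: the sum of the `(|i_a| + |j_a|) |i_b|` with `a < b`. -/
def coefSign (p : ι → ZMod 2) {n : ℕ} (I J : Fin n → ι) : ZMod 2 :=
  ∑ a, ∑ b, if a < b then (p (I a) + p (J a)) * p (I b) else 0

theorem coefSign_cons {n : ℕ} (i j : ι) (I J : Fin n → ι) :
    coefSign p (Fin.cons i I : Fin (n + 1) → ι) (Fin.cons j J) =
      (p i + p j) * tpar p I + coefSign p I J := by
  simp [coefSign, Fin.sum_univ_succ, tpar, Finset.mul_sum]

theorem coefSign_eq {n : ℕ} (I J : Fin n → ι) :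
    coefSign p I J = shuffleSign p p I I + shuffleSign p p I J := by
  simp only [coefSign, shuffleSign, ← Finset.sum_add_distrib]
  refine Finset.sum_congr rfl fun a _ => Finset.sum_congr rfl fun b _ => ?_
  split_ifs
  · ring
  · simp

variable [Fintype ι]

/-- The superbialgebra `end A = A^! • A`.  Its generators are the `z^i_j = x^i ⊗ x_j`, of parity
`|i| + |j|`, indexed by the pairs `(i, j)`. -/
def endo (R : HomRel k p N) : HomRel k (fun x : ι × ι => p x.1 + p x.2) N :=
  R.perp.black R

/-- The element of `end A` that is the matrix coefficient of the coaction on `V^{⊗ n}` at the basis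
tensors `x_I` and `x_J`; up to a sign this is `z^{I 0}_{J 0} ⋯ z^{I (n-1)}_{J (n-1)}`. -/
noncomputable def zcoef (R : HomRel k p N) {n : ℕ} (I J : Fin n → ι) : R.endo.Alg :=
  sgn k (coefSign p I J) • R.endo.mon fun a => (I a, J a)

theorem zcoef_zero (R : HomRel k p N) (I J : Fin 0 → ι) : R.zcoef I J = 1 := by
  simp [zcoef, coefSign, mon_zero]

theorem zcoef_cons (R : HomRel k p N) {n : ℕ} (i j : ι) (I J : Fin n → ι) :
    R.zcoef (Fin.cons i I : Fin (n + 1) → ι) (Fin.cons j J) =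
      sgn k ((p i + p j) * tpar p I) • (R.endo.gen (i, j) * R.zcoef I J) := by
  have h : (fun a => ((Fin.cons i I : Fin (n + 1) → ι) a, (Fin.cons j J : Fin (n + 1) → ι) a)) =
      (Fin.cons (i, j) (fun a => (I a, J a)) : Fin (n + 1) → ι × ι) := by
    funext a
    refine Fin.cases ?_ (fun a => ?_) a <;> simp
  rw [zcoef, zcoef, coefSign_cons, h, mon_cons, sgn_add, mul_smul, mul_smul_comm]

theorem zcoef_mem_par (R : HomRel k p N) {n : ℕ} (I J : Fin n → ι) :
    R.zcoef I J ∈ R.endo.par (tpar p I + tpar p J) := by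
  have h := R.endo.mon_mem_par fun a => (I a, J a)
  have h0 : tpar (fun x : ι × ι => p x.1 + p x.2) (fun a => (I a, J a)) = tpar p I + tpar p J := by
    simp [tpar, Finset.sum_add_distrib]
  rw [h0] at h
  exact Submodule.smul_mem _ _ h

/-- In `end A`, pairing the coaction of a relation with a functional that vanishes on the relations
gives zero. -/
theorem zcoef_rel (R : HomRel k p N) (g : (Fin N → ι) → k)
    (hg : ∀ r ∈ R.rel, ∑ I, g I * r I = 0) {r : (Fin N → ι) → k} (hr : r ∈ R.rel) :
    ∑ I, ∑ J, (g I * r J) • R.zcoef I J = 0 := by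
  set f : (Fin N → ι) → k := fun I => sgn k (shuffleSign p p I I) * g I with hf
  have hfp : f ∈ R.perp.rel := by
    intro r hr
    rw [← hg r hr]
    refine Finset.sum_congr rfl fun I _ => ?_
    rw [hf, ← mul_assoc, ← mul_assoc, sgn_mul_self, one_mul]
  have hmem : shuffle p p f r ∈ R.endo.rel := Submodule.subset_span ⟨f, hfp, r, hr, rfl⟩
  have h := R.endo.sum_rel hmem
  rw [← h, ← Finset.sum_product', Finset.univ_product_univ]
  refine Fintype.sum_equiv (Equiv.arrowProdEquivProdArrow (Fin N) (fun _ => ι) (fun _ => ι)).symm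
    _ _ ?_
  rintro ⟨I, J⟩
  have e : (Equiv.arrowProdEquivProdArrow (Fin N) (fun _ => ι) (fun _ => ι)).symm (I, J) =
    fun a => (I a, J a) := rfl
  rw [e]
  simp only [shuffle, zcoef, smul_smul, hf, coefSign_eq, sgn_add]
  congr 1
  ring

end HomRel

end Dual

section Coaction

variable {k : Type u} [Field k]

theorem tmul_mul_tmul {A B : Type u} [Ring A] [Algebra k A] [Ring B] [Algebra k B]
    (𝒜 : ZMod 2 → Submodule k A) [GradedAlgebra 𝒜] (ℬ : ZMod 2 → Submodule k B) [GradedAlgebra ℬ]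
    {s t : ZMod 2} (a a' : A) (b b' : B) (hb : b ∈ ℬ s) (ha' : a' ∈ 𝒜 t) :
    ((a ᵍ⊗ₜ[k] b : 𝒜 ᵍ⊗[k] ℬ) * (a' ᵍ⊗ₜ[k] b' : 𝒜 ᵍ⊗[k] ℬ) : 𝒜 ᵍ⊗[k] ℬ) =
      sgn k (s * t) • ((a * a') ᵍ⊗ₜ[k] (b * b') : 𝒜 ᵍ⊗[k] ℬ) := by
  have h := GradedTensorProduct.tmul_coe_mul_coe_tmul (R := k) 𝒜 ℬ a ⟨b, hb⟩ ⟨a', ha'⟩ b'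
  rw [units_smul_eq k] at h
  exact h

/-- The matrix of a projection onto the subspace `S`. -/
theorem exists_projection {X : Type} [Fintype X] (S : Submodule k (X → k)) :
    ∃ P : X → X → k, (∀ K, (fun I => P I K) ∈ S) ∧
      (∀ L, ∀ r ∈ S, ∑ K, P L K * r K = r L) := by
  classical
  obtain ⟨T, hT⟩ := S.exists_isCompl
  let π : (X → k) →ₗ[k] (X → k) := S.subtype ∘ₗ Submodule.projectionOnto S T hT
  refine ⟨fun I K => π (Pi.single K 1) I, fun K => ?_, fun L r hr => ?_⟩
  · exact (Submodule.projectionOnto S T hT (Pi.single K 1)).2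
  · have h : π r = r := by
      exact congrArg Subtype.val (Submodule.projectionOnto_apply_left hT ⟨r, hr⟩)
    conv_rhs => rw [← h, ← Finset.univ_sum_single r, map_sum, Finset.sum_apply]
    refine Finset.sum_congr rfl fun K _ => ?_
    have : (Pi.single K (r K) : X → k) = r K • Pi.single K 1 := by
      rw [← Pi.single_smul, smul_eq_mul, mul_one]
    rw [this, map_smul, Pi.smul_apply, smul_eq_mul, mul_comm]

namespace HomRel

variable {ι : Type} {p : ι → ZMod 2} {N : ℕ}

theorem cons_surj {n : ℕ} (I : Fin (n + 1) → ι) : ∃ i J, I = Fin.cons i J :=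
  ⟨I 0, Fin.tail I, (Fin.cons_self_tail I).symm⟩

open Classical in
theorem prod_delta {n : ℕ} (W : Fin n → ι × ι) :
    (List.ofFn fun a => if (W a).1 = (W a).2 then (1 : k) else 0).prod =
      if (fun a => (W a).1) = (fun a => (W a).2) then 1 else 0 := by
  rw [List.prod_ofFn, Finset.prod_ite_zero]
  simp [funext_iff]

variable [Fintype ι]

theorem sum_cons {n : ℕ} {M : Type*} [AddCommMonoid M] (F : (Fin (n + 1) → ι) → M) :
    ∑ I, F I = ∑ i, ∑ J : Fin n → ι, F (Fin.cons i J) := by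
  rw [← Finset.sum_product', Finset.univ_product_univ]
  exact (Fintype.sum_equiv (Fin.consEquiv fun _ : Fin (n + 1) => ι) _ _ fun _ => rfl).symm

/-- The image `∑ i, x_i ⊗ z^i_j` of the generator `x_j` under the coaction of `end A(V, R)` on
`A(V, S)`. -/
noncomputable def coactGen (R S : HomRel k p N) (j : ι) : S.par ᵍ⊗[k] R.endo.par :=
  ∑ i, S.gen i ᵍ⊗ₜ[k] R.endo.gen (i, j)

theorem prod_coactGen (R S : HomRel k p N) {n : ℕ} (J : Fin n → ι) :
    (List.ofFn fun a => R.coactGen S (J a)).prod =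
      ∑ I : Fin n → ι, (S.mon I ᵍ⊗ₜ[k] R.zcoef I J : S.par ᵍ⊗[k] R.endo.par) := by
  induction n with
  | zero => simp [mon_zero, zcoef_zero]; rfl
  | succ n ih =>
    obtain ⟨j, J, rfl⟩ := cons_surj J
    rw [List.ofFn_succ, List.prod_cons]
    simp only [Fin.cons_succ, Fin.cons_zero]
    rw [ih J, coactGen, Finset.sum_mul_sum, sum_cons]
    refine Finset.sum_congr rfl fun i _ => Finset.sum_congr rfl fun I _ => ?_
    rw [tmul_mul_tmul S.par R.endo.par _ _ _ _ (R.endo.gen_mem_par (i, j)) (S.mon_mem_par I),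
      zcoef_cons, mon_cons, ← map_smul, ← TensorProduct.tmul_smul]

/-- The condition for the coaction of `end A(V, R)` on generators to extend to `A(V, S)`. -/
def Coacts (R S : HomRel k p N) : Prop :=
  ∀ r ∈ S.rel, ∑ J, r J • (List.ofFn fun a => R.coactGen S (J a)).prod = 0

theorem coacts_free (R : HomRel k p N) : R.Coacts (free k p N) := by
  intro r hr
  have : r = 0 := hr
  simp [this]

theorem coacts_self (R : HomRel k p N) : R.Coacts R := by
  intro r hr
  classical
  obtain ⟨P, hP1, hP2⟩ := exists_projection R.rel
  simp only [prod_coactGen]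
  have h1 : ∀ I : Fin N → ι, R.mon I = ∑ K, ((if K = I then 1 else 0) - P K I) • R.mon K := by
    intro I
    have := R.sum_rel (hP1 I)
    simp only [sub_smul, Finset.sum_sub_distrib, this, sub_zero, ite_smul, one_smul, zero_smul]
    simp
  have h2 : ∀ K : Fin N → ι,
      ∑ I, ∑ J, (((if K = I then 1 else 0) - P K I) * r J) • R.zcoef I J = 0 := by
    intro K
    refine R.zcoef_rel (fun I => (if K = I then 1 else 0) - P K I) ?_ hr
    intro r hr
    simp only [sub_mul, Finset.sum_sub_distrib, hP2 K r hr]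
    simp
  calc ∑ J, r J • ∑ I : Fin N → ι, (R.mon I ᵍ⊗ₜ[k] R.zcoef I J : R.par ᵍ⊗[k] R.endo.par)
      = ∑ K, (R.mon K ᵍ⊗ₜ[k]
          (∑ I, ∑ J, (((if K = I then 1 else 0) - P K I) * r J) • R.zcoef I J) :
          R.par ᵍ⊗[k] R.endo.par) := by
        have e1 : ∀ I J : Fin N → ι, (R.mon I ᵍ⊗ₜ[k] R.zcoef I J : R.par ᵍ⊗[k] R.endo.par) =
            ∑ K, ((if K = I then 1 else 0) - P K I) •
              (R.mon K ᵍ⊗ₜ[k] R.zcoef I J : R.par ᵍ⊗[k] R.endo.par) := by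
          intro I J
          conv_lhs => rw [h1 I]
          simp only [GradedTensorProduct.tmul, TensorProduct.sum_tmul, map_sum,
            ← TensorProduct.smul_tmul', map_smul]
        have e2 : ∀ K : Fin N → ι, (R.mon K ᵍ⊗ₜ[k]
          (∑ I, ∑ J, (((if K = I then 1 else 0) - P K I) * r J) • R.zcoef I J) :
          R.par ᵍ⊗[k] R.endo.par) = ∑ J, ∑ I, (r J * ((if K = I then 1 else 0) - P K I)) •
              (R.mon K ᵍ⊗ₜ[k] R.zcoef I J : R.par ᵍ⊗[k] R.endo.par) := by
          intro K
          rw [Finset.sum_comm]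
          simp only [GradedTensorProduct.tmul, TensorProduct.tmul_sum, map_sum,
            TensorProduct.tmul_smul, map_smul, mul_comm]
        simp only [e1, e2, Finset.smul_sum, smul_smul]
        conv_rhs => rw [Finset.sum_comm]
        refine Finset.sum_congr rfl fun J _ => ?_
        rw [Finset.sum_comm]
    _ = 0 := by
        simp only [h2]
        simp [GradedTensorProduct.tmul]

/-- The coaction of `end A(V, R)` on `A(V, S)`, the morphism of superalgebras with
`x_j ↦ ∑ i, x_i ⊗ z^i_j`.  It is used for `S = R`, where it is the coaction on `A(V, R)`, and for
`S = 0`, where it is the coaction on `T(V)`. -/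
noncomputable def coaction (R S : HomRel k p N) (h : R.Coacts S) :
    S.Alg →ₐ[k] S.par ᵍ⊗[k] R.endo.par :=
  S.lift (R.coactGen S) h

theorem coaction_mon (R S : HomRel k p N) (h : R.Coacts S) {n : ℕ} (J : Fin n → ι) :
    R.coaction S h (S.mon J) = ∑ I : Fin n → ι, S.mon I ᵍ⊗ₜ[k] R.zcoef I J := by
  rw [← prod_coactGen, mon, map_list_prod, List.map_ofFn]
  congr 2
  funext a
  exact S.lift_gen _ h (J a)

/-- The image `∑ l, z^i_l ⊗ z^l_j` of `z^i_j` under the comultiplication. -/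
noncomputable def comulGen (R : HomRel k p N) (x : ι × ι) : R.endo.par ᵍ⊗[k] R.endo.par :=
  ∑ l, R.endo.gen (x.1, l) ᵍ⊗ₜ[k] R.endo.gen (l, x.2)

theorem prod_comulGen (R : HomRel k p N) {n : ℕ} (I J : Fin n → ι) :
    sgn k (coefSign p I J) • (List.ofFn fun a => R.comulGen (I a, J a)).prod =
      ∑ K : Fin n → ι, (R.zcoef I K ᵍ⊗ₜ[k] R.zcoef K J : R.endo.par ᵍ⊗[k] R.endo.par) := by
  induction n with
  | zero => simp [zcoef_zero, coefSign]; rfl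
  | succ n ih =>
    obtain ⟨j, J, rfl⟩ := cons_surj J
    obtain ⟨i, I, rfl⟩ := cons_surj I
    rw [List.ofFn_succ, List.prod_cons]
    simp only [Fin.cons_succ, Fin.cons_zero]
    rw [coefSign_cons, sgn_add, mul_smul, ← mul_smul_comm, ih I J, comulGen, Finset.sum_mul_sum,
      sum_cons, Finset.smul_sum]
    refine Finset.sum_congr rfl fun l _ => ?_
    rw [Finset.smul_sum]
    refine Finset.sum_congr rfl fun K _ => ?_
    rw [tmul_mul_tmul R.endo.par R.endo.par _ _ _ _ (R.endo.gen_mem_par (l, j))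
      (R.zcoef_mem_par I K), zcoef_cons, zcoef_cons]
    simp only [GradedTensorProduct.tmul]
    rw [TensorProduct.smul_tmul_smul, map_smul, smul_smul, ← sgn_add, ← sgn_add]
    congr 2
    have h2 : (2 : ZMod 2) = 0 := by decide
    linear_combination (p j * tpar p I) * h2

theorem comul_rel (R : HomRel k p N) :
    ∀ r ∈ R.endo.rel, ∑ W, r W • (List.ofFn fun a => R.comulGen (W a)).prod = 0 := by
  intro g hg
  have hsub : R.endo.rel ≤ LinearMap.ker (Fintype.linearCombination k
      fun W : Fin N → ι × ι => (List.ofFn fun a => R.comulGen (W a)).prod) := by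
    change Submodule.span k _ ≤ _
    rw [Submodule.span_le]
    rintro _ ⟨f, hf, r, hr, rfl⟩
    rw [SetLike.mem_coe, LinearMap.mem_ker, Fintype.linearCombination_apply]
    classical
    obtain ⟨P, hP1, hP2⟩ := exists_projection R.rel
    set g : (Fin N → ι) → k := fun I => sgn k (shuffleSign p p I I) * f I with hg
    have hgr : ∀ r ∈ R.rel, ∑ I, g I * r I = 0 := by
      intro r hr
      rw [← hf r hr]
      refine Finset.sum_congr rfl fun I _ => ?_
      rw [hg, mul_assoc]
    have e1 : ∑ W, shuffle p p f r W • (List.ofFn fun a => R.comulGen (W a)).prod =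
        ∑ I, ∑ J, (g I * r J) • ∑ K : Fin N → ι,
          (R.zcoef I K ᵍ⊗ₜ[k] R.zcoef K J : R.endo.par ᵍ⊗[k] R.endo.par) := by
      rw [← Finset.sum_product', Finset.univ_product_univ]
      refine Fintype.sum_equiv (Equiv.arrowProdEquivProdArrow (Fin N) (fun _ => ι) (fun _ => ι))
        _ _ ?_
      intro W
      have e : (Equiv.arrowProdEquivProdArrow (Fin N) (fun _ => ι) (fun _ => ι)) W =
        (fun a => (W a).1, fun a => (W a).2) := rfl
      rw [e]
      simp only
      rw [← prod_comulGen, smul_smul]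
      congr 1
      simp only [shuffle, hg, coefSign_eq, sgn_add]
      have := sgn_mul_self k (shuffleSign p p (fun a => (W a).1) fun a => (W a).1)
      linear_combination (-(sgn k (shuffleSign p p (fun a => (W a).1) fun a => (W a).2) *
        f (fun a => (W a).1) * r (fun a => (W a).2))) * this
    have e2 : ∀ K, ∑ I, ∑ J, (g I * P J K) • R.zcoef I J = 0 := fun K => R.zcoef_rel g hgr (hP1 K)
    have e3 : ∀ L, ∑ K, ∑ J, (((if L = K then 1 else 0) - P L K) * r J) • R.zcoef K J = 0 := by
      intro L
      refine R.zcoef_rel (fun I => (if L = I then 1 else 0) - P L I) ?_ hr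
      intro r hr
      simp only [sub_mul, Finset.sum_sub_distrib, hP2 L r hr]
      simp
    set u : (Fin N → ι) → R.endo.Alg := fun K => ∑ I, g I • R.zcoef I K with hu
    set v : (Fin N → ι) → R.endo.Alg := fun K => ∑ J, r J • R.zcoef K J with hv
    have e2' : ∀ K, ∑ J, P J K • u J = 0 := by
      intro K
      rw [← e2 K, Finset.sum_comm]
      refine Finset.sum_congr rfl fun J _ => ?_
      rw [hu, Finset.smul_sum]
      refine Finset.sum_congr rfl fun I _ => ?_
      rw [smul_smul, mul_comm]
    have e3' : ∀ L, v L = ∑ K, P L K • v K := by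
      intro L
      have h := e3 L
      have h' : ∑ K, ((if L = K then 1 else 0) - P L K) • v K = 0 := by
        rw [← h]
        refine Finset.sum_congr rfl fun K _ => ?_
        rw [hv, Finset.smul_sum]
        refine Finset.sum_congr rfl fun J _ => ?_
        rw [smul_smul]
      simp only [sub_smul, Finset.sum_sub_distrib, ite_smul, one_smul, zero_smul,
        Finset.sum_ite_eq, Finset.mem_univ, if_true] at h'
      exact sub_eq_zero.1 h'
    have e4 : ∑ I, ∑ J, (g I * r J) • ∑ K : Fin N → ι,
        (R.zcoef I K ᵍ⊗ₜ[k] R.zcoef K J : R.endo.par ᵍ⊗[k] R.endo.par) =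
        ∑ K, (u K ᵍ⊗ₜ[k] v K : R.endo.par ᵍ⊗[k] R.endo.par) := by
      have e5 : ∀ K, (u K ᵍ⊗ₜ[k] v K : R.endo.par ᵍ⊗[k] R.endo.par) = ∑ I, ∑ J, (g I * r J) •
          (R.zcoef I K ᵍ⊗ₜ[k] R.zcoef K J : R.endo.par ᵍ⊗[k] R.endo.par) := by
        intro K
        rw [Finset.sum_comm]
        simp only [hu, hv, GradedTensorProduct.tmul, TensorProduct.sum_tmul, TensorProduct.tmul_sum,
          map_sum, TensorProduct.smul_tmul_smul, map_smul]
      simp only [e5, Finset.smul_sum]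
      conv_rhs => rw [Finset.sum_comm]
      refine Finset.sum_congr rfl fun I _ => ?_
      rw [Finset.sum_comm]
    rw [e1, e4]
    calc ∑ K, (u K ᵍ⊗ₜ[k] v K : R.endo.par ᵍ⊗[k] R.endo.par)
        = ∑ K, ((∑ J, P J K • u J) ᵍ⊗ₜ[k] v K : R.endo.par ᵍ⊗[k] R.endo.par) := by
          simp only [GradedTensorProduct.tmul, TensorProduct.sum_tmul, map_sum]
          rw [Finset.sum_comm]
          refine Finset.sum_congr rfl fun K _ => ?_
          conv_lhs => rw [e3' K]
          rw [TensorProduct.tmul_sum, map_sum]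
          refine Finset.sum_congr rfl fun L _ => ?_
          rw [TensorProduct.smul_tmul]
      _ = 0 := by simp [e2', GradedTensorProduct.tmul]
  exact hsub hg

/-- The comultiplication of `end A`, the morphism of superalgebras with
`z^i_j ↦ ∑ l, z^i_l ⊗ z^l_j`. -/
noncomputable def comulHom (R : HomRel k p N) : R.endo.Alg →ₐ[k] R.endo.par ᵍ⊗[k] R.endo.par :=
  R.endo.lift R.comulGen R.comul_rel

theorem comulHom_zcoef (R : HomRel k p N) {n : ℕ} (I J : Fin n → ι) :
    R.comulHom (R.zcoef I J) = ∑ K : Fin n → ι, R.zcoef I K ᵍ⊗ₜ[k] R.zcoef K J := by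
  rw [← prod_comulGen, zcoef, map_smul, mon, map_list_prod, List.map_ofFn]
  congr 3
  funext a
  exact R.endo.lift_gen _ _ (I a, J a)

open Classical in
theorem counit_rel (R : HomRel k p N) :
    ∀ r ∈ R.endo.rel, ∑ W, r W • (List.ofFn fun a => if (W a).1 = (W a).2 then (1 : k) else 0).prod
      = 0 := by
  intro g hg
  have hsub : R.endo.rel ≤ LinearMap.ker (Fintype.linearCombination k
      fun W : Fin N → ι × ι => (List.ofFn fun a => if (W a).1 = (W a).2 then (1 : k) else 0).prod) := by
    change Submodule.span k _ ≤ _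
    rw [Submodule.span_le]
    rintro _ ⟨f, hf, r, hr, rfl⟩
    rw [SetLike.mem_coe, LinearMap.mem_ker, Fintype.linearCombination_apply]
    simp only [prod_delta]
    refine Eq.trans ?_ (hf r hr)
    have := Fintype.sum_equiv (Equiv.arrowProdEquivProdArrow (Fin N) (fun _ => ι) (fun _ => ι))
      (fun W => shuffle p p f r W • if (fun a => (W a).1) = (fun a => (W a).2) then (1 : k) else 0)
      (fun x => if x.1 = x.2 then sgn k (shuffleSign p p x.1 x.2) * (f x.1 * r x.2) else 0) (by
        intro W
        have e : (Equiv.arrowProdEquivProdArrow (Fin N) (fun _ => ι) (fun _ => ι)) W =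
          (fun a => (W a).1, fun a => (W a).2) := rfl
        rw [e]
        simp [shuffle])
    rw [this, ← Finset.univ_product_univ, Finset.sum_product]
    simp
  exact hsub hg

open Classical in
/-- The counit of `end A`, the morphism of superalgebras with `z^i_j ↦ δ^i_j`. -/
noncomputable def counitHom (R : HomRel k p N) : R.endo.Alg →ₐ[k] k :=
  R.endo.lift (fun x => if x.1 = x.2 then 1 else 0) R.counit_rel

open Classical in
theorem counitHom_zcoef (R : HomRel k p N) {n : ℕ} (I J : Fin n → ι) :
    R.counitHom (R.zcoef I J) = if I = J then 1 else 0 := by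
  have h : R.counitHom (R.endo.mon fun a => (I a, J a)) = if I = J then 1 else 0 := by
    have := prod_delta (k := k) fun a => (I a, J a)
    rw [← this, mon, map_list_prod, List.map_ofFn]
    congr 2
    funext a
    simp [counitHom]
  rw [zcoef, map_smul, h]
  split_ifs with h
  · subst h
    have : coefSign p I I = 0 := by simp [coefSign, zmod_two_add_self]
    simp [this]
  · simp

end HomRel

end Coaction

section Superspaces

variable {k : Type u} [Field k]

/-- The `ℤ/2`-grading of the tensor product of two superspaces. -/
def tensorGrading {V W : Type*} [AddCommGroup V] [Module k V] [AddCommGroup W] [Module k W]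
    (𝒱 : ZMod 2 → Submodule k V) (𝒲 : ZMod 2 → Submodule k W) (r : ZMod 2) :
    Submodule k (V ⊗[k] W) :=
  Submodule.span k {x | ∃ s t v w, s + t = r ∧ v ∈ 𝒱 s ∧ w ∈ 𝒲 t ∧ x = v ⊗ₜ[k] w}

theorem tmul_mem_tensorGrading {V W : Type*} [AddCommGroup V] [Module k V] [AddCommGroup W]
    [Module k W] {𝒱 : ZMod 2 → Submodule k V} {𝒲 : ZMod 2 → Submodule k W} {r s t : ZMod 2}
    {v : V} {w : W} (hv : v ∈ 𝒱 s) (hw : w ∈ 𝒲 t) (h : s + t = r) :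
    v ⊗ₜ[k] w ∈ tensorGrading 𝒱 𝒲 r :=
  Submodule.subset_span ⟨s, t, v, w, h, hv, hw, rfl⟩

/-- The projection of a superspace onto its component of parity `r`. -/
noncomputable def superProj {V : Type*} [AddCommGroup V] [Module k V] (𝒱 : ZMod 2 → Submodule k V)
    [DirectSum.Decomposition 𝒱] (r : ZMod 2) : V →ₗ[k] V :=
  (𝒱 r).subtype ∘ₗ DirectSum.component k (ZMod 2) (fun s => 𝒱 s) r ∘ₗ
    (DirectSum.decomposeLinearEquiv 𝒱).toLinearMap

theorem superProj_apply {V : Type*} [AddCommGroup V] [Module k V] (𝒱 : ZMod 2 → Submodule k V)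
    [DirectSum.Decomposition 𝒱] (r : ZMod 2) (v : V) :
    superProj 𝒱 r v = (DirectSum.decompose 𝒱 v r : V) := rfl

theorem superProj_of_mem {V : Type*} [AddCommGroup V] [Module k V] (𝒱 : ZMod 2 → Submodule k V)
    [DirectSum.Decomposition 𝒱] {r s : ZMod 2} {v : V} (hv : v ∈ 𝒱 s) :
    superProj 𝒱 r v = if r = s then v else 0 := by
  rw [superProj_apply]
  split_ifs with h
  · subst h
    exact DirectSum.decompose_of_mem_same 𝒱 hv
  · exact DirectSum.decompose_of_mem_ne 𝒱 hv (Ne.symm h)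

theorem superProj_mem {V : Type*} [AddCommGroup V] [Module k V] (𝒱 : ZMod 2 → Submodule k V)
    [DirectSum.Decomposition 𝒱] (r : ZMod 2) (v : V) : superProj 𝒱 r v ∈ 𝒱 r :=
  (DirectSum.decompose 𝒱 v r).2

theorem sum_superProj {V : Type*} [AddCommGroup V] [Module k V] (𝒱 : ZMod 2 → Submodule k V)
    [DirectSum.Decomposition 𝒱] (v : V) : ∑ r, superProj 𝒱 r v = v := by
  classical
  conv_rhs => rw [← DirectSum.sum_support_decompose 𝒱 v]
  symm
  refine Finset.sum_subset (Finset.subset_univ _) fun r _ hr => ?_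
  simpa using hr

/-- A family of subspaces is a grading if a basis consists of homogeneous elements and the
coordinates of homogeneous elements are supported on basis elements of the same parity. -/
theorem isInternal_of_basis {V : Type*} [AddCommGroup V] [Module k V]
    (𝒱 : ZMod 2 → Submodule k V) {κ : Type*} (b : Module.Basis κ k V) (q : κ → ZMod 2)
    (hb : ∀ i, b i ∈ 𝒱 (q i)) (h : ∀ r, ∀ v ∈ 𝒱 r, ∀ i, q i ≠ r → b.coord i v = 0) :
    DirectSum.IsInternal 𝒱 := by
  rw [DirectSum.isInternal_submodule_iff_iSupIndep_and_iSup_eq_top]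
  refine ⟨fun r => ?_, ?_⟩
  · rw [Submodule.disjoint_def]
    intro v hv hv'
    refine b.ext_elem fun i => ?_
    rw [map_zero, Finsupp.zero_apply]
    change b.coord i v = 0
    by_cases hi : q i = r
    · have hle : (⨆ (s : ZMod 2) (_ : s ≠ r), 𝒱 s) ≤ LinearMap.ker (b.coord i) := by
        refine iSup₂_le fun s hs w hw => ?_
        exact h s w hw i (fun h' => hs (h'.symm.trans hi))
      exact hle hv'
    · exact h r v hv i hi
  · rw [eq_top_iff, ← b.span_eq, Submodule.span_le]
    rintro _ ⟨i, rfl⟩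
    exact Submodule.mem_iSup_of_mem (q i) (hb i)

end Superspaces

section Bialgebras

variable {k : Type u} [Field k] {B : Type u} [Ring B] [Algebra k B]

section Shuffle

variable (ℬ : ZMod 2 → Submodule k B) [GradedAlgebra ℬ]

/-- The linear map `(M ⊗ B) ⊗ (N ⊗ B) → (M ⊗ N) ⊗ B` with
`(m ⊗ b) ⊗ (n ⊗ b') ↦ (-1) ^ (|b| |n|) (m ⊗ n) ⊗ b b'`. -/
noncomputable def superShuffle (M N : Type*) [AddCommGroup M] [Module k M] [AddCommGroup N]
    [Module k N] (𝒩 : ZMod 2 → Submodule k N) [DirectSum.Decomposition 𝒩] :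
    (M ⊗[k] B) ⊗[k] (N ⊗[k] B) →ₗ[k] (M ⊗[k] N) ⊗[k] B :=
  ∑ r : ZMod 2, ∑ s : ZMod 2, sgn k (r * s) •
    ((LinearMap.mul' k B).lTensor (M ⊗[k] N) ∘ₗ
      (TensorProduct.tensorTensorTensorComm k M B N B).toLinearMap ∘ₗ
        TensorProduct.map ((superProj ℬ r).lTensor M) ((superProj 𝒩 s).rTensor B))

theorem superShuffle_tmul {M N : Type*} [AddCommGroup M] [Module k M] [AddCommGroup N]
    [Module k N] (𝒩 : ZMod 2 → Submodule k N) [DirectSum.Decomposition 𝒩] {r s : ZMod 2}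
    (m : M) {b : B} (hb : b ∈ ℬ r) {n : N} (hn : n ∈ 𝒩 s) (b' : B) :
    superShuffle ℬ M N 𝒩 ((m ⊗ₜ b) ⊗ₜ (n ⊗ₜ b')) =
      sgn k (r * s) • ((m ⊗ₜ[k] n) ⊗ₜ[k] (b * b')) := by
  have h : ∀ r' s', sgn k (r' * s') • ((m ⊗ₜ[k] (superProj 𝒩 s' n)) ⊗ₜ[k]
      (superProj ℬ r' b * b')) = if r' = r then (if s' = s then
        sgn k (r * s) • ((m ⊗ₜ[k] n) ⊗ₜ[k] (b * b')) else 0) else 0 := by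
    intro r' s'
    rw [superProj_of_mem ℬ hb, superProj_of_mem 𝒩 hn]
    split_ifs with h1 h2
    · rw [h1, h2]
    all_goals simp
  simp only [superShuffle, LinearMap.sum_apply, LinearMap.smul_apply, LinearMap.comp_apply,
    TensorProduct.map_tmul, LinearMap.lTensor_tmul, LinearMap.rTensor_tmul, LinearEquiv.coe_coe,
    TensorProduct.tensorTensorTensorComm_tmul, LinearMap.mul'_apply, h]
  simp

end Shuffle

/-- A superalgebra `B` with a coalgebra structure is a superbialgebra if the comultiplication and
the counit are morphisms of superalgebras; here `B ⊗ B` carries the multiplication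
`(a ⊗ b) (a' ⊗ b') = (-1) ^ (|a'| |b|) a a' ⊗ b b'`. -/
class SuperBialgebra (ℬ : ZMod 2 → Submodule k B) [GradedAlgebra ℬ] [Coalgebra k B] : Prop where
  comul_one : GradedTensorProduct.of k ℬ ℬ (CoalgebraStruct.comul (R := k) (1 : B)) = 1
  comul_mul : ∀ a b : B, GradedTensorProduct.of k ℬ ℬ (CoalgebraStruct.comul (R := k) (a * b)) =
    GradedTensorProduct.of k ℬ ℬ (CoalgebraStruct.comul (R := k) a) *
      GradedTensorProduct.of k ℬ ℬ (CoalgebraStruct.comul (R := k) b)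
  counit_one : CoalgebraStruct.counit (R := k) (1 : B) = 1
  counit_mul : ∀ a b : B, CoalgebraStruct.counit (R := k) (a * b) =
    CoalgebraStruct.counit (R := k) a * CoalgebraStruct.counit (R := k) b
  comul_even : ∀ r, ∀ b ∈ ℬ r, CoalgebraStruct.comul (R := k) b ∈ tensorGrading ℬ ℬ r
  counit_even : ∀ b ∈ ℬ 1, CoalgebraStruct.counit (R := k) b = 0

variable [Coalgebra k B]

/-- A finite-dimensional object of the category of right supercomodules over `B`: a
finite-dimensional superspace with a coassociative and counital even coaction. -/
structure SComod (ℬ : ZMod 2 → Submodule k B) : Type (u + 1) where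
  /-- the underlying vector space -/
  carrier : Type u
  [addCommGroup : AddCommGroup carrier]
  [module : Module k carrier]
  [finite : Module.Finite k carrier]
  /-- the even and the odd part -/
  grading : ZMod 2 → Submodule k carrier
  isInternal : DirectSum.IsInternal grading
  /-- the coaction -/
  coact : carrier →ₗ[k] carrier ⊗[k] B
  coassoc : (TensorProduct.assoc k carrier B B).toLinearMap ∘ₗ coact.rTensor B ∘ₗ coact =
    (CoalgebraStruct.comul (R := k) (A := B)).lTensor carrier ∘ₗ coact
  counit : (TensorProduct.rid k carrier).toLinearMap ∘ₗ
    (CoalgebraStruct.counit (R := k) (A := B)).lTensor carrier ∘ₗ coact = LinearMap.id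
  even : ∀ r, ∀ m ∈ grading r, coact m ∈ tensorGrading grading ℬ r

attribute [instance] SComod.addCommGroup SComod.module SComod.finite

theorem coassoc_at {M κ : Type*} [AddCommGroup M] [Module k M] [Fintype κ] (δ : M →ₗ[k] M ⊗[k] B)
    (b : κ → M) (c : κ → κ → B) (h : ∀ j, δ (b j) = ∑ i, b i ⊗ₜ c i j)
    (hc : ∀ i j, CoalgebraStruct.comul (R := k) (c i j) = ∑ l, c i l ⊗ₜ[k] c l j) (j : κ) :
    TensorProduct.assoc k M B B (δ.rTensor B (δ (b j))) =
      (CoalgebraStruct.comul (R := k) (A := B)).lTensor M (δ (b j)) := by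
  simp only [h, map_sum, LinearMap.rTensor_tmul, LinearMap.lTensor_tmul, TensorProduct.sum_tmul,
    TensorProduct.assoc_tmul, hc, TensorProduct.tmul_sum]
  rw [Finset.sum_comm]

theorem counit_at {M κ : Type*} [AddCommGroup M] [Module k M] [Fintype κ] [DecidableEq κ]
    (δ : M →ₗ[k] M ⊗[k] B)
    (b : κ → M) (c : κ → κ → B) (h : ∀ j, δ (b j) = ∑ i, b i ⊗ₜ c i j)
    (hc : ∀ i j, CoalgebraStruct.counit (R := k) (c i j) = if i = j then 1 else 0) (j : κ) :
    TensorProduct.rid k M ((CoalgebraStruct.counit (R := k) (A := B)).lTensor M (δ (b j))) =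
      b j := by
  simp [h, hc]

namespace SComod

variable {ℬ : ZMod 2 → Submodule k B}

noncomputable instance (M : SComod ℬ) : DirectSum.Decomposition M.grading :=
  M.isInternal.chooseDecomposition

/-- The index set of a homogeneous basis. -/
abbrev Idx (M : SComod ℬ) : Type := Σ r : ZMod 2, Fin (Module.finrank k (M.grading r))

/-- A basis of `M` that consists of homogeneous elements; the element with index `i` has
parity `i.1`. -/
noncomputable def basis (M : SComod ℬ) : Module.Basis M.Idx k M.carrier :=
  M.isInternal.collectedBasis fun r => Module.finBasis k (M.grading r)

theorem basis_mem (M : SComod ℬ) (i : M.Idx) : M.basis i ∈ M.grading i.1 :=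
  M.isInternal.collectedBasis_mem _ i

theorem basis_coord_of_ne (M : SComod ℬ) {r : ZMod 2} {m : M.carrier} (hm : m ∈ M.grading r)
    {i : M.Idx} (h : i.1 ≠ r) : M.basis.coord i m = 0 := by
  have := M.isInternal.collectedBasis_repr_of_mem_ne
    (fun r => Module.finBasis k (M.grading r)) (a := i.2) (Ne.symm h) hm
  exact this

/-- The matrix coefficients `b^i_j` of the coaction, `δ(x_j) = ∑ i, x_i ⊗ b^i_j`. -/
noncomputable def coef (M : SComod ℬ) (i j : M.Idx) : B :=
  TensorProduct.lid k B ((M.basis.coord i).rTensor B (M.coact (M.basis j)))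

theorem sum_basis_tmul (M : SComod ℬ) (x : M.carrier ⊗[k] B) :
    x = ∑ i, M.basis i ⊗ₜ TensorProduct.lid k B ((M.basis.coord i).rTensor B x) := by
  induction x with
  | zero => simp
  | tmul m b =>
    simp only [LinearMap.rTensor_tmul, TensorProduct.lid_tmul, TensorProduct.tmul_smul,
      TensorProduct.smul_tmul', ← TensorProduct.sum_tmul]
    congr 1
    simpa using (M.basis.sum_repr m).symm
  | add x y hx hy =>
    simp only [map_add, TensorProduct.tmul_add, Finset.sum_add_distrib]
    rw [← hx, ← hy]

theorem coact_basis (M : SComod ℬ) (j : M.Idx) :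
    M.coact (M.basis j) = ∑ i, M.basis i ⊗ₜ M.coef i j :=
  M.sum_basis_tmul _

theorem coef_mem (M : SComod ℬ) (i j : M.Idx) : M.coef i j ∈ ℬ (i.1 + j.1) := by
  have h : tensorGrading M.grading ℬ j.1 ≤ (ℬ (i.1 + j.1)).comap
      ((TensorProduct.lid k B).toLinearMap ∘ₗ (M.basis.coord i).rTensor B) := by
    rw [tensorGrading, Submodule.span_le]
    rintro _ ⟨s, t, m, b, hst, hm, hb, rfl⟩
    simp only [SetLike.mem_coe, Submodule.mem_comap, LinearMap.comp_apply,
      LinearMap.rTensor_tmul, LinearEquiv.coe_coe, TensorProduct.lid_tmul]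
    by_cases hi : i.1 = s
    · have : i.1 + j.1 = t := by
        rw [← hst, hi, ← add_assoc, zmod_two_add_self, zero_add]
      rw [this]
      exact Submodule.smul_mem _ _ hb
    · rw [M.basis_coord_of_ne hm hi, zero_smul]
      exact Submodule.zero_mem _
  exact h (M.even _ _ (M.basis_mem j))

theorem comul_coef (M : SComod ℬ) (i j : M.Idx) :
    CoalgebraStruct.comul (R := k) (M.coef i j) = ∑ l, M.coef i l ⊗ₜ[k] M.coef l j := by
  classical
  have h := LinearMap.congr_fun M.coassoc (M.basis j)
  simp only [LinearMap.comp_apply, coact_basis, map_sum, LinearMap.rTensor_tmul,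
    LinearMap.lTensor_tmul, TensorProduct.sum_tmul, LinearEquiv.coe_coe,
    TensorProduct.assoc_tmul] at h
  have h2 := congrArg (fun x => TensorProduct.lid k (B ⊗[k] B)
    ((M.basis.coord i).rTensor (B ⊗[k] B) x)) h
  simp only [map_sum, LinearMap.rTensor_tmul, TensorProduct.lid_tmul, Module.Basis.coord_apply,
    Module.Basis.repr_self, Finsupp.single_apply, ite_smul, one_smul, zero_smul,
    Finset.sum_ite_eq', Finset.mem_univ, if_true] at h2
  exact h2.symm

open Classical in
theorem counit_coef (M : SComod ℬ) (i j : M.Idx) :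
    CoalgebraStruct.counit (R := k) (M.coef i j) = if i = j then 1 else 0 := by
  have h := LinearMap.congr_fun M.counit (M.basis j)
  simp only [LinearMap.comp_apply, coact_basis, map_sum,
    LinearMap.lTensor_tmul, LinearEquiv.coe_coe, TensorProduct.rid_tmul, LinearMap.id_apply] at h
  have h2 := congrArg (M.basis.coord i) h
  simpa [Finsupp.single_apply, eq_comm] using h2

/-- The supercharacter `χ^s_M = ∑ i, (-1) ^ |i| b^i_i` of `M`, as an element of `B`. -/
noncomputable def scharVal (M : SComod ℬ) : B := ∑ i, sgn k i.1 • M.coef i i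

theorem scharVal_mem (M : SComod ℬ) : M.scharVal ∈ ℬ 0 := by
  refine Submodule.sum_mem _ fun i _ => Submodule.smul_mem _ _ ?_
  have := M.coef_mem i i
  rwa [zmod_two_add_self] at this

/-- The supercharacter `χ^s_M`, an element of the even part of `B`. -/
noncomputable def schar (M : SComod ℬ) : ℬ 0 := ⟨M.scharVal, M.scharVal_mem⟩

end SComod

end Bialgebras

namespace SComod

variable {k : Type u} [Field k] {B : Type u} [Ring B] [Algebra k B] [Coalgebra k B]
  {ℬ : ZMod 2 → Submodule k B} [GradedAlgebra ℬ]

/-- The coaction of the tensor product of two supercomodules,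
`m ⊗ n ↦ ∑ (-1) ^ (|m_1| |n_0|) (m_0 ⊗ n_0) ⊗ m_1 n_1`. -/
noncomputable def tensorCoact (M N : SComod ℬ) :
    M.carrier ⊗[k] N.carrier →ₗ[k] (M.carrier ⊗[k] N.carrier) ⊗[k] B :=
  superShuffle ℬ M.carrier N.carrier N.grading ∘ₗ TensorProduct.map M.coact N.coact

theorem tensorCoact_tmul (M N : SComod ℬ) {κ κ' : Type*} [Fintype κ] [Fintype κ']
    {m : M.carrier} {n : N.carrier} (x : κ → M.carrier) (b : κ → B) (β : κ → ZMod 2)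
    (hb : ∀ i, b i ∈ ℬ (β i)) (hm : M.coact m = ∑ i, x i ⊗ₜ b i)
    (y : κ' → N.carrier) (c : κ' → B) (γ : κ' → ZMod 2) (hy : ∀ l, y l ∈ N.grading (γ l))
    (hn : N.coact n = ∑ l, y l ⊗ₜ c l) :
    tensorCoact M N (m ⊗ₜ n) = ∑ i, ∑ l, (x i ⊗ₜ y l) ⊗ₜ (sgn k (β i * γ l) • (b i * c l)) := by
  simp only [tensorCoact, LinearMap.comp_apply, TensorProduct.map_tmul, hm, hn,
    TensorProduct.sum_tmul, TensorProduct.tmul_sum, map_sum]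
  rw [Finset.sum_comm]
  refine Finset.sum_congr rfl fun i _ => Finset.sum_congr rfl fun l _ => ?_
  rw [superShuffle_tmul ℬ N.grading _ (hb i) (hy l), TensorProduct.tmul_smul]

/-- The matrix coefficients of the tensor product. -/
noncomputable def tensorCoef (M N : SComod ℬ) (x y : M.Idx × N.Idx) : B :=
  sgn k ((x.1.1 + y.1.1) * x.2.1) • (M.coef x.1 y.1 * N.coef x.2 y.2)

theorem tensorCoact_basis (M N : SComod ℬ) (y : M.Idx × N.Idx) :
    tensorCoact M N ((M.basis.tensorProduct N.basis) y) =
      ∑ x, (M.basis.tensorProduct N.basis) x ⊗ₜ tensorCoef M N x y := by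
  simp only [Module.Basis.tensorProduct_apply', ← Finset.univ_product_univ, Finset.sum_product]
  exact tensorCoact_tmul M N M.basis (fun i => M.coef i y.1) (fun i => i.1 + y.1.1)
    (fun i => M.coef_mem i y.1) (M.coact_basis y.1) N.basis (fun l => N.coef l y.2)
    (fun l => l.1) N.basis_mem (N.coact_basis y.2)

theorem comul_tensorCoef [SuperBialgebra ℬ] (M N : SComod ℬ) (x y : M.Idx × N.Idx) :
    CoalgebraStruct.comul (R := k) (tensorCoef M N x y) =
      ∑ z, tensorCoef M N x z ⊗ₜ[k] tensorCoef M N z y := by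
  refine (GradedTensorProduct.of k ℬ ℬ).injective ?_
  rw [tensorCoef, map_smul, map_smul, SuperBialgebra.comul_mul, comul_coef, comul_coef, map_sum,
    map_sum, map_sum, ← Finset.univ_product_univ, Finset.sum_product, Finset.sum_mul_sum,
    Finset.smul_sum]
  refine Finset.sum_congr rfl fun i _ => ?_
  rw [Finset.smul_sum]
  refine Finset.sum_congr rfl fun l _ => ?_
  have h := tmul_mul_tmul ℬ ℬ (M.coef x.1 i) (N.coef x.2 l) (M.coef i y.1) (N.coef l y.2)
    (M.coef_mem i y.1) (N.coef_mem x.2 l)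
  simp only [GradedTensorProduct.tmul] at h
  refine (congrArg _ h).trans ?_
  rw [tensorCoef, tensorCoef, TensorProduct.smul_tmul_smul, map_smul, smul_smul, ← sgn_add,
    ← sgn_add]
  congr 2
  have h2 : (2 : ZMod 2) = 0 := by decide
  linear_combination (y.1.1 * x.2.1) * h2

theorem mul_delta_aux {κ κ' : Type*} (x y : κ × κ') [DecidableEq κ] [DecidableEq κ']
    [DecidableEq (κ × κ')] :
    ((if x.1 = y.1 then 1 else 0) * (if x.2 = y.2 then 1 else 0) : k) = if x = y then 1 else 0 := by
  by_cases h1 : x.1 = y.1 <;> by_cases h2 : x.2 = y.2 <;> simp [h1, h2, Prod.ext_iff]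

open Classical in
theorem counit_tensorCoef [SuperBialgebra ℬ] (M N : SComod ℬ) (x y : M.Idx × N.Idx) :
    CoalgebraStruct.counit (R := k) (tensorCoef M N x y) = if x = y then 1 else 0 := by
  rw [tensorCoef, map_smul, SuperBialgebra.counit_mul (ℬ := ℬ), counit_coef, counit_coef,
    mul_delta_aux]
  split_ifs with h
  · subst h
    simp [zmod_two_add_self]
  · simp

theorem tensor_even (M N : SComod ℬ) (r : ZMod 2)
    (x : M.carrier ⊗[k] N.carrier) (hx : x ∈ tensorGrading M.grading N.grading r) :
    tensorCoact M N x ∈ tensorGrading (tensorGrading M.grading N.grading) ℬ r := by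
  have h : tensorGrading M.grading N.grading r ≤
      (tensorGrading (tensorGrading M.grading N.grading) ℬ r).comap (tensorCoact M N) := by
    conv_lhs => rw [tensorGrading]
    rw [Submodule.span_le]
    rintro _ ⟨s, t, m, n, rfl, hm, hn, rfl⟩
    have h1 := Submodule.apply_mem_map₂ (TensorProduct.mk k (M.carrier ⊗[k] B) (N.carrier ⊗[k] B))
      (M.even s m hm) (N.even t n hn)
    rw [tensorGrading, tensorGrading, Submodule.map₂_span_span] at h1
    have h2 := Submodule.mem_map_of_mem (f := superShuffle ℬ M.carrier N.carrier N.grading) h1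
    rw [Submodule.map_span] at h2
    rw [SetLike.mem_coe, Submodule.mem_comap, tensorCoact, LinearMap.comp_apply,
      TensorProduct.map_tmul]
    refine (Submodule.span_le.2 ?_ : Submodule.span k _ ≤ _) h2
    rintro _ ⟨_, ⟨_, ⟨s1, t1, v, b, rfl, hv, hb, rfl⟩, _, ⟨s2, t2, w, c, rfl, hw, hc, rfl⟩, rfl⟩, rfl⟩
    change superShuffle ℬ M.carrier N.carrier N.grading ((v ⊗ₜ[k] b) ⊗ₜ[k] (w ⊗ₜ[k] c)) ∈ _
    rw [superShuffle_tmul ℬ N.grading _ hb hw]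
    refine Submodule.smul_mem _ _ (tmul_mem_tensorGrading (s := s1 + s2) (t := t1 + t2)
      (tmul_mem_tensorGrading hv hw rfl) (SetLike.mul_mem_graded hb hc) (by abel))
  exact h hx

/-- The tensor product of two supercomodules. -/
@[reducible] noncomputable def tensor [SuperBialgebra ℬ] (M N : SComod ℬ) : SComod ℬ where
  carrier := M.carrier ⊗[k] N.carrier
  grading := tensorGrading M.grading N.grading
  isInternal := by
    refine isInternal_of_basis _ (M.basis.tensorProduct N.basis) (fun x => x.1.1 + x.2.1) ?_ ?_
    · rintro ⟨i, l⟩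
      rw [Module.Basis.tensorProduct_apply]
      exact tmul_mem_tensorGrading (M.basis_mem i) (N.basis_mem l) rfl
    · intro r v hv x hx
      have h : tensorGrading M.grading N.grading r ≤
          LinearMap.ker ((M.basis.tensorProduct N.basis).coord x) := by
        rw [tensorGrading, Submodule.span_le]
        rintro _ ⟨s, t, v, w, rfl, hv, hw, rfl⟩
        rw [SetLike.mem_coe, LinearMap.mem_ker, Module.Basis.coord_apply,
          Module.Basis.tensorProduct_repr_tmul_apply]
        by_cases h1 : x.1.1 = s
        · have h2 : x.2.1 ≠ t := fun h2 => hx (by rw [h1, h2])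
          have := N.basis_coord_of_ne hw h2
          rw [Module.Basis.coord_apply] at this
          rw [this, zero_smul]
        · have := M.basis_coord_of_ne hv h1
          rw [Module.Basis.coord_apply] at this
          rw [this, smul_zero]
      exact h hv
  coact := tensorCoact M N
  coassoc := (M.basis.tensorProduct N.basis).ext fun x => coassoc_at _ _ (tensorCoef M N)
    (tensorCoact_basis M N) (comul_tensorCoef M N) x
  counit := by
    classical
    exact (M.basis.tensorProduct N.basis).ext fun x => counit_at _ _ (tensorCoef M N)
      (tensorCoact_basis M N) (counit_tensorCoef M N) x
  even := tensor_even M N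

/-- The trivial supercomodule `k`, with coaction `1 ↦ 1 ⊗ 1`. -/
@[reducible] noncomputable def unit [SuperBialgebra ℬ] : SComod ℬ where
  carrier := k
  grading r := if r = 0 then ⊤ else ⊥
  isInternal := by
    refine isInternal_of_basis _ (Module.Basis.singleton PUnit.{1} k) (fun _ => 0) (by simp) ?_
    intro r v hv _ hr
    rw [if_neg (Ne.symm hr), Submodule.mem_bot] at hv
    rw [hv, map_zero]
  coact := (TensorProduct.mk k k B).flip 1
  coassoc := by
    refine LinearMap.ext_ring ?_
    have := SuperBialgebra.comul_one (ℬ := ℬ)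
    have h : CoalgebraStruct.comul (R := k) (1 : B) = 1 ⊗ₜ[k] 1 :=
      (GradedTensorProduct.of k ℬ ℬ).injective this
    simp [h]
  counit := by
    refine LinearMap.ext_ring ?_
    simp [SuperBialgebra.counit_one (ℬ := ℬ)]
  even := by
    intro r m hm
    by_cases hr : r = 0
    · subst hr
      exact tmul_mem_tensorGrading hm SetLike.GradedOne.one_mem (add_zero 0)
    · rw [if_neg hr, Submodule.mem_bot] at hm
      subst hm
      rw [map_zero]
      exact Submodule.zero_mem _

/-- The zero supercomodule. -/
@[reducible] noncomputable def zero : SComod ℬ where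
  carrier := PUnit
  grading _ := ⊥
  isInternal := isInternal_of_basis _ (Module.Basis.empty (ι := Empty) PUnit.{u + 1}) (fun _ => 0)
    (fun i => i.elim) (fun _ _ _ (i : Empty) => i.elim)
  coact := 0
  coassoc := by simp
  counit := LinearMap.ext fun _ => rfl
  even := by simp

/-- `f` is a morphism of supercomodules. -/
structure IsHom {M N : SComod ℬ} (f : M.carrier →ₗ[k] N.carrier) : Prop where
  even : ∀ r, ∀ m ∈ M.grading r, f m ∈ N.grading r
  comm : ∀ m, N.coact (f m) = f.rTensor B (M.coact m)

/-- `0 → U → V → W → 0` is a short exact sequence of supercomodules for suitable morphisms. -/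
def IsExtension (U V W : SComod ℬ) : Prop :=
  ∃ (f : U.carrier →ₗ[k] V.carrier) (g : V.carrier →ₗ[k] W.carrier), IsHom f ∧ IsHom g ∧
    Function.Injective f ∧ Function.Exact f g ∧ Function.Surjective g

end SComod

set_option linter.unusedSectionVars false

namespace SComod

variable {k : Type u} [Field k] {B : Type u} [Ring B] [Algebra k B] [Coalgebra k B]
  {ℬ : ZMod 2 → Submodule k B} [GradedAlgebra ℬ]

theorem tensorCoef_mem (M N : SComod ℬ) (x y : M.Idx × N.Idx) :
    tensorCoef M N x y ∈ ℬ ((x.1.1 + y.1.1) + (x.2.1 + y.2.1)) :=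
  Submodule.smul_mem _ _ (SetLike.mul_mem_graded (M.coef_mem _ _) (N.coef_mem _ _))

variable [SuperBialgebra ℬ]

theorem IsHom.id (M : SComod ℬ) : IsHom (M := M) (N := M) LinearMap.id where
  even := fun _ _ h => h
  comm := by simp

theorem IsHom.map {M M' N N' : SComod ℬ} {f : M.carrier →ₗ[k] M'.carrier}
    {g : N.carrier →ₗ[k] N'.carrier} (hf : IsHom f) (hg : IsHom g) :
    IsHom (M := tensor M N) (N := tensor M' N') (TensorProduct.map f g) where
  even := by
    intro r m hm
    have h : tensorGrading M.grading N.grading r ≤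
        (tensorGrading M'.grading N'.grading r).comap (TensorProduct.map f g) := by
      conv_lhs => rw [tensorGrading]
      rw [Submodule.span_le]
      rintro _ ⟨s, t, v, w, hst, hv, hw, rfl⟩
      exact tmul_mem_tensorGrading (hf.even s v hv) (hg.even t w hw) hst
    exact h hm
  comm := by
    have h : tensorCoact M' N' ∘ₗ TensorProduct.map f g =
        (TensorProduct.map f g).rTensor B ∘ₗ tensorCoact M N := by
      refine (M.basis.tensorProduct N.basis).ext fun y => ?_
      have hm : M'.coact (f (M.basis y.1)) = ∑ i, f (M.basis i) ⊗ₜ M.coef i y.1 := by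
        rw [hf.comm, coact_basis, map_sum]; rfl
      have hn : N'.coact (g (N.basis y.2)) = ∑ i, g (N.basis i) ⊗ₜ N.coef i y.2 := by
        rw [hg.comm, coact_basis, map_sum]; rfl
      rw [Module.Basis.tensorProduct_apply', LinearMap.comp_apply, LinearMap.comp_apply,
        TensorProduct.map_tmul,
        tensorCoact_tmul M' N' _ _ (fun i => i.1 + y.1.1) (fun i => M.coef_mem i y.1) hm
          _ _ (fun l => l.1) (fun l => hg.even _ _ (N.basis_mem l)) hn,
        tensorCoact_tmul M N _ _ (fun i => i.1 + y.1.1) (fun i => M.coef_mem i y.1)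
          (M.coact_basis _) _ _ (fun l => l.1) N.basis_mem (N.coact_basis _)]
      simp only [map_sum, LinearMap.rTensor_tmul, TensorProduct.map_tmul]
    exact LinearMap.congr_fun h

theorem IsHom.assoc (M N P : SComod ℬ) :
    IsHom (M := tensor (tensor M N) P) (N := tensor M (tensor N P))
      (TensorProduct.assoc k M.carrier N.carrier P.carrier).toLinearMap where
  even := by
    intro r m hm
    have h : tensorGrading (tensorGrading M.grading N.grading) P.grading r ≤
        (tensorGrading M.grading (tensorGrading N.grading P.grading) r).comap
          (TensorProduct.assoc k M.carrier N.carrier P.carrier).toLinearMap := by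
      conv_lhs => rw [tensorGrading]
      rw [Submodule.span_le]
      rintro _ ⟨s, t, v, w, rfl, hv, hw, rfl⟩
      have h2 : tensorGrading M.grading N.grading s ≤
          (tensorGrading M.grading (tensorGrading N.grading P.grading) (s + t)).comap
          ((TensorProduct.assoc k M.carrier N.carrier P.carrier).toLinearMap ∘ₗ
            (TensorProduct.mk k _ _).flip w) := by
        conv_lhs => rw [tensorGrading]
        rw [Submodule.span_le]
        rintro _ ⟨s', t', v', w', rfl, hv', hw', rfl⟩
        exact tmul_mem_tensorGrading hv' (tmul_mem_tensorGrading hw' hw rfl)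
          (add_assoc s' t' t).symm
      exact h2 hv
    exact h hm
  comm := by
    have h : tensorCoact M (tensor N P) ∘ₗ
          (TensorProduct.assoc k M.carrier N.carrier P.carrier).toLinearMap =
        (TensorProduct.assoc k M.carrier N.carrier P.carrier).toLinearMap.rTensor B ∘ₗ
          tensorCoact (tensor M N) P := by
      refine ((M.basis.tensorProduct N.basis).tensorProduct P.basis).ext fun y => ?_
      have hmn : (tensor M N).coact (M.basis y.1.1 ⊗ₜ N.basis y.1.2) =
          ∑ x : M.Idx × N.Idx, (M.basis x.1 ⊗ₜ N.basis x.2) ⊗ₜ tensorCoef M N x y.1 := by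
        simpa only [Module.Basis.tensorProduct_apply'] using tensorCoact_basis M N y.1
      have hnp : (tensor N P).coact (N.basis y.1.2 ⊗ₜ P.basis y.2) =
          ∑ x : N.Idx × P.Idx, (N.basis x.1 ⊗ₜ P.basis x.2) ⊗ₜ
            tensorCoef N P x (y.1.2, y.2) := by
        simpa only [Module.Basis.tensorProduct_apply'] using tensorCoact_basis N P (y.1.2, y.2)
      have h1 := tensorCoact_tmul M (tensor N P) M.basis (fun i => M.coef i y.1.1) (fun i => i.1 + y.1.1.1)
          (fun i => M.coef_mem i y.1.1) (M.coact_basis _) _ (fun x => tensorCoef N P x (y.1.2, y.2))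
          (fun l => l.1.1 + l.2.1)
          (fun l => tmul_mem_tensorGrading (N.basis_mem l.1) (P.basis_mem l.2) rfl) hnp
      have h2 := tensorCoact_tmul (tensor M N) P _ (fun x => tensorCoef M N x y.1)
          (fun x => (x.1.1 + y.1.1.1) + (x.2.1 + y.1.2.1)) (fun x => tensorCoef_mem M N x y.1)
          hmn P.basis (fun l => P.coef l y.2) (fun l => l.1) P.basis_mem (P.coact_basis y.2)
      simp only [Module.Basis.tensorProduct_apply']
      rw [LinearMap.comp_apply, LinearMap.comp_apply, LinearEquiv.coe_coe,
        TensorProduct.assoc_tmul, h1, h2]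
      simp only [map_sum, LinearMap.rTensor_tmul, LinearEquiv.coe_coe, TensorProduct.assoc_tmul,
        ← Finset.univ_product_univ, Finset.sum_product]
      refine Finset.sum_congr rfl fun i _ => Finset.sum_congr rfl fun l _ =>
        Finset.sum_congr rfl fun q _ => ?_
      congr 1
      simp only [tensorCoef, mul_smul_comm, smul_mul_assoc, smul_smul, ← sgn_add, mul_assoc]
      congr 2
      ring
    exact LinearMap.congr_fun h

theorem IsHom.lid (M : SComod ℬ) :
    IsHom (M := tensor unit M) (N := M) (TensorProduct.lid k M.carrier).toLinearMap where
  even := by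
    intro r m hm
    have h : tensorGrading (unit (ℬ := ℬ)).grading M.grading r ≤
        (M.grading r).comap (TensorProduct.lid k M.carrier).toLinearMap := by
      conv_lhs => rw [tensorGrading]
      rw [Submodule.span_le]
      rintro _ ⟨s, t, v, w, rfl, hv, hw, rfl⟩
      change (TensorProduct.lid k M.carrier) ((v : k) ⊗ₜ w) ∈ M.grading (s + t)
      rw [TensorProduct.lid_tmul]
      rcases zmod_two_cases s with rfl | rfl
      · rw [zero_add]
        exact Submodule.smul_mem _ _ hw
      · have hv' : (v : k) = 0 := hv
        rw [hv', zero_smul]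
        exact Submodule.zero_mem _
    exact h hm
  comm := by
    have h : M.coact ∘ₗ (TensorProduct.lid k M.carrier).toLinearMap =
        (TensorProduct.lid k M.carrier).toLinearMap.rTensor B ∘ₗ tensorCoact unit M := by
      refine TensorProduct.ext (LinearMap.ext_ring (M.basis.ext fun j => ?_))
      have h1 : (unit (ℬ := ℬ)).coact (1 : k) = ∑ _i : PUnit.{1}, (1 : k) ⊗ₜ (1 : B) := by
        simp [unit]
      have h2 := tensorCoact_tmul unit M (fun _ => (1 : k)) _ (fun _ => 0)
        (fun _ => SetLike.GradedOne.one_mem) h1 _ _ (fun l => l.1) M.basis_mem (M.coact_basis j)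
      change M.coact (TensorProduct.lid k M.carrier ((1 : k) ⊗ₜ M.basis j)) =
        (TensorProduct.lid k M.carrier).toLinearMap.rTensor B
          (tensorCoact unit M ((1 : k) ⊗ₜ[k] M.basis j))
      rw [h2, TensorProduct.lid_tmul, one_smul, coact_basis]
      simp only [Finset.univ_unique, Finset.sum_singleton, map_sum, zero_mul, sgn_zero, one_smul,
        one_mul]
      refine Finset.sum_congr rfl fun i _ => ?_
      change _ = (TensorProduct.lid k M.carrier ((1 : k) ⊗ₜ M.basis i)) ⊗ₜ[k] _
      rw [TensorProduct.lid_tmul, one_smul]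
      rfl
    exact LinearMap.congr_fun h

theorem IsHom.rid (M : SComod ℬ) :
    IsHom (M := tensor M unit) (N := M) (TensorProduct.rid k M.carrier).toLinearMap where
  even := by
    intro r m hm
    have h : tensorGrading M.grading (unit (ℬ := ℬ)).grading r ≤
        (M.grading r).comap (TensorProduct.rid k M.carrier).toLinearMap := by
      conv_lhs => rw [tensorGrading]
      rw [Submodule.span_le]
      rintro _ ⟨s, t, v, w, rfl, hv, hw, rfl⟩
      change (TensorProduct.rid k M.carrier) (v ⊗ₜ (w : k)) ∈ M.grading (s + t)
      rw [TensorProduct.rid_tmul]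
      rcases zmod_two_cases t with rfl | rfl
      · rw [add_zero]
        exact Submodule.smul_mem _ _ hv
      · have hw' : (w : k) = 0 := hw
        rw [hw', zero_smul]
        exact Submodule.zero_mem _
    exact h hm
  comm := by
    have h : M.coact ∘ₗ (TensorProduct.rid k M.carrier).toLinearMap =
        (TensorProduct.rid k M.carrier).toLinearMap.rTensor B ∘ₗ tensorCoact M unit := by
      refine TensorProduct.ext (M.basis.ext fun j => LinearMap.ext_ring ?_)
      have h1 : (unit (ℬ := ℬ)).coact (1 : k) = ∑ _i : PUnit.{1}, (1 : k) ⊗ₜ (1 : B) := by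
        simp [unit]
      have h2 := tensorCoact_tmul M unit _ _ (fun i => i.1 + j.1) (fun i => M.coef_mem i j)
        (M.coact_basis j) (fun _ => (1 : k)) _ (fun _ => 0) (fun _ => trivial) h1
      change M.coact (TensorProduct.rid k M.carrier (M.basis j ⊗ₜ (1 : k))) =
        (TensorProduct.rid k M.carrier).toLinearMap.rTensor B
          (tensorCoact M unit (M.basis j ⊗ₜ[k] (1 : k)))
      rw [h2, TensorProduct.rid_tmul, one_smul, coact_basis]
      simp only [Finset.univ_unique, Finset.sum_singleton, map_sum, mul_zero, sgn_zero, one_smul,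
        mul_one]
      refine Finset.sum_congr rfl fun i _ => ?_
      change _ = (TensorProduct.rid k M.carrier (M.basis i ⊗ₜ (1 : k))) ⊗ₜ[k] _
      rw [TensorProduct.rid_tmul, one_smul]
      rfl
    exact LinearMap.congr_fun h

theorem IsExtension.tensor_right {U V W : SComod ℬ} (h : IsExtension U V W) (N : SComod ℬ) :
    IsExtension (tensor U N) (tensor V N) (tensor W N) := by
  obtain ⟨f, g, hf, hg, h1, h2, h3⟩ := h
  exact ⟨_, _, hf.map (IsHom.id N), hg.map (IsHom.id N),
    Module.Flat.rTensor_preserves_injective_linearMap f h1,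
    rTensor_exact N.carrier h2 h3, LinearMap.rTensor_surjective N.carrier h3⟩

theorem IsExtension.tensor_left {U V W : SComod ℬ} (h : IsExtension U V W) (N : SComod ℬ) :
    IsExtension (tensor N U) (tensor N V) (tensor N W) := by
  obtain ⟨f, g, hf, hg, h1, h2, h3⟩ := h
  exact ⟨_, _, (IsHom.id N).map hf, (IsHom.id N).map hg,
    Module.Flat.lTensor_preserves_injective_linearMap f h1,
    lTensor_exact N.carrier h2 h3, LinearMap.lTensor_surjective N.carrier h3⟩

theorem isExtension_of_bijective {V W : SComod ℬ} {f : V.carrier →ₗ[k] W.carrier} (hf : IsHom f)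
    (h : Function.Bijective f) : IsExtension zero V W := by
  refine ⟨0, f, ⟨?_, ?_⟩, hf, fun _ _ _ => rfl, fun y => ?_, h.2⟩
  · intro r m _
    exact Submodule.zero_mem _
  · intro m
    simp
  · constructor
    · intro hy
      exact ⟨PUnit.unit, (h.1 (by rw [hy]; exact (map_zero f).symm)).symm⟩
    · rintro ⟨x, rfl⟩
      simp

end SComod

section Grothendieck

variable {k : Type u} [Field k] {B : Type u} [Ring B] [Algebra k B] [Coalgebra k B]
  (ℬ : ZMod 2 → Submodule k B)

/-- The relations `[V] = [U] + [W]` that define the Grothendieck group. -/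
def extensionRelations : AddSubgroup (FreeAbelianGroup (SComod ℬ)) :=
  AddSubgroup.closure {x | ∃ U V W : SComod ℬ, SComod.IsExtension U V W ∧
    x = FreeAbelianGroup.of V - (FreeAbelianGroup.of U + FreeAbelianGroup.of W)}

/-- The Grothendieck ring `K_0` of the category of finite-dimensional right supercomodules. -/
def GrothendieckRing : Type (u + 1) := FreeAbelianGroup (SComod ℬ) ⧸ extensionRelations ℬ

namespace GrothendieckRing

noncomputable instance : AddCommGroup (GrothendieckRing ℬ) :=
  inferInstanceAs (AddCommGroup (FreeAbelianGroup (SComod ℬ) ⧸ extensionRelations ℬ))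

variable {ℬ}

/-- The class `[V]` of a supercomodule. -/
def cls (V : SComod ℬ) : GrothendieckRing ℬ :=
  QuotientAddGroup.mk (FreeAbelianGroup.of V)

theorem cls_extension {U V W : SComod ℬ} (h : SComod.IsExtension U V W) :
    cls V = cls U + cls W := by
  refine (QuotientAddGroup.eq_iff_sub_mem (N := extensionRelations ℬ)).2 ?_
  exact AddSubgroup.subset_closure ⟨U, V, W, h, rfl⟩

theorem induction {P : GrothendieckRing ℬ → Prop} (zero : P 0) (cls : ∀ V, P (cls V))
    (neg : ∀ x, P x → P (-x)) (add : ∀ x y, P x → P y → P (x + y)) (x : GrothendieckRing ℬ) :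
    P x := by
  obtain ⟨y, rfl⟩ := QuotientAddGroup.mk_surjective x
  induction y using FreeAbelianGroup.induction_on with
  | zero => exact zero
  | of V => exact cls V
  | neg V h => exact neg _ h
  | add y z hy hz => exact add _ _ hy hz

/-- Additive maps out of the Grothendieck group. -/
noncomputable def lift {G : Type*} [AddCommGroup G] (φ : SComod ℬ → G)
    (h : ∀ U V W, SComod.IsExtension U V W → φ V = φ U + φ W) : GrothendieckRing ℬ →+ G :=
  QuotientAddGroup.lift (extensionRelations ℬ) (FreeAbelianGroup.lift φ) (by
    rw [extensionRelations, AddSubgroup.closure_le]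
    rintro _ ⟨U, V, W, hUVW, rfl⟩
    rw [SetLike.mem_coe, AddMonoidHom.mem_ker]
    simp [h U V W hUVW])

theorem lift_cls {G : Type*} [AddCommGroup G] (φ : SComod ℬ → G)
    (h : ∀ U V W, SComod.IsExtension U V W → φ V = φ U + φ W) (V : SComod ℬ) :
    lift φ h (cls V) = φ V :=
  FreeAbelianGroup.lift_apply_of φ V

variable [GradedAlgebra ℬ] [SuperBialgebra ℬ]

theorem cls_zero : cls (SComod.zero (ℬ := ℬ)) = 0 := by
  have := cls_extension (SComod.isExtension_of_bijective (SComod.IsHom.id (SComod.zero (ℬ := ℬ)))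
    Function.bijective_id)
  simpa using this

theorem cls_eq {V W : SComod ℬ} {f : V.carrier →ₗ[k] W.carrier} (hf : SComod.IsHom f)
    (h : Function.Bijective f) : cls V = cls W := by
  rw [cls_extension (SComod.isExtension_of_bijective hf h), cls_zero, zero_add]

/-- The multiplication of the Grothendieck ring as a biadditive map. -/
noncomputable def mulHom : GrothendieckRing ℬ →+ GrothendieckRing ℬ →+ GrothendieckRing ℬ :=
  lift (fun V => lift (fun W => cls (V.tensor W)) fun _ _ _ h => cls_extension (h.tensor_left V))
    fun U V W h => by
      refine AddMonoidHom.ext fun x => ?_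
      induction x using induction with
      | zero => simp
      | cls N =>
        rw [AddMonoidHom.add_apply, lift_cls, lift_cls, lift_cls]
        exact cls_extension (h.tensor_right N)
      | neg x hx => rw [map_neg, map_neg, hx]
      | add x y hx hy => rw [map_add, map_add, hx, hy]

noncomputable instance : Mul (GrothendieckRing ℬ) := ⟨fun x y => mulHom x y⟩

noncomputable instance : One (GrothendieckRing ℬ) := ⟨cls SComod.unit⟩

theorem cls_mul_cls (V W : SComod ℬ) : cls V * cls W = cls (V.tensor W) := by
  change mulHom (cls V) (cls W) = _
  rw [mulHom, lift_cls, lift_cls]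

theorem one_eq : (1 : GrothendieckRing ℬ) = cls SComod.unit := rfl

theorem mul_add_aux (x y z : GrothendieckRing ℬ) : x * (y + z) = x * y + x * z :=
  map_add (mulHom x) y z

theorem add_mul_aux (x y z : GrothendieckRing ℬ) : (x + y) * z = x * z + y * z := by
  change mulHom (x + y) z = mulHom x z + mulHom y z
  rw [map_add, AddMonoidHom.add_apply]

theorem mul_neg_aux (x y : GrothendieckRing ℬ) : x * (-y) = -(x * y) := map_neg (mulHom x) y

theorem neg_mul_aux (x y : GrothendieckRing ℬ) : (-x) * y = -(x * y) := by
  change mulHom (-x) y = - mulHom x y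
  rw [map_neg, AddMonoidHom.neg_apply]

theorem mul_zero_aux (x : GrothendieckRing ℬ) : x * 0 = 0 := map_zero (mulHom x)

theorem zero_mul_aux (x : GrothendieckRing ℬ) : 0 * x = 0 := by
  change mulHom 0 x = 0
  rw [map_zero, AddMonoidHom.zero_apply]

theorem mul_assoc_aux (x y z : GrothendieckRing ℬ) : x * y * z = x * (y * z) := by
  induction x using induction with
  | zero => simp only [zero_mul_aux]
  | neg x hx => simp only [neg_mul_aux, hx]
  | add x x' hx hx' => simp only [add_mul_aux, hx, hx']
  | cls U =>
    induction y using induction with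
    | zero => simp only [zero_mul_aux, mul_zero_aux]
    | neg x hx => simp only [neg_mul_aux, mul_neg_aux, hx]
    | add x x' hx hx' => simp only [add_mul_aux, mul_add_aux, hx, hx']
    | cls V =>
      induction z using induction with
      | zero => simp only [mul_zero_aux]
      | neg x hx => simp only [mul_neg_aux, hx]
      | add x x' hx hx' => simp only [mul_add_aux, hx, hx']
      | cls W =>
        simp only [cls_mul_cls]
        exact cls_eq (SComod.IsHom.assoc U V W) (LinearEquiv.bijective _)

noncomputable instance : Ring (GrothendieckRing ℬ) where
  __ := (inferInstance : AddCommGroup (GrothendieckRing ℬ))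
  left_distrib := mul_add_aux
  right_distrib := add_mul_aux
  zero_mul := zero_mul_aux
  mul_zero := mul_zero_aux
  mul_assoc := mul_assoc_aux
  one_mul x := by
    induction x using induction with
    | zero => exact mul_zero_aux _
    | neg x hx => rw [mul_neg_aux, hx]
    | add x x' hx hx' => rw [mul_add_aux, hx, hx']
    | cls V =>
      rw [one_eq, cls_mul_cls]
      exact cls_eq (SComod.IsHom.lid V) (LinearEquiv.bijective _)
  mul_one x := by
    induction x using induction with
    | zero => exact zero_mul_aux _
    | neg x hx => rw [neg_mul_aux, hx]
    | add x x' hx hx' => rw [add_mul_aux, hx, hx']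
    | cls V =>
      rw [one_eq, cls_mul_cls]
      exact cls_eq (SComod.IsHom.rid V) (LinearEquiv.bijective _)

end GrothendieckRing

end Grothendieck

section EndA

variable {k : Type u} [Field k] {ι : Type} [Fintype ι] {p : ι → ZMod 2} {N : ℕ}

namespace HomRel

theorem endo_linearMap_ext {M : Type*} [AddCommGroup M] [Module k M] (R : HomRel k p N)
    {f g : R.endo.Alg →ₗ[k] M}
    (h : ∀ (n : ℕ) (I J : Fin n → ι), f (R.zcoef I J) = g (R.zcoef I J)) : f = g := by
  refine R.endo.linearMap_ext fun n W => ?_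
  have h1 := h n (fun a => (W a).1) (fun a => (W a).2)
  rw [zcoef, map_smul, map_smul] at h1
  have h2 := congrArg
    (fun x => sgn k (coefSign p (fun a => (W a).1) (fun a => (W a).2)) • x) h1
  simpa only [smul_smul, sgn_mul_self, one_smul] using h2

theorem of_symm_tmul (R : HomRel k p N) (a b : R.endo.Alg) :
    (GradedTensorProduct.of k R.endo.par R.endo.par).symm
      (a ᵍ⊗ₜ[k] b : R.endo.par ᵍ⊗[k] R.endo.par) = a ⊗ₜ[k] b := rfl

/-- The comultiplication of `end A` as a linear map. -/
noncomputable def comulLin (R : HomRel k p N) : R.endo.Alg →ₗ[k] R.endo.Alg ⊗[k] R.endo.Alg :=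
  (GradedTensorProduct.of k R.endo.par R.endo.par).symm.toLinearMap ∘ₗ R.comulHom.toLinearMap

theorem comulLin_zcoef (R : HomRel k p N) {n : ℕ} (I J : Fin n → ι) :
    R.comulLin (R.zcoef I J) = ∑ K : Fin n → ι, R.zcoef I K ⊗ₜ[k] R.zcoef K J := by
  have h : R.comulLin (R.zcoef I J) =
    (GradedTensorProduct.of k R.endo.par R.endo.par).symm (R.comulHom (R.zcoef I J)) := rfl
  rw [h, comulHom_zcoef, map_sum]
  rfl

noncomputable instance (R : HomRel k p N) : Coalgebra k R.endo.Alg where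
  comul := R.comulLin
  counit := R.counitHom.toLinearMap
  coassoc := by
    refine R.endo_linearMap_ext fun n I J => ?_
    simp only [LinearMap.comp_apply, comulLin_zcoef, map_sum, LinearMap.rTensor_tmul,
      LinearMap.lTensor_tmul, TensorProduct.sum_tmul, TensorProduct.tmul_sum, LinearEquiv.coe_coe,
      TensorProduct.assoc_tmul]
    exact Finset.sum_comm
  rTensor_counit_comp_comul := by
    refine R.endo_linearMap_ext fun n I J => ?_
    simp [comulLin_zcoef, counitHom_zcoef, TensorProduct.ite_tmul]
  lTensor_counit_comp_comul := by
    refine R.endo_linearMap_ext fun n I J => ?_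
    simp [comulLin_zcoef, counitHom_zcoef, TensorProduct.tmul_ite]

theorem comul_zcoef (R : HomRel k p N) {n : ℕ} (I J : Fin n → ι) :
    CoalgebraStruct.comul (R := k) (R.zcoef I J) =
      ∑ K : Fin n → ι, R.zcoef I K ⊗ₜ[k] R.zcoef K J :=
  R.comulLin_zcoef I J

open Classical in
theorem counit_zcoef (R : HomRel k p N) {n : ℕ} (I J : Fin n → ι) :
    CoalgebraStruct.counit (R := k) (R.zcoef I J) = if I = J then 1 else 0 :=
  R.counitHom_zcoef I J

theorem of_comul (R : HomRel k p N) (a : R.endo.Alg) :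
    GradedTensorProduct.of k R.endo.par R.endo.par (CoalgebraStruct.comul (R := k) a) =
      R.comulHom a := rfl

theorem endo_par_le (R : HomRel k p N) (r : ZMod 2) (S : Submodule k R.endo.Alg)
    (h : ∀ (n : ℕ) (I J : Fin n → ι), tpar p I + tpar p J = r → R.zcoef I J ∈ S) :
    R.endo.par r ≤ S := by
  rw [par, Submodule.span_le]
  rintro _ ⟨n, W, hW, rfl⟩
  have h0 : tpar (fun x : ι × ι => p x.1 + p x.2) W =
      tpar p (fun a => (W a).1) + tpar p (fun a => (W a).2) := by
    simp [tpar, Finset.sum_add_distrib]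
  have h1 := h n _ _ (h0.symm.trans hW)
  have h2 := S.smul_mem (sgn k (coefSign p (fun a => (W a).1) (fun a => (W a).2))) h1
  rw [zcoef, smul_smul, sgn_mul_self, one_smul] at h2
  exact h2

instance (R : HomRel k p N) : SuperBialgebra R.endo.par where
  comul_one := by rw [of_comul, map_one]
  comul_mul a b := by simp only [of_comul, map_mul]
  counit_one := map_one R.counitHom
  counit_mul := map_mul R.counitHom
  comul_even r b hb := by
    refine R.endo_par_le r ((tensorGrading R.endo.par R.endo.par r).comap
      (CoalgebraStruct.comul (R := k) (A := R.endo.Alg))) ?_ hb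
    intro n I J hIJ
    rw [Submodule.mem_comap, comul_zcoef]
    refine Submodule.sum_mem _ fun K _ => ?_
    refine tmul_mem_tensorGrading (R.zcoef_mem_par I K) (R.zcoef_mem_par K J) ?_
    rw [← hIJ]
    linear_combination zmod_two_add_self (tpar p K)
  counit_even b hb := by
    refine R.endo_par_le 1 (LinearMap.ker
      (CoalgebraStruct.counit (R := k) (A := R.endo.Alg))) ?_ hb
    intro n I J hIJ
    rw [LinearMap.mem_ker, counit_zcoef, if_neg]
    rintro rfl
    rw [zmod_two_add_self] at hIJ
    exact zero_ne_one hIJ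

end HomRel

end EndA

section Subcomodules

variable {k : Type u} [Field k] {B : Type u} [Ring B] [Algebra k B]

/-- The subspace `S` of `M` is a subcomodule for `δ`, that is, `δ(S) ⊆ S ⊗ B`. -/
def Costable {M : Type u} [AddCommGroup M] [Module k M] (δ : M →ₗ[k] M ⊗[k] B)
    (S : Submodule k M) : Prop :=
  ∀ x ∈ S, δ x ∈ LinearMap.range (S.subtype.rTensor B)

theorem mem_range_rTensor_iff {M : Type u} [AddCommGroup M] [Module k M]
    (S : Submodule k M) (x : M ⊗[k] B) : x ∈ LinearMap.range (S.subtype.rTensor B) ↔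
      ∀ f : B →ₗ[k] k, TensorProduct.rid k M (f.lTensor M x) ∈ S := by
  constructor
  · rintro ⟨y, rfl⟩ f
    induction y with
    | zero => simp
    | tmul s b =>
      simp only [LinearMap.rTensor_tmul, LinearMap.lTensor_tmul, TensorProduct.rid_tmul]
      exact S.smul_mem _ s.2
    | add y z hy hz =>
      simp only [map_add]
      exact S.add_mem hy hz
  · intro h
    classical
    let b := Module.Basis.ofVectorSpace k B
    have key : x = (TensorProduct.equivFinsuppOfBasisRight b x).sum fun i m => m ⊗ₜ[k] b i := by
      conv_lhs => rw [← (TensorProduct.equivFinsuppOfBasisRight b).symm_apply_apply x]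
      exact LinearMap.congr_fun (TensorProduct.equivFinsuppOfBasisRight_symm b) _
    have hm : ∀ i, TensorProduct.equivFinsuppOfBasisRight b x i ∈ S := by
      intro i
      have : TensorProduct.equivFinsuppOfBasisRight b x i =
          TensorProduct.rid k M ((b.coord i).lTensor M x) := by
        rw [TensorProduct.equivFinsuppOfBasisRight_apply]
      rw [this]
      exact h _
    rw [key]
    exact Submodule.sum_mem _ fun i _ => ⟨(⟨_, hm i⟩ : S) ⊗ₜ b i, by simp⟩

/-- The subspace `S` of the superspace `M` is `ℤ/2`-graded. -/
def IsGradedSub {M : Type u} [AddCommGroup M] [Module k M] (ℳ : ZMod 2 → Submodule k M)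
    [DirectSum.Decomposition ℳ] (S : Submodule k M) : Prop :=
  ∀ r, ∀ x ∈ S, superProj ℳ r x ∈ S

theorem rTensor_subtype_injective {M : Type u} [AddCommGroup M] [Module k M] (S : Submodule k M)
    (C : Type u) [AddCommGroup C] [Module k C] : Function.Injective (S.subtype.rTensor C) :=
  Module.Flat.rTensor_preserves_injective_linearMap _ S.injective_subtype

/-- The restriction of the coaction `δ` to a subcomodule `S`. -/
noncomputable def subCoact {M : Type u} [AddCommGroup M] [Module k M] (δ : M →ₗ[k] M ⊗[k] B)
    (S : Submodule k M) (hS : Costable δ S) : S →ₗ[k] S ⊗[k] B :=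
  (LinearEquiv.ofInjective _ (rTensor_subtype_injective S B)).symm.toLinearMap ∘ₗ
    (δ ∘ₗ S.subtype).codRestrict _ fun x => hS x x.2

theorem subCoact_spec {M : Type u} [AddCommGroup M] [Module k M] (δ : M →ₗ[k] M ⊗[k] B)
    (S : Submodule k M) (hS : Costable δ S) (x : S) :
    S.subtype.rTensor B (subCoact δ S hS x) = δ x :=
  congrArg Subtype.val ((LinearEquiv.ofInjective _ (rTensor_subtype_injective S B)).apply_symm_apply
      ((δ ∘ₗ S.subtype).codRestrict _ (fun x => hS x x.2) x))

variable [Coalgebra k B] {ℬ : ZMod 2 → Submodule k B} [GradedAlgebra ℬ]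

/-- A finite-dimensional graded subcomodule of a (possibly infinite-dimensional) supercomodule
`M`, as a supercomodule. -/
noncomputable def SComod.ofSub {M : Type u} [AddCommGroup M] [Module k M]
    (ℳ : ZMod 2 → Submodule k M) [DirectSum.Decomposition ℳ] (δ : M →ₗ[k] M ⊗[k] B)
    (coassoc : (TensorProduct.assoc k M B B).toLinearMap ∘ₗ δ.rTensor B ∘ₗ δ =
      (CoalgebraStruct.comul (R := k) (A := B)).lTensor M ∘ₗ δ)
    (counit : (TensorProduct.rid k M).toLinearMap ∘ₗ
      (CoalgebraStruct.counit (R := k) (A := B)).lTensor M ∘ₗ δ = LinearMap.id)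
    (even : ∀ r, ∀ m ∈ ℳ r, δ m ∈ tensorGrading ℳ ℬ r)
    (S : Submodule k M) (hfin : Module.Finite k S) (hgr : IsGradedSub ℳ S)
    (hS : Costable δ S) : SComod ℬ where
  carrier := S
  grading := fun r => (ℳ r).comap S.subtype
  isInternal := by
    rw [DirectSum.isInternal_submodule_iff_iSupIndep_and_iSup_eq_top]
    refine ⟨fun r => ?_, ?_⟩
    · rw [Submodule.disjoint_def]
      intro v hv hv'
      have hle : (⨆ (s : ZMod 2) (_ : s ≠ r), (ℳ s).comap S.subtype) ≤
          LinearMap.ker (superProj ℳ r ∘ₗ S.subtype) := by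
        refine iSup₂_le fun s hs w hw => ?_
        rw [LinearMap.mem_ker, LinearMap.comp_apply, superProj_of_mem ℳ hw, if_neg (Ne.symm hs)]
      have h1 : superProj ℳ r (v : M) = 0 := hle hv'
      rw [superProj_of_mem ℳ (v := (v : M)) hv, if_pos rfl] at h1
      exact Subtype.ext h1
    · rw [eq_top_iff]
      rintro x -
      have hx : x = ∑ r, ⟨superProj ℳ r x, hgr r x x.2⟩ := by
        refine Subtype.ext ?_
        rw [AddSubmonoidClass.coe_finsetSum]
        exact (sum_superProj ℳ (x : M)).symm
      rw [hx]
      exact Submodule.sum_mem _ fun r _ => Submodule.mem_iSup_of_mem r (superProj_mem ℳ r (x : M))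
  coact := subCoact δ S hS
  coassoc := by
    refine LinearMap.ext fun x => rTensor_subtype_injective S (B ⊗[k] B) ?_
    have hδ := subCoact_spec δ S hS
    generalize subCoact δ S hS = δS at hδ ⊢
    have hδ' : S.subtype.rTensor B ∘ₗ δS = δ ∘ₗ S.subtype := LinearMap.ext hδ
    have h1 : S.subtype.rTensor (B ⊗[k] B) ∘ₗ (TensorProduct.assoc k S B B).toLinearMap ∘ₗ
        δS.rTensor B = (TensorProduct.assoc k M B B).toLinearMap ∘ₗ δ.rTensor B ∘ₗ
          S.subtype.rTensor B := by
      rw [← LinearMap.rTensor_comp, ← hδ', LinearMap.rTensor_comp]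
      refine LinearMap.ext fun y => ?_
      simp only [LinearMap.comp_apply, LinearEquiv.coe_coe]
      generalize δS.rTensor B y = z
      have : S.subtype.rTensor (B ⊗[k] B) ∘ₗ (TensorProduct.assoc k S B B).toLinearMap =
        (TensorProduct.assoc k M B B).toLinearMap ∘ₗ (S.subtype.rTensor B).rTensor B := by
        ext; rfl
      exact LinearMap.congr_fun this z
    have h2 : S.subtype.rTensor (B ⊗[k] B) ∘ₗ
        (CoalgebraStruct.comul (R := k) (A := B)).lTensor S =
        (CoalgebraStruct.comul (R := k) (A := B)).lTensor M ∘ₗ S.subtype.rTensor B := by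
      rw [LinearMap.rTensor_comp_lTensor, LinearMap.lTensor_comp_rTensor]
    have e1 := LinearMap.congr_fun h1 (δS x)
    have e2 := LinearMap.congr_fun h2 (δS x)
    have e3 := LinearMap.congr_fun coassoc (x : M)
    simp only [LinearMap.comp_apply] at e1 e2 e3 ⊢
    rw [e1, e2, hδ, e3]
  counit := by
    refine LinearMap.ext fun x => S.injective_subtype ?_
    have hδ := subCoact_spec δ S hS
    generalize subCoact δ S hS = δS at hδ ⊢
    have h1 : S.subtype ∘ₗ (TensorProduct.rid k S).toLinearMap ∘ₗ
        (CoalgebraStruct.counit (R := k) (A := B)).lTensor S =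
        (TensorProduct.rid k M).toLinearMap ∘ₗ
        (CoalgebraStruct.counit (R := k) (A := B)).lTensor M ∘ₗ S.subtype.rTensor B := by
      ext; simp
    have e1 := LinearMap.congr_fun h1 (δS x)
    have e3 := LinearMap.congr_fun counit (x : M)
    simp only [LinearMap.comp_apply] at e1 e3 ⊢
    rw [e1, hδ, e3]
    rfl
  even := by
    intro r x hx
    let π : ZMod 2 → S →ₗ[k] S := fun s =>
      (superProj ℳ s).restrict (p := S) (q := S) fun y hy => hgr s y hy
    let PS : S ⊗[k] B →ₗ[k] S ⊗[k] B := ∑ s, TensorProduct.map (π s) (superProj ℬ (r - s))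
    let PM : M ⊗[k] B →ₗ[k] M ⊗[k] B :=
      ∑ s, TensorProduct.map (superProj ℳ s) (superProj ℬ (r - s))
    have h1 : ∀ y, S.subtype.rTensor B (PS y) = PM (S.subtype.rTensor B y) := by
      intro y
      have : S.subtype.rTensor B ∘ₗ PS = PM ∘ₗ S.subtype.rTensor B := by
        refine TensorProduct.ext' fun s b => ?_
        simp [PS, PM, π]
      exact LinearMap.congr_fun this y
    have h2 : ∀ y, PS y ∈ tensorGrading (fun r => (ℳ r).comap S.subtype) ℬ r := by
      intro y
      induction y with
      | zero => rw [map_zero]; exact Submodule.zero_mem _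
      | tmul s b =>
        simp only [PS, LinearMap.sum_apply, TensorProduct.map_tmul]
        refine Submodule.sum_mem _ fun s' _ => tmul_mem_tensorGrading (s := s') (t := r - s')
          (superProj_mem ℳ s' (s : M)) (superProj_mem ℬ _ _) (by abel)
      | add y z hy hz => rw [map_add]; exact Submodule.add_mem _ hy hz
    have h3 : ∀ y ∈ tensorGrading ℳ ℬ r, PM y = y := by
      intro y hy
      have hle : tensorGrading ℳ ℬ r ≤ LinearMap.ker (PM - LinearMap.id) := by
        rw [tensorGrading, Submodule.span_le]
        rintro _ ⟨s, t, v, w, rfl, hv, hw, rfl⟩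
        rw [SetLike.mem_coe, LinearMap.mem_ker, LinearMap.sub_apply, sub_eq_zero]
        simp only [PM, LinearMap.sum_apply, TensorProduct.map_tmul, superProj_of_mem ℳ hv,
          superProj_of_mem ℬ hw]
        rw [Finset.sum_eq_single s]
        · simp
        · intro s' _ hs'
          simp [hs']
        · simp
      have := hle hy
      rwa [LinearMap.mem_ker, LinearMap.sub_apply, sub_eq_zero] at this
    have hδ := subCoact_spec δ S hS
    generalize subCoact δ S hS = δS at hδ ⊢
    have h4 : δS x = PS (δS x) := by
      refine rTensor_subtype_injective S B ?_
      rw [h1, hδ, h3 (δ x) (even r x hx)]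
    rw [h4]
    exact h2 _

end Subcomodules

section Components

variable {k : Type u} [Field k] {ι : Type} [Fintype ι] {p : ι → ZMod 2} {N : ℕ}

namespace HomRel

/-- The coaction of `end A(V, R)` on `A(V, S)`, as a linear map. -/
noncomputable def coactLin (R S : HomRel k p N) (h : R.Coacts S) :
    S.Alg →ₗ[k] S.Alg ⊗[k] R.endo.Alg :=
  (GradedTensorProduct.of k S.par R.endo.par).symm.toLinearMap ∘ₗ (R.coaction S h).toLinearMap

theorem of_coactLin (R S : HomRel k p N) (h : R.Coacts S) (x : S.Alg) :
    GradedTensorProduct.of k S.par R.endo.par (R.coactLin S h x) = R.coaction S h x := rfl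

theorem coactLin_mon (R S : HomRel k p N) (h : R.Coacts S) {n : ℕ} (J : Fin n → ι) :
    R.coactLin S h (S.mon J) = ∑ I : Fin n → ι, S.mon I ⊗ₜ[k] R.zcoef I J := by
  have e : R.coactLin S h (S.mon J) =
    (GradedTensorProduct.of k S.par R.endo.par).symm (R.coaction S h (S.mon J)) := rfl
  rw [e, coaction_mon, map_sum]
  rfl

theorem coactLin_coassoc (R S : HomRel k p N) (h : R.Coacts S) :
    (TensorProduct.assoc k S.Alg R.endo.Alg R.endo.Alg).toLinearMap ∘ₗ
      (R.coactLin S h).rTensor R.endo.Alg ∘ₗ R.coactLin S h =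
    (CoalgebraStruct.comul (R := k) (A := R.endo.Alg)).lTensor S.Alg ∘ₗ R.coactLin S h :=
  S.linearMap_ext fun n I => coassoc_at (R.coactLin S h) (fun J : Fin n → ι => S.mon J) R.zcoef
    (R.coactLin_mon S h) R.comul_zcoef I

theorem coactLin_counit (R S : HomRel k p N) (h : R.Coacts S) :
    (TensorProduct.rid k S.Alg).toLinearMap ∘ₗ
      (CoalgebraStruct.counit (R := k) (A := R.endo.Alg)).lTensor S.Alg ∘ₗ R.coactLin S h =
    LinearMap.id := by
  classical
  refine S.linearMap_ext fun n I => counit_at (R.coactLin S h) (fun J : Fin n → ι => S.mon J)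
    R.zcoef (R.coactLin_mon S h) (fun I J => ?_) I
  rw [counit_zcoef]

theorem coactLin_even (R S : HomRel k p N) (h : R.Coacts S) (r : ZMod 2) (x : S.Alg)
    (hx : x ∈ S.par r) : R.coactLin S h x ∈ tensorGrading S.par R.endo.par r := by
  have hle : S.par r ≤ (tensorGrading S.par R.endo.par r).comap (R.coactLin S h) := by
    rw [par, Submodule.span_le]
    rintro _ ⟨n, J, rfl, rfl⟩
    rw [SetLike.mem_coe, Submodule.mem_comap, coactLin_mon]
    refine Submodule.sum_mem _ fun I _ => tmul_mem_tensorGrading (S.mon_mem_par I)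
      (R.zcoef_mem_par I J) ?_
    rw [← add_assoc, zmod_two_add_self, zero_add]
  exact hle hx

theorem superProj_mul (S : HomRel k p N) (r : ZMod 2) (x y : S.Alg) :
    superProj S.par r (x * y) = ∑ s, superProj S.par s x * superProj S.par (r - s) y := by
  have h : ∀ s t, superProj S.par r (superProj S.par s x * superProj S.par t y) =
      if t = r - s then superProj S.par s x * superProj S.par t y else 0 := by
    intro s t
    rw [superProj_of_mem S.par
      (SetLike.mul_mem_graded (superProj_mem S.par s x) (superProj_mem S.par t y))]
    simp only [eq_sub_iff_add_eq', eq_comm]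
  conv_lhs => rw [← sum_superProj S.par x, ← sum_superProj S.par y, Finset.sum_mul_sum]
  simp only [map_sum, h]
  simp

theorem isGradedSub_mul (S : HomRel k p N) {X Y : Submodule k S.Alg} (hX : IsGradedSub S.par X)
    (hY : IsGradedSub S.par Y) : IsGradedSub S.par (X * Y) := by
  intro r
  have h : X * Y ≤ (X * Y).comap (superProj S.par r) := by
    rw [Submodule.mul_le]
    intro x hx y hy
    rw [Submodule.mem_comap, superProj_mul]
    exact Submodule.sum_mem _ fun s _ => Submodule.mul_mem_mul (hX s x hx) (hY _ y hy)
  exact h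

theorem costable_mul (R S : HomRel k p N) (h : R.Coacts S) {X Y : Submodule k S.Alg}
    (hX : Costable (R.coactLin S h) X) (hY : Costable (R.coactLin S h) Y)
    (hYg : IsGradedSub S.par Y) : Costable (R.coactLin S h) (X * Y) := by
  let e := GradedTensorProduct.of k S.par R.endo.par
  have key : ∀ (x : X ⊗[k] R.endo.Alg) (y : Y ⊗[k] R.endo.Alg),
      e.symm (e (X.subtype.rTensor R.endo.Alg x) * e (Y.subtype.rTensor R.endo.Alg y)) ∈
        LinearMap.range ((X * Y).subtype.rTensor R.endo.Alg) := by
    intro x y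
    induction x with
    | zero => rw [map_zero, map_zero, zero_mul, map_zero]; exact Submodule.zero_mem _
    | add x x' hx hx' =>
      rw [map_add, map_add, add_mul, map_add]
      exact Submodule.add_mem _ hx hx'
    | tmul a b =>
      induction y with
      | zero => rw [map_zero, map_zero, mul_zero, map_zero]; exact Submodule.zero_mem _
      | add x x' hx hx' =>
        rw [map_add, map_add, mul_add, map_add]
        exact Submodule.add_mem _ hx hx'
      | tmul a' b' =>
        rw [LinearMap.rTensor_tmul, LinearMap.rTensor_tmul, ← sum_superProj R.endo.par b,
          ← sum_superProj S.par (Y.subtype a'), TensorProduct.tmul_sum, TensorProduct.sum_tmul,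
          map_sum, map_sum, Finset.sum_mul_sum, map_sum]
        refine Submodule.sum_mem _ fun s _ => ?_
        rw [map_sum]
        refine Submodule.sum_mem _ fun t _ => ?_
        have h1 := tmul_mul_tmul S.par R.endo.par (X.subtype a) (superProj S.par t (Y.subtype a'))
          (superProj R.endo.par s b) b' (superProj_mem R.endo.par s b) (superProj_mem S.par t _)
        have h2 : e.symm (e (X.subtype a ⊗ₜ superProj R.endo.par s b) *
            e (superProj S.par t (Y.subtype a') ⊗ₜ b')) = sgn k (s * t) •
            ((X.subtype a * superProj S.par t (Y.subtype a')) ⊗ₜ[k]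
              (superProj R.endo.par s b * b')) := congrArg e.symm h1
        rw [h2]
        refine Submodule.smul_mem _ _ ⟨(⟨X.subtype a * superProj S.par t (Y.subtype a'),
          Submodule.mul_mem_mul a.2 (hYg t _ a'.2)⟩ : (X * Y : Submodule k S.Alg)) ⊗ₜ
            (superProj R.endo.par s b * b'), ?_⟩
        rw [LinearMap.rTensor_tmul]
        rfl
  have hle : X * Y ≤ (LinearMap.range ((X * Y).subtype.rTensor R.endo.Alg)).comap
      (R.coactLin S h) := by
    rw [Submodule.mul_le]
    intro x hx y hy
    obtain ⟨x', hx'⟩ := hX x hx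
    obtain ⟨y', hy'⟩ := hY y hy
    have h1 := key x' y'
    rw [hx', hy'] at h1
    have h2 : e.symm (e (R.coactLin S h x) * e (R.coactLin S h y)) = R.coactLin S h (x * y) := by
      rw [LinearEquiv.symm_apply_eq]
      exact (map_mul (R.coaction S h) x y).symm
    rw [h2] at h1
    exact h1
  exact hle

theorem deg_finite (S : HomRel k p N) (n : ℕ) : Module.Finite k (S.deg n) := by
  refine Module.Finite.iff_fg.2 (Submodule.fg_span ?_)
  have : {x | ∃ I : Fin n → ι, x = S.mon I} = Set.range fun I : Fin n → ι => S.mon I := by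
    ext x
    simp [eq_comm]
  rw [this]
  exact Set.finite_range _

theorem deg_graded (S : HomRel k p N) (n : ℕ) : IsGradedSub S.par (S.deg n) := by
  intro r
  have h : S.deg n ≤ (S.deg n).comap (superProj S.par r) := by
    conv_lhs => rw [deg]
    rw [Submodule.span_le]
    rintro _ ⟨I, rfl⟩
    rw [SetLike.mem_coe, Submodule.mem_comap, superProj_of_mem S.par (S.mon_mem_par I)]
    split_ifs
    · exact S.mon_mem_deg I
    · exact Submodule.zero_mem _
  exact h

theorem deg_costable (R S : HomRel k p N) (h : R.Coacts S) (n : ℕ) :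
    Costable (R.coactLin S h) (S.deg n) := by
  have hle : S.deg n ≤ (LinearMap.range ((S.deg n).subtype.rTensor R.endo.Alg)).comap
      (R.coactLin S h) := by
    conv_lhs => rw [deg]
    rw [Submodule.span_le]
    rintro _ ⟨J, rfl⟩
    rw [SetLike.mem_coe, Submodule.mem_comap, coactLin_mon]
    exact Submodule.sum_mem _ fun I _ => ⟨(⟨S.mon I, S.mon_mem_deg I⟩ : S.deg n) ⊗ₜ R.zcoef I J,
      by simp⟩
  exact hle

/-- The degree `n` component `A_n` of `A = A(V, R)`, as a right supercomodule over `end A`. -/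
noncomputable def comodDeg (R : HomRel k p N) (n : ℕ) : SComod R.endo.par :=
  SComod.ofSub R.par (R.coactLin R R.coacts_self) (R.coactLin_coassoc R _) (R.coactLin_counit R _)
    (R.coactLin_even R _) (R.deg n) (R.deg_finite n) (R.deg_graded n) (R.deg_costable R _ n)

/-- The space of relations `R`, as a subspace of the tensor algebra `T(V)`. -/
noncomputable def relT (R : HomRel k p N) : Submodule k (free k p N).Alg :=
  R.rel.map (Fintype.linearCombination k fun I : Fin N → ι => (free k p N).mon I)

theorem relT_graded (R : HomRel k p N) : IsGradedSub (free k p N).par R.relT := by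
  rintro s _ ⟨r, hr, rfl⟩
  refine ⟨_, R.graded r hr s, ?_⟩
  rw [Fintype.linearCombination_apply, Fintype.linearCombination_apply, map_sum]
  refine Finset.sum_congr rfl fun I _ => ?_
  rw [map_smul, superProj_of_mem (free k p N).par ((free k p N).mon_mem_par I)]
  by_cases h : tpar p I = s
  · rw [if_pos h, if_pos h.symm]
  · rw [if_neg h, if_neg (Ne.symm h), zero_smul, smul_zero]

theorem relT_costable (R : HomRel k p N) :
    Costable (R.coactLin (free k p N) R.coacts_free) R.relT := by
  rintro _ ⟨r, hr, rfl⟩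
  rw [mem_range_rTensor_iff]
  intro f
  classical
  obtain ⟨P, hP1, hP2⟩ := exists_projection R.rel
  set w : (Fin N → ι) → k := fun I => ∑ J, r J * f (R.zcoef I J) with hw
  have hw1 : ∀ L, ∑ K, P L K * w K = w L := by
    intro L
    have h1 := R.zcoef_rel (fun I => P L I - if L = I then 1 else 0) (by
      intro r hr
      simp only [sub_mul, Finset.sum_sub_distrib, hP2 L r hr]
      simp) hr
    have h2 := congrArg f h1
    simp only [map_sum, map_smul, smul_eq_mul, map_zero] at h2
    rw [← sub_eq_zero]
    refine Eq.trans ?_ h2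
    have h3 : ∀ I, ∑ J, ((P L I - if L = I then 1 else 0) * r J) * f (R.zcoef I J) =
        P L I * w I - if L = I then w I else 0 := by
      intro I
      split_ifs <;> simp [hw, sub_mul, mul_assoc, Finset.sum_sub_distrib, Finset.mul_sum]
    simp only [h3, Finset.sum_sub_distrib]
    simp
  have hwmem : w ∈ R.rel := by
    have : w = ∑ K, w K • fun I => P I K := by
      funext L
      rw [← hw1 L, Finset.sum_apply]
      exact Finset.sum_congr rfl fun K _ => mul_comm _ _
    rw [this]
    exact Submodule.sum_mem _ fun K _ => Submodule.smul_mem _ _ (hP1 K)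
  refine ⟨w, hwmem, ?_⟩
  rw [Fintype.linearCombination_apply, Fintype.linearCombination_apply]
  simp only [map_sum, map_smul, coactLin_mon, LinearMap.lTensor_tmul, TensorProduct.rid_tmul,
    Finset.smul_sum, hw, Finset.sum_smul, mul_smul]
  exact Finset.sum_comm

/-- The space `A^{!*}_n`: this is `V^{⊗ n}` for `n < N` and the intersection of the
`V^{⊗ i} ⊗ R ⊗ V^{⊗ j}` with `i + N + j = n` for `n ≥ N`, as a subspace of `T(V)`. -/
noncomputable def dualSub (R : HomRel k p N) (n : ℕ) : Submodule k (free k p N).Alg :=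
  (free k p N).deg n ⊓ ⨅ (i : ℕ) (j : ℕ) (_ : i + N + j = n),
    (free k p N).deg i * R.relT * (free k p N).deg j

theorem isGradedSub_inf {M : Type u} [AddCommGroup M] [Module k M]
    (ℳ : ZMod 2 → Submodule k M) [DirectSum.Decomposition ℳ] {S T : Submodule k M}
    (hS : IsGradedSub ℳ S) (hT : IsGradedSub ℳ T) : IsGradedSub ℳ (S ⊓ T) :=
  fun r x hx => ⟨hS r x hx.1, hT r x hx.2⟩

theorem isGradedSub_iInf {M : Type u} [AddCommGroup M] [Module k M]
    (ℳ : ZMod 2 → Submodule k M) [DirectSum.Decomposition ℳ] {κ : Sort*} {S : κ → Submodule k M}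
    (hS : ∀ i, IsGradedSub ℳ (S i)) : IsGradedSub ℳ (⨅ i, S i) := by
  intro r x hx
  rw [Submodule.mem_iInf] at hx ⊢
  exact fun i => hS i r x (hx i)

theorem costable_inf {M B : Type u} [AddCommGroup M] [Module k M] [Ring B] [Algebra k B]
    {δ : M →ₗ[k] M ⊗[k] B} {S T : Submodule k M} (hS : Costable δ S) (hT : Costable δ T) :
    Costable δ (S ⊓ T) := by
  intro x hx
  rw [mem_range_rTensor_iff]
  exact fun f => ⟨(mem_range_rTensor_iff S _).1 (hS x hx.1) f,
    (mem_range_rTensor_iff T _).1 (hT x hx.2) f⟩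

theorem costable_iInf {M B : Type u} [AddCommGroup M] [Module k M] [Ring B] [Algebra k B]
    {δ : M →ₗ[k] M ⊗[k] B} {κ : Sort*} {S : κ → Submodule k M} (hS : ∀ i, Costable δ (S i)) :
    Costable δ (⨅ i, S i) := by
  intro x hx
  rw [mem_range_rTensor_iff]
  intro f
  rw [Submodule.mem_iInf] at hx ⊢
  exact fun i => (mem_range_rTensor_iff (S i) _).1 (hS i x (hx i)) f

theorem dualSub_finite (R : HomRel k p N) (n : ℕ) : Module.Finite k (R.dualSub n) := by
  have := (free k p N).deg_finite n
  exact Submodule.finiteDimensional_of_le (inf_le_left : R.dualSub n ≤ (free k p N).deg n)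

theorem dualSub_graded (R : HomRel k p N) (n : ℕ) :
    IsGradedSub (free k p N).par (R.dualSub n) :=
  isGradedSub_inf _ (deg_graded _ n) <| isGradedSub_iInf _ fun _ => isGradedSub_iInf _ fun _ =>
    isGradedSub_iInf _ fun _ => isGradedSub_mul _ (isGradedSub_mul _ (deg_graded _ _) R.relT_graded)
      (deg_graded _ _)

theorem dualSub_costable (R : HomRel k p N) (n : ℕ) :
    Costable (R.coactLin (free k p N) R.coacts_free) (R.dualSub n) :=
  costable_inf (deg_costable _ _ _ n) <| costable_iInf fun _ => costable_iInf fun _ =>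
    costable_iInf fun _ => costable_mul _ _ _ (costable_mul _ _ _ (deg_costable _ _ _ _)
      R.relT_costable R.relT_graded) (deg_costable _ _ _ _) (deg_graded _ _)

/-- The space `A^{!*}_n`, as a right supercomodule over `end A`, namely as a subcomodule of
`V^{⊗ n}`. -/
noncomputable def comodDual (R : HomRel k p N) (n : ℕ) : SComod R.endo.par :=
  SComod.ofSub (free k p N).par (R.coactLin (free k p N) R.coacts_free)
    (R.coactLin_coassoc _ _) (R.coactLin_counit _ _) (R.coactLin_even _ _) (R.dualSub n)
    (R.dualSub_finite n) (R.dualSub_graded n) (R.dualSub_costable n)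

end HomRel

end Components

section Koszul

variable {k : Type u} [Field k]

theorem contractNth_update {A : Type u} [Ring A] {i : ℕ} [DecidableEq (Fin (i + 1))]
    [DecidableEq (Fin i)] (j : Fin i) (a : Fin (i + 1) → A) (m : Fin (i + 1)) :
    ∃ (l : Fin i) (c d : A), ∀ x : A, Fin.contractNth j.castSucc (· * ·) (Function.update a m x) =
      Function.update (Fin.contractNth j.castSucc (· * ·) a) l (c * x * d) := by
  by_cases h1 : (m : ℕ) < j
  · refine ⟨⟨m, by omega⟩, 1, 1, fun x => ?_⟩
    funext l
    simp only [Fin.contractNth, Function.update_apply, Fin.ext_iff, Fin.val_castSucc, Fin.val_succ,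
      one_mul, mul_one]
    grind
  · by_cases h2 : (m : ℕ) = j
    · refine ⟨j, 1, a j.succ, fun x => ?_⟩
      funext l
      have h3 : (l : ℕ) = j → l = j := Fin.ext
      simp only [Fin.contractNth, Function.update_apply, Fin.ext_iff, Fin.val_castSucc,
        Fin.val_succ, one_mul]
      grind
    · by_cases h4 : (m : ℕ) = j + 1
      · refine ⟨j, a j.castSucc, 1, fun x => ?_⟩
        funext l
        have h3 : (l : ℕ) = j → l = j := Fin.ext
        simp only [Fin.contractNth, Function.update_apply, Fin.ext_iff, Fin.val_castSucc,
          Fin.val_succ, mul_one]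
        grind
      · refine ⟨⟨m - 1, by omega⟩, 1, 1, fun x => ?_⟩
        funext l
        simp only [Fin.contractNth, Function.update_apply, Fin.ext_iff, Fin.val_castSucc,
          Fin.val_succ, one_mul, mul_one]
        grind

/-- The multiplication of two adjacent factors,
`a_0 ⊗ ⋯ ⊗ a_i ↦ a_0 ⊗ ⋯ ⊗ a_j a_{j+1} ⊗ ⋯ ⊗ a_i`. -/
noncomputable def mulAt (k : Type u) [Field k] (A : Type u) [Ring A] [Algebra k A] {i : ℕ}
    (j : Fin i) : ⨂[k]^(i + 1) A →ₗ[k] ⨂[k]^i A :=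
  PiTensorProduct.lift
    { toFun := fun a => PiTensorProduct.tprod k (Fin.contractNth j.castSucc (· * ·) a)
      map_update_add' := by
        intro _ a m x y
        obtain ⟨l, c, d, h⟩ := contractNth_update j a m
        rw [h, h, h, mul_add, add_mul, MultilinearMap.map_update_add]
      map_update_smul' := by
        intro _ a m c' x
        obtain ⟨l, c, d, h⟩ := contractNth_update j a m
        rw [h, h, mul_smul_comm, smul_mul_assoc, MultilinearMap.map_update_smul] }

theorem mulAt_tprod (A : Type u) [Ring A] [Algebra k A] {i : ℕ} (j : Fin i)
    (a : Fin (i + 1) → A) : mulAt k A j (PiTensorProduct.tprod k a) =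
      PiTensorProduct.tprod k (Fin.contractNth j.castSucc (· * ·) a) :=
  PiTensorProduct.lift.tprod a

/-- The differential `a_0 ⊗ ⋯ ⊗ a_i ↦ ∑ j < i, (-1) ^ j a_0 ⊗ ⋯ ⊗ a_j a_{j+1} ⊗ ⋯ ⊗ a_i` of the bar
complex. -/
noncomputable def barD (k : Type u) [Field k] (A : Type u) [Ring A] [Algebra k A] (i : ℕ) :
    ⨂[k]^(i + 1) A →ₗ[k] ⨂[k]^i A :=
  ∑ j : Fin i, (-1 : k) ^ (j : ℕ) • mulAt k A j

namespace HomRel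

variable {ι : Type} [Fintype ι] {p : ι → ZMod 2} {N : ℕ}

/-- The component of internal degree `n` of `A_+ ^ {⊗ i}`, where `A_+` is the augmentation ideal
of `A`; this is the degree `n` component of the `i`-th term of the reduced bar complex
`⋯ → A_+ ⊗ A_+ → A_+ → k`, which computes `Tor^A(k, k)`. -/
noncomputable def barSpace (R : HomRel k p N) (i n : ℕ) : Submodule k (⨂[k]^i R.Alg) :=
  Submodule.span k {x | ∃ (m : Fin i → ℕ) (a : Fin i → R.Alg), (∀ l, 0 < m l) ∧ ∑ l, m l = n ∧
    (∀ l, a l ∈ R.deg (m l)) ∧ x = PiTensorProduct.tprod k a}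

/-- The cycles of degree `n` in the `i`-th term of the reduced bar complex. -/
noncomputable def barCycles (R : HomRel k p N) : (i n : ℕ) → Submodule k (⨂[k]^i R.Alg)
  | 0, n => R.barSpace 0 n
  | i + 1, n => R.barSpace (i + 1) n ⊓ LinearMap.ker (barD k R.Alg i)

/-- The boundaries of degree `n` in the `i`-th term of the reduced bar complex. -/
noncomputable def barBoundaries (R : HomRel k p N) (i n : ℕ) : Submodule k (⨂[k]^i R.Alg) :=
  (R.barSpace (i + 1) n).map (barD k R.Alg i)

/-- The component of internal degree `n` of `Tor^A_i(k, k)`, for `A = A(V, R)`. -/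
def Tor (R : HomRel k p N) (i n : ℕ) : Type u :=
  R.barCycles i n ⧸ (R.barBoundaries i n).submoduleOf (R.barCycles i n)

noncomputable instance (R : HomRel k p N) (i n : ℕ) : AddCommGroup (R.Tor i n) :=
  inferInstanceAs
    (AddCommGroup (R.barCycles i n ⧸ (R.barBoundaries i n).submoduleOf (R.barCycles i n)))

noncomputable instance (R : HomRel k p N) (i n : ℕ) : Module k (R.Tor i n) :=
  inferInstanceAs
    (Module k (R.barCycles i n ⧸ (R.barBoundaries i n).submoduleOf (R.barCycles i n)))

end HomRel

/-- The jump function: `ν_N(i) = (i / 2) N` for even `i`, and `ν_N(i) = ((i - 1) / 2) N + 1` for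
odd `i`. -/
def nu (N i : ℕ) : ℕ := if Even i then i / 2 * N else (i - 1) / 2 * N + 1

/-- `A(V, R)` is `N`-Koszul: `Tor^A_i(k, k)` is concentrated in degree `ν_N(i)` for all `i`. -/
def HomRel.IsNKoszul {ι : Type} [Fintype ι] {p : ι → ZMod 2} {N : ℕ} (R : HomRel k p N) : Prop :=
  ∀ i n, n ≠ nu N i → Subsingleton (R.Tor i n)

end Koszul

section Series

open PowerSeries

/-- The series `P_N(t) = ∑ (-1) ^ (n - (n mod N)) a_n t ^ n`, where the sum is over the `n` that are
congruent to `0` or `1` modulo `N`, for `P(t) = ∑ a_n t ^ n`. -/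
noncomputable def jumpSeries {Q : Type*} [Ring Q] (N : ℕ) (P : PowerSeries Q) : PowerSeries Q :=
  PowerSeries.mk fun n =>
    if n % N = 0 ∨ n % N = 1 then (-1) ^ (n - n % N) * PowerSeries.coeff n P else 0

/-- The series `P(-t)`. -/
noncomputable def evalNeg {Q : Type*} [Ring Q] (P : PowerSeries Q) : PowerSeries Q :=
  PowerSeries.mk fun n => (-1) ^ n * PowerSeries.coeff n P

namespace HomRel

variable {k : Type u} [Field k] {ι : Type} [Fintype ι] {p : ι → ZMod 2} {N : ℕ}

/-- The Poincaré series `P_A(t) = ∑ [A_n] t ^ n`, over the Grothendieck ring of `end A`. -/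
noncomputable def poincare (R : HomRel k p N) : PowerSeries (GrothendieckRing R.endo.par) :=
  PowerSeries.mk fun n => GrothendieckRing.cls (R.comodDeg n)

/-- The Poincaré series `∑ [A^{!*}_n] t ^ n`, over the Grothendieck ring of `end A`. -/
noncomputable def poincareDual (R : HomRel k p N) : PowerSeries (GrothendieckRing R.endo.par) :=
  PowerSeries.mk fun n => GrothendieckRing.cls (R.comodDual n)

end HomRel

end Series

end NKoszul

/-!
The two identities express that the Euler characteristic of the Koszul complex vanishes, in the
Grothendieck ring and after taking supercharacters.

*The Koszul complex.*  Its `i`-th term is `A ⊗ A^{!*}_{ν(i)}` with `ν = ν_N`.  The differential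
`kos` removes the first `gap N i = ν(i + 1) - ν(i)` letters of the tensor in the second factor and
multiplies them into `A`.  Two consecutive differentials involve `N` letters in total, hence compose
to zero (`kos_kos`).  The subspace `A^{!*}_n` of `V^{⊗ n}` consists of the tensors all of whose
slices of length `N` are relations (`mem_dualSub_iff`).  Membership of tensors in `A^{!*}_n` and
vanishing in `A` in degrees at most `N` are thereby questions about slices
(`mem_lowRel_of_quot_eq_zero`).

*Exactness.*  The groups `Tor^A(k, k)` are computed from the bar complex.  Instead of minimal
resolutions, the proof uses the reduced bar complex with coefficients in a graded module `M`, whose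
terms are `A_+^{⊗ i} ⊗ M`.  For `M = A_+` it embeds into the full bar complex (`barIncl_injective`,
`barIncl_barDiff`), so that `N`-Koszulness says that its homology in degree `j` is concentrated in
the internal degree `ν(j + 1)` (`barVanish_of_tor`, `kerVanish_zero`).  It is acyclic for free
modules (`free_barAcyclic`).  Hence, if `Z_i` is the kernel of the `i`-th differential of the
augmented Koszul complex and the complex is exact there, dimension shifting (`BarVanish.shift`)
transports the statement "the bar homology of `Z_i` in degree `j` is concentrated in the internal
degree `ν(i + 1 + j)`" from `i` to `i + 1` (`KerVanish.succ`).  For `j = 0` this statement says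
that `Z_i` is generated in degree `ν(i + 1)` (`le_of_vanish`).  In this degree, the elements of
`Z_i` are represented by tensors of degree `ν(i + 1)` for which the slices that start with the first
letter, and those that start after at least `gap N i` letters, are relations (`mem_range_kos`).  For
even `i` these are all the slices.  For odd `i` the slices in between are also relations, by the
exactness of the Koszul complex at `A ⊗ R`, which is the case `i = 2` (`slice_mem_of_exact`).  So
the tensor lies in `A^{!*}_{ν(i + 1)}` and the complex is exact at the `i`-th place; the induction
over `i` is `kosKer_le_range`.

*The first identity.*  The homogeneous components of the Koszul complex are complexes of
supercomodules over `end A` (`kosDeg_isHom`), since the coaction is a morphism of algebras and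
`A^{!*}_n` is a subcomodule of `T(V)`.  Exactness makes their Euler characteristics vanish in
positive degrees (`sum_kosCls`).  The values of `ν` are the numbers congruent to `0` or `1` modulo
`N`, and the remainder of `ν(i)` modulo `N` is that of `i` modulo `2`, so these Euler
characteristics are the coefficients of `P_A(t) P_{A^{!*}, N}(-t)` (`sum_antidiagonal_jump`,
`evalNeg_jumpSeries`, `poincare_mul`).

*The second identity.*  A functional `φ` on `end A` turns the supercharacter of a comodule into the
trace of an endomorphism that is natural in the comodule (`trace_superAct`, `superAct_map`).  Traces
are additive in short exact sequences, and the supercharacter of a tensor product is computed in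
a product basis; hence the supercharacter is a ring morphism `scharHom` on the Grothendieck ring,
and it maps the first identity to the second one.
-/


namespace NKoszul

open Finset.HasAntidiagonal (antidiagonal mem_antidiagonal)

/-! ### The reduced bar complex with coefficients -/

section Bar

theorem sum_antidiagonal_assoc {M : Type*} [AddCommMonoid M] (n : ℕ) (f : ℕ → ℕ → ℕ → M) :
    ∑ x ∈ antidiagonal n, ∑ y ∈ antidiagonal x.1, f y.1 y.2 x.2 =
      ∑ x ∈ antidiagonal n, ∑ y ∈ antidiagonal x.2, f x.1 y.1 y.2 := by
  rw [Finset.sum_sigma', Finset.sum_sigma']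
  refine Finset.sum_nbij' (fun x => ⟨(x.2.1, x.2.2 + x.1.2), (x.2.2, x.1.2)⟩)
    (fun x => ⟨(x.1.1 + x.2.1, x.2.2), (x.1.1, x.2.1)⟩) ?_ ?_ ?_ ?_ ?_
  · rintro ⟨⟨a, b⟩, c, d⟩ h
    simp only [Finset.mem_sigma, mem_antidiagonal] at h ⊢
    constructor <;> grind
  · rintro ⟨⟨a, b⟩, c, d⟩ h
    simp only [Finset.mem_sigma, mem_antidiagonal] at h ⊢
    constructor <;> grind
  · rintro ⟨⟨a, b⟩, c, d⟩ h
    simp only [Finset.mem_sigma, mem_antidiagonal] at h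
    obtain ⟨h1, rfl⟩ := h
    rfl
  · rintro ⟨⟨a, b⟩, c, d⟩ h
    simp only [Finset.mem_sigma, mem_antidiagonal] at h
    obtain ⟨h1, rfl⟩ := h
    rfl
  · rintro ⟨⟨a, b⟩, c, d⟩ h
    rfl

/-- An augmented `k`-algebra `A` together with operators `π n`, to be thought of as the projections
of `A` onto its homogeneous components.  Only the compatibility of the `π n` with products and with
the augmentation is recorded. -/
structure AugAlg (k A : Type u) [Field k] [Ring A] [Algebra k A] where
  /-- the augmentation -/
  ε : A →ₐ[k] k
  /-- the degree operators -/
  π : ℕ → A →ₗ[k] A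
  π_mul : ∀ n a b, π n (a * b) = ∑ x ∈ antidiagonal n, π x.1 a * π x.2 b
  ε_π : ∀ n a, ε a = 0 → ε (π n a) = 0

variable {k A : Type u} [Field k] [Ring A] [Algebra k A]

namespace AugAlg

variable (G : AugAlg k A)

/-- The augmentation ideal `A_+`. -/
abbrev plus : Ideal A := RingHom.ker G.ε

/-- The degree operators on the augmentation ideal. -/
noncomputable def πPlus (n : ℕ) : G.plus →ₗ[k] G.plus :=
  (G.π n ∘ₗ (G.plus.subtype.restrictScalars k)).codRestrict (G.plus.restrictScalars k)
    fun a => G.ε_π n a a.2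

@[simp] theorem πPlus_coe (n : ℕ) (a : G.plus) : (G.πPlus n a : A) = G.π n a := rfl

theorem πPlus_smul (n : ℕ) (a : A) (b : G.plus) :
    G.πPlus n (a • b) = ∑ x ∈ antidiagonal n, G.π x.1 a • G.πPlus x.2 b := by
  refine Subtype.ext ?_
  simp [G.π_mul]

end AugAlg

/-- A left `A`-module with degree operators that are compatible with those of `A`. -/
structure DegMod (G : AugAlg k A) where
  /-- the underlying type -/
  X : Type u
  [addCommGroup : AddCommGroup X]
  [moduleBase : Module k X]
  [module : Module A X]
  [isScalarTower : IsScalarTower k A X]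
  /-- the degree operators -/
  π : ℕ → X →ₗ[k] X
  π_smul : ∀ n (a : A) x, π n (a • x) = ∑ y ∈ antidiagonal n, G.π y.1 a • π y.2 x

attribute [instance] DegMod.addCommGroup DegMod.moduleBase DegMod.module DegMod.isScalarTower

namespace DegMod

variable {G : AugAlg k A}

/-- The `A`-module `A_+ ⊗ M`, where `A` acts on the first factor. -/
@[reducible] noncomputable def ext (M : DegMod G) : DegMod G where
  X := G.plus ⊗[k] M.X
  π n := ∑ x ∈ antidiagonal n, TensorProduct.map (G.πPlus x.1) (M.π x.2)
  π_smul n a x := by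
    induction x with
    | zero => simp
    | add x y hx hy => simp only [smul_add, map_add, hx, hy, Finset.sum_add_distrib]
    | tmul b m =>
      simp only [TensorProduct.smul_tmul', LinearMap.sum_apply, TensorProduct.map_tmul,
        Finset.smul_sum, G.πPlus_smul, TensorProduct.sum_tmul]
      exact sum_antidiagonal_assoc n fun i j l => (G.π i a • G.πPlus j b) ⊗ₜ[k] M.π l m

theorem ext_π_tmul (M : DegMod G) (n : ℕ) (a : G.plus) (m : M.X) :
    M.ext.π n (a ⊗ₜ[k] m) = ∑ x ∈ antidiagonal n, G.πPlus x.1 a ⊗ₜ[k] M.π x.2 m := by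
  simp only [LinearMap.sum_apply, TensorProduct.map_tmul]

/-- The action `A_+ ⊗ M → M`. -/
noncomputable def act (M : DegMod G) : M.ext.X →ₗ[A] M.X :=
  TensorProduct.AlgebraTensorModule.lift
    { toFun := fun a => Algebra.lsmul k k M.X (a : A)
      map_add' := fun a b => by
        rw [Submodule.coe_add, map_add]
      map_smul' := fun r a => by
        ext m
        simp }

@[simp] theorem act_tmul (M : DegMod G) (a : G.plus) (m : M.X) :
    M.act (a ⊗ₜ[k] m) = (a : A) • m := rfl

/-- The map `A_+ ⊗ M → A_+ ⊗ N` induced by `f : M → N`. -/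
noncomputable def extMap {M N : DegMod G} (f : M.X →ₗ[k] N.X) : M.ext.X →ₗ[A] N.ext.X :=
  TensorProduct.AlgebraTensorModule.lTensor A G.plus f

@[simp] theorem extMap_tmul {M N : DegMod G} (f : M.X →ₗ[k] N.X) (a : G.plus) (m : M.X) :
    extMap f (a ⊗ₜ[k] m) = a ⊗ₜ[k] f m := rfl

theorem act_extMap {M N : DegMod G} (f : M.X →ₗ[A] N.X) (x : M.ext.X) :
    N.act (extMap (f.restrictScalars k) x) = f (M.act x) := by
  induction x using TensorProduct.induction_on with
  | zero => simp only [map_zero]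
  | add x y hx hy => simp only [map_add, hx, hy]
  | tmul a m => rw [extMap_tmul, act_tmul, act_tmul, map_smul]; rfl

theorem extMap_comp {M N L : DegMod G} (f : M.X →ₗ[k] N.X) (g : N.X →ₗ[k] L.X) (x : M.ext.X) :
    extMap g (extMap f x) = extMap (g ∘ₗ f) x := by
  induction x using TensorProduct.induction_on with
  | zero => simp only [map_zero]
  | add x y hx hy => simp only [map_add, hx, hy]
  | tmul a m => rfl

theorem act_π (M : DegMod G) (n : ℕ) (x : M.ext.X) : M.act (M.ext.π n x) = M.π n (M.act x) := by
  induction x using TensorProduct.induction_on with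
  | zero => simp only [map_zero]
  | add x y hx hy => simp only [map_add, hx, hy]
  | tmul a m =>
    rw [ext_π_tmul, map_sum, act_tmul, M.π_smul]
    rfl

theorem extMap_π {M N : DegMod G} (f : M.X →ₗ[k] N.X) (hf : ∀ n x, f (M.π n x) = N.π n (f x))
    (n : ℕ) (x : M.ext.X) : extMap f (M.ext.π n x) = N.ext.π n (extMap f x) := by
  induction x using TensorProduct.induction_on with
  | zero => simp only [map_zero]
  | add x y hx hy => simp only [map_add, hx, hy]
  | tmul a m =>
    rw [ext_π_tmul, map_sum, extMap_tmul, ext_π_tmul]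
    refine Finset.sum_congr rfl fun y _ => ?_
    rw [extMap_tmul, hf]

/-- The step `d ↦ (a ⊗ x ↦ a x - a ⊗ d x)` in the construction of the bar differential. -/
noncomputable def stepDiff {M : DegMod G} (d : M.ext.X →ₗ[A] M.X) : M.ext.ext.X →ₗ[A] M.ext.X :=
  M.ext.act - extMap (d.restrictScalars k)

theorem stepDiff_apply {M : DegMod G} (d : M.ext.X →ₗ[A] M.X) (x : M.ext.ext.X) :
    stepDiff d x = M.ext.act x - extMap (d.restrictScalars k) x := rfl

theorem act_stepDiff_act (M : DegMod G) (x : M.ext.ext.X) : M.act (stepDiff M.act x) = 0 := by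
  rw [stepDiff_apply, map_sub, act_extMap, sub_self]

theorem stepDiff_stepDiff {M : DegMod G} (d : M.ext.X →ₗ[A] M.X)
    (h : ∀ x, d (stepDiff d x) = 0) (x : M.ext.ext.ext.X) :
    stepDiff d (stepDiff (stepDiff d) x) = 0 := by
  rw [stepDiff_apply (stepDiff d), map_sub, ← act_extMap, stepDiff_apply d (extMap _ x),
    extMap_comp, sub_sub_cancel]
  have h' : (d.restrictScalars k) ∘ₗ ((stepDiff d).restrictScalars k) = 0 := LinearMap.ext h
  rw [h']
  induction x using TensorProduct.induction_on with
  | zero => simp only [map_zero]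
  | add x y hx hy => simp only [map_add, hx, hy, add_zero]
  | tmul a m => exact TensorProduct.tmul_zero _ _

theorem stepDiff_π {M : DegMod G} (d : M.ext.X →ₗ[A] M.X)
    (h : ∀ n x, d (M.ext.π n x) = M.π n (d x)) (n : ℕ) (x : M.ext.ext.X) :
    stepDiff d (M.ext.ext.π n x) = M.ext.π n (stepDiff d x) := by
  rw [stepDiff_apply, stepDiff_apply, map_sub, act_π]
  congr 1
  exact extMap_π (M := M.ext) (N := M) (d.restrictScalars k) h n x

theorem stepDiff_extMap {M N : DegMod G} (d : M.ext.X →ₗ[A] M.X) (d' : N.ext.X →ₗ[A] N.X)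
    (f : M.X →ₗ[k] N.X) (h : ∀ x, d' (extMap f x) = f (d x)) (x : M.ext.ext.X) :
    stepDiff d' (extMap ((extMap f).restrictScalars k) x) = extMap f (stepDiff d x) := by
  rw [stepDiff_apply, stepDiff_apply, map_sub, act_extMap, extMap_comp, extMap_comp]
  congr 2
  exact congrArg extMap (LinearMap.ext h)

theorem extMap_surjective {M N : DegMod G} (f : M.X →ₗ[k] N.X) (hf : Function.Surjective f) :
    Function.Surjective (extMap f) := LinearMap.lTensor_surjective G.plus hf

/-- The term `A_+^{⊗ i} ⊗ M` of the reduced bar complex with coefficients in `M`. -/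
noncomputable def bar (M : DegMod G) : ℕ → DegMod G
  | 0 => M
  | i + 1 => (bar M i).ext

/-- The differential of the reduced bar complex:
`a ⊗ m ↦ a m`, and `a ⊗ x ↦ a x - a ⊗ d x` in higher degrees. -/
noncomputable def barDiff (M : DegMod G) : (i : ℕ) → (M.bar i).ext.X →ₗ[A] (M.bar i).X
  | 0 => M.act
  | i + 1 => stepDiff (barDiff M i)

theorem barDiff_barDiff (M : DegMod G) (i : ℕ) (x : (M.bar i).ext.ext.X) :
    M.barDiff i (stepDiff (M.barDiff i) x) = 0 := by
  induction i with
  | zero => exact M.act_stepDiff_act x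
  | succ i ih => exact stepDiff_stepDiff _ ih x

theorem barDiff_π (M : DegMod G) (i n : ℕ) (x : (M.bar i).ext.X) :
    M.barDiff i ((M.bar i).ext.π n x) = (M.bar i).π n (M.barDiff i x) := by
  induction i generalizing n with
  | zero => exact M.act_π n x
  | succ i ih => exact stepDiff_π (M.barDiff i) (fun n x => ih n x) n x

/-- The map of bar complexes induced by a map of coefficients. -/
noncomputable def barMap {M N : DegMod G} (f : M.X →ₗ[k] N.X) :
    (i : ℕ) → (M.bar i).X →ₗ[k] (N.bar i).X
  | 0 => f
  | i + 1 => (extMap (barMap f i)).restrictScalars k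

theorem barMap_π {M N : DegMod G} (f : M.X →ₗ[k] N.X) (hf : ∀ n x, f (M.π n x) = N.π n (f x))
    (i n : ℕ) (x : (M.bar i).X) :
    barMap f i ((M.bar i).π n x) = (N.bar i).π n (barMap f i x) := by
  induction i generalizing n with
  | zero => exact hf n x
  | succ i ih => exact extMap_π (barMap f i) (fun n x => ih n x) n x

theorem barDiff_barMap {M N : DegMod G} (f : M.X →ₗ[A] N.X) (i : ℕ) (x : (M.bar i).ext.X) :
    N.barDiff i (extMap (barMap (f.restrictScalars k) i) x) =
      barMap (f.restrictScalars k) i (M.barDiff i x) := by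
  induction i with
  | zero => exact act_extMap f x
  | succ i ih => exact stepDiff_extMap _ _ _ ih x

theorem barMap_injective {M N : DegMod G} (f : M.X →ₗ[k] N.X) (hf : Function.Injective f) (i : ℕ) :
    Function.Injective (barMap f i) := by
  induction i with
  | zero => exact hf
  | succ i ih => exact Module.Flat.lTensor_preserves_injective_linearMap (M := G.plus) _ ih

theorem barMap_surjective {M N : DegMod G} (f : M.X →ₗ[k] N.X) (hf : Function.Surjective f)
    (i : ℕ) : Function.Surjective (barMap f i) := by
  induction i with
  | zero => exact hf
  | succ i ih => exact LinearMap.lTensor_surjective G.plus ih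

theorem barMap_exact {L M N : DegMod G} (f : L.X →ₗ[k] M.X) (g : M.X →ₗ[k] N.X)
    (h : Function.Exact f g) (hg : Function.Surjective g) (i : ℕ) :
    Function.Exact (barMap f i) (barMap g i) := by
  induction i with
  | zero => exact h
  | succ i ih => exact lTensor_exact G.plus ih (barMap_surjective g hg i)

/-- The homology of the reduced bar complex with coefficients in `M` vanishes in homological
degree `i` and internal degree `n`. -/
def BarVanish (M : DegMod G) : ℕ → ℕ → Prop
  | 0, n => ∀ x : M.X, ∃ y : M.ext.X, M.act y = M.π n x
  | i + 1, n => ∀ x : (M.bar i).ext.X, M.barDiff i x = 0 →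
      ∃ y, stepDiff (M.barDiff i) y = (M.bar i).ext.π n x

/-- The bar complex with coefficients in `M` is exact in positive homological degrees. -/
def BarAcyclic (M : DegMod G) : Prop :=
  ∀ i (x : (M.bar i).ext.X), M.barDiff i x = 0 → ∃ y, stepDiff (M.barDiff i) y = x

/-- Dimension shifting: if `0 → Z → F → M → 0` is exact, the bar complex of `F` is acyclic, and
`Z ⊆ A_+ F`, then the homology of the bar complex of `M` in degree `i + 1` determines that
of `Z` in degree `i`. -/
theorem BarVanish.shift {Z F M : DegMod G} (f : Z.X →ₗ[A] F.X) (g : F.X →ₗ[A] M.X)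
    (hfπ : ∀ n x, f (Z.π n x) = F.π n (f x)) (hgπ : ∀ n x, g (F.π n x) = M.π n (g x))
    (hf : Function.Injective f) (hg : Function.Surjective g) (hfg : Function.Exact f g)
    (hF : F.BarAcyclic) (hmin : ∀ z, ∃ y, F.act y = f z) {i n : ℕ} (h : M.BarVanish (i + 1) n) :
    Z.BarVanish i n := by
  -- the chase, for a cycle `c` of `Z` whose image is the boundary of `e`
  have key : ∀ (c : (Z.bar i).X) (e : (F.bar i).ext.X),
      F.barDiff i e = barMap (f.restrictScalars k) i c →
      ∃ y, Z.barDiff i y = (Z.bar i).π n c := by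
    intro c e he
    have h1 : M.barDiff i (extMap (barMap (g.restrictScalars k) i) e) = 0 := by
      rw [barDiff_barMap, he]
      exact (barMap_exact (f.restrictScalars k) (g.restrictScalars k)
        hfg hg i).apply_apply_eq_zero c
    obtain ⟨w, hw⟩ := h _ h1
    have hs := barMap_surjective (g.restrictScalars k) hg i
    obtain ⟨v, hv⟩ := extMap_surjective
      ((extMap (barMap (g.restrictScalars k) i)).restrictScalars k)
      (extMap_surjective (barMap (g.restrictScalars k) i) hs) w
    have h2 : extMap (barMap (g.restrictScalars k) i)
        ((F.bar i).ext.π n e - stepDiff (F.barDiff i) v) = 0 := by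
      rw [map_sub, sub_eq_zero, extMap_π _ (fun n x => barMap_π _ hgπ i n x), ← hw, ← hv,
        stepDiff_extMap _ _ _ (fun x => barDiff_barMap g i x)]
    obtain ⟨y, hy⟩ := (lTensor_exact G.plus (barMap_exact (f.restrictScalars k)
      (g.restrictScalars k) hfg hg i) (barMap_surjective (g.restrictScalars k) hg i) _).1 h2
    have hy' : extMap (barMap (f.restrictScalars k) i) y =
      (F.bar i).ext.π n e - stepDiff (F.barDiff i) v := hy
    refine ⟨y, barMap_injective (f.restrictScalars k) hf i ?_⟩
    rw [← barDiff_barMap, hy', map_sub, barDiff_barDiff, sub_zero, barDiff_π, he, barMap_π _ hfπ]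
  cases i with
  | zero =>
    intro z
    obtain ⟨e, he⟩ := hmin z
    exact key z e he
  | succ i =>
    intro c hc
    obtain ⟨e, he⟩ := hF i (extMap (barMap (f.restrictScalars k) i) c) (by
      rw [barDiff_barMap, hc, map_zero])
    exact key c e he

theorem BarVanish.of_bijective {M N : DegMod G} (f : M.X →ₗ[A] N.X)
    (hfπ : ∀ n x, f (M.π n x) = N.π n (f x)) (hf : Function.Bijective f) {i n : ℕ}
    (h : M.BarVanish i n) : N.BarVanish i n := by
  cases i with
  | zero =>
    intro x
    obtain ⟨x, rfl⟩ := hf.2 x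
    obtain ⟨y, hy⟩ := h x
    refine ⟨extMap (f.restrictScalars k) y, ?_⟩
    rw [act_extMap, hy, hfπ]
  | succ i =>
    intro x hx
    obtain ⟨x, rfl⟩ := extMap_surjective _ (barMap_surjective (f.restrictScalars k) hf.2 i) x
    obtain ⟨y, hy⟩ := h x (barMap_injective (f.restrictScalars k) hf.1 i (by
      rw [← barDiff_barMap, map_zero]
      exact hx))
    refine ⟨extMap ((extMap (barMap (f.restrictScalars k) i)).restrictScalars k) y, ?_⟩
    rw [stepDiff_extMap _ _ _ (fun x => barDiff_barMap f i x), hy,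
      extMap_π _ (fun n x => barMap_π _ hfπ i n x)]

section Free

variable (W : Type u) [AddCommGroup W] [Module k W] (πF : ℕ → A ⊗[k] W →ₗ[k] A ⊗[k] W)
  (hπF : ∀ n (a : A) x, πF n (a • x) = ∑ y ∈ antidiagonal n, G.π y.1 a • πF y.2 x)

/-- The free `A`-module `A ⊗ W`. -/
@[reducible] noncomputable def free : DegMod G where
  X := A ⊗[k] W
  π := πF
  π_smul := hπF

/-- The map `a ↦ a - ε(a)` onto the augmentation ideal. -/
noncomputable def toPlus (G : AugAlg k A) : A →ₗ[k] G.plus :=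
  (LinearMap.id - Algebra.linearMap k A ∘ₗ G.ε.toLinearMap).codRestrict
    (G.plus.restrictScalars k) fun a => by simp [RingHom.mem_ker]

theorem toPlus_coe (a : A) : (toPlus G a : A) = a - G.ε a • (1 : A) := by
  rw [← Algebra.algebraMap_eq_smul_one]; rfl

/-- The contraction `a ⊗ w ↦ (a - ε(a)) ⊗ (1 ⊗ w)`. -/
noncomputable def contract (G : AugAlg k A) : A ⊗[k] W →ₗ[k] G.plus ⊗[k] (A ⊗[k] W) :=
  TensorProduct.map (toPlus G) (TensorProduct.mk k A W 1)

/-- The contracting homotopy of the bar complex of `A ⊗ W`. -/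
noncomputable def homotopy : (i : ℕ) →
    ((free W πF hπF).bar i).X →ₗ[k] ((free W πF hπF).bar i).ext.X
  | 0 => contract W G
  | i + 1 => -(extMap (homotopy i)).restrictScalars k

theorem extMap_add {M N : DegMod G} (f g : M.X →ₗ[k] N.X) (x : M.ext.X) :
    extMap (f + g) x = extMap f x + extMap g x :=
  LinearMap.congr_fun (LinearMap.lTensor_add G.plus f g) x

theorem extMap_neg {M N : DegMod G} (f : M.X →ₗ[k] N.X) (x : M.ext.X) :
    extMap (-f) x = -extMap f x :=
  LinearMap.congr_fun (LinearMap.lTensor_neg (M := G.plus) (f := f)) x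

theorem extMap_id (M : DegMod G) (x : M.ext.X) :
    extMap (LinearMap.id : M.X →ₗ[k] M.X) x = x :=
  LinearMap.congr_fun (LinearMap.lTensor_id G.plus M.X) x

theorem homotopy_step {M : DegMod G} (d : M.ext.X →ₗ[A] M.X) (h : M.X →ₗ[k] M.ext.X)
    (H : ∀ x, stepDiff d (-extMap h x) + h (d x) = x) (x : M.ext.ext.X) :
    stepDiff (stepDiff d) (-extMap (-(extMap h).restrictScalars k) x) +
      (-(extMap h).restrictScalars k) (stepDiff d x) = x := by
  have e1 : (stepDiff (stepDiff d)) (-extMap (-(extMap h).restrictScalars k) x) =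
      M.ext.ext.act (extMap ((extMap h).restrictScalars k) x) -
        extMap ((stepDiff d).restrictScalars k ∘ₗ (extMap h).restrictScalars k) x := by
    rw [extMap_neg, neg_neg, stepDiff_apply, extMap_comp]
  have e2 : (-(extMap h).restrictScalars k) (stepDiff d x) =
      extMap (h ∘ₗ d.restrictScalars k) x - extMap h (M.ext.act x) := by
    rw [LinearMap.neg_apply, LinearMap.restrictScalars_apply, stepDiff_apply, map_sub, neg_sub,
      extMap_comp]
  have e3 : h ∘ₗ d.restrictScalars k = LinearMap.id +
      (stepDiff d).restrictScalars k ∘ₗ (extMap h).restrictScalars k := by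
    refine LinearMap.ext fun y => ?_
    have := H y
    rw [map_neg] at this
    change h (d y) = y + stepDiff d (extMap h y)
    exact (neg_add_eq_iff_eq_add.1 this).trans (add_comm _ _)
  rw [e1, e2, act_extMap, e3, extMap_add, extMap_id]
  abel

theorem contract_spec (x : G.plus ⊗[k] (A ⊗[k] W)) :
    stepDiff (free W πF hπF).act (-extMap (M := free W πF hπF) (N := (free W πF hπF).ext)
      (contract W G) x) + contract W G ((free W πF hπF).act x) = x := by
  rw [map_neg, stepDiff_apply, extMap_comp]
  induction x using TensorProduct.induction_on with
  | zero => simp only [map_zero, sub_zero, neg_zero, add_zero]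
  | add x y hx hy =>
    conv_rhs => rw [← hx, ← hy]
    simp only [map_add]
    abel
  | tmul a x =>
    induction x using TensorProduct.induction_on with
    | zero => simp
    | add x y hx hy =>
      conv_rhs => rw [TensorProduct.tmul_add, ← hx, ← hy]
      simp only [map_add, TensorProduct.tmul_add]
      abel
    | tmul b w =>
      have h1 : contract W G (b ⊗ₜ w) = toPlus G b ⊗ₜ (1 ⊗ₜ w) := rfl
      have h2 : contract W G ((free W πF hπF).act (a ⊗ₜ (b ⊗ₜ w))) =
        toPlus G (a * b) ⊗ₜ (1 ⊗ₜ w) := rfl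
      have h3 : toPlus G (a * b) = (a : A) • toPlus G b + G.ε b • a := by
        refine Subtype.ext ?_
        have ha : G.ε a = 0 := a.2
        rw [Submodule.coe_add, Submodule.coe_smul, Submodule.coe_smul_of_tower, toPlus_coe,
          toPlus_coe, map_mul, ha]
        simp [mul_sub]
      have h4 : ((toPlus G b : A) • ((1 : A) ⊗ₜ[k] w) : A ⊗[k] W) =
          b ⊗ₜ w - G.ε b • ((1 : A) ⊗ₜ[k] w) := by
        rw [toPlus_coe, TensorProduct.smul_tmul', smul_eq_mul, mul_one, TensorProduct.sub_tmul,
          TensorProduct.smul_tmul']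
      rw [h2, extMap_tmul, extMap_tmul, h3]
      change -((a : A) • contract W G (b ⊗ₜ w) -
          a ⊗ₜ[k] (free W πF hπF).act (contract W G (b ⊗ₜ w)))
        + _ = _
      rw [h1, act_tmul, h4, TensorProduct.tmul_sub, TensorProduct.smul_tmul',
        TensorProduct.tmul_smul, TensorProduct.add_tmul, TensorProduct.smul_tmul']
      abel

theorem homotopy_spec (i : ℕ) (x : ((free W πF hπF).bar i).ext.X) :
    stepDiff ((free W πF hπF).barDiff i) (-extMap (homotopy W πF hπF i) x) +
      homotopy W πF hπF i ((free W πF hπF).barDiff i x) = x := by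
  induction i with
  | zero => exact contract_spec W πF hπF x
  | succ i ih => exact homotopy_step _ _ ih x

theorem free_barAcyclic : (free W πF hπF).BarAcyclic := by
  intro i x hx
  refine ⟨-extMap (homotopy W πF hπF i) x, ?_⟩
  have := homotopy_spec W πF hπF i x
  rwa [hx, map_zero, add_zero] at this

end Free

end DegMod
end Bar

/-! ### Words and coordinates in the tensor algebra -/

section Words

variable {k : Type u} [Field k] {ι : Type} [Fintype ι] {p : ι → ZMod 2} {N : ℕ}

namespace HomRel

/-- The monomial that corresponds to a word. -/
noncomputable def word (S : HomRel k p N) (w : List ι) : S.Alg := (w.map S.gen).prod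

theorem mon_eq_word (S : HomRel k p N) {n : ℕ} (I : Fin n → ι) :
    S.mon I = S.word (List.ofFn I) := by
  rw [mon, word, List.map_ofFn]; rfl

theorem word_nil (S : HomRel k p N) : S.word [] = 1 := rfl

theorem word_cons (S : HomRel k p N) (i : ι) (w : List ι) :
    S.word (i :: w) = S.gen i * S.word w := by
  simp [word]

theorem word_append (S : HomRel k p N) (v w : List ι) :
    S.word (v ++ w) = S.word v * S.word w := by
  simp [word]

theorem word_eq_mon (S : HomRel k p N) (w : List ι) : S.word w = S.mon w.get := by
  rw [mon_eq_word, List.ofFn_get]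

/-- Two linear maps on `A(V, R)` agree if they agree on words. -/
theorem word_ext {M : Type*} [AddCommGroup M] [Module k M] (S : HomRel k p N)
    {f g : S.Alg →ₗ[k] M} (h : ∀ w, f (S.word w) = g (S.word w)) : f = g :=
  S.linearMap_ext fun n I => by rw [mon_eq_word, h]

theorem word_mem_deg (S : HomRel k p N) (w : List ι) : S.word w ∈ S.deg w.length := by
  rw [word_eq_mon]; exact S.mon_mem_deg _

/-- The algebra morphism from `T(V)` to `C` that is determined by the images of the generators. -/
noncomputable def freeLift (p : ι → ZMod 2) (N : ℕ) {C : Type*} [Ring C] [Algebra k C]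
    (f : ι → C) : (free k p N).Alg →ₐ[k] C :=
  (free k p N).lift f (by
    intro r hr
    have : r = 0 := hr
    simp [this])

theorem freeLift_word {C : Type*} [Ring C] [Algebra k C] (f : ι → C) (w : List ι) :
    freeLift (k := k) p N f ((free k p N).word w) = (w.map f).prod := by
  rw [word, map_list_prod, List.map_map]
  congr 2
  funext i
  exact lift_gen _ _ _ i

/-- The coordinates of an element of `T(V)` with respect to the words. -/
noncomputable def coords : (free k p N).Alg →ₗ[k] (List ι →₀ k) :=
  (MonoidAlgebra.coeffLinearEquiv (S := k) (M := FreeMonoid ι) k).toLinearMap ∘ₗ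
    (freeLift (k := k) p N fun i => MonoidAlgebra.of k (FreeMonoid ι) (FreeMonoid.of i)).toLinearMap

theorem coords_word (w : List ι) :
    coords ((free k p N).word w) = Finsupp.single w (1 : k) := by
  have h : (w.map fun i => MonoidAlgebra.of k (FreeMonoid ι) (FreeMonoid.of i)).prod =
      MonoidAlgebra.of k (FreeMonoid ι) (FreeMonoid.ofList w) := by
    induction w with
    | nil => exact (map_one _).symm
    | cons i w ih => rw [List.map_cons, List.prod_cons, ih, ← map_mul]; rfl
  refine (congrArg (MonoidAlgebra.coeffLinearEquiv (S := k) (M := FreeMonoid ι) k)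
    ((freeLift_word _ w).trans h)).trans ?_
  rfl

/-- The coordinate isomorphism of `T(V)`. -/
noncomputable def coordsEquiv : (free k p N).Alg ≃ₗ[k] (List ι →₀ k) :=
  LinearEquiv.ofLinearMap coords (Finsupp.linearCombination k (free k p N).word)
    (by
      refine Finsupp.lhom_ext fun w c => ?_
      simp [coords_word])
    (by
      refine word_ext _ fun w => ?_
      simp [coords_word])

theorem coords_injective : Function.Injective (coords (k := k) (p := p) (N := N)) :=
  coordsEquiv.injective

theorem coords_ext {x y : (free k p N).Alg} (h : ∀ w, coords x w = coords y w) : x = y :=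
  coords_injective (Finsupp.ext h)

/-- The operator on `T(V)` that removes the prefix `v` from a word, and that annihilates the words
without this prefix. -/
noncomputable def strip (v : List ι) : (free k p N).Alg →ₗ[k] (free k p N).Alg :=
  coordsEquiv.symm.toLinearMap ∘ₗ
    Finsupp.lcomapDomain (R := k) (M := k) (fun w => v ++ w) (List.append_right_injective v) ∘ₗ
      coords

@[simp] theorem coords_strip (v w : List ι) (x : (free k p N).Alg) :
    coords (strip v x) w = coords x (v ++ w) := by
  have h : coords (strip v x) =
      Finsupp.lcomapDomain (R := k) (M := k) (fun w => v ++ w) (List.append_right_injective v)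
        (coords x) :=
    coordsEquiv.apply_symm_apply _
  rw [h]; rfl

/-- The operator on `T(V)` that removes the suffix `v` from a word, and that annihilates the words
without this suffix. -/
noncomputable def rstrip (v : List ι) : (free k p N).Alg →ₗ[k] (free k p N).Alg :=
  coordsEquiv.symm.toLinearMap ∘ₗ
    Finsupp.lcomapDomain (R := k) (M := k) (fun w => w ++ v) (List.append_left_injective v) ∘ₗ
      coords

@[simp] theorem coords_rstrip (v w : List ι) (x : (free k p N).Alg) :
    coords (rstrip v x) w = coords x (w ++ v) := by
  have h : coords (rstrip v x) =
      Finsupp.lcomapDomain (R := k) (M := k) (fun w => w ++ v) (List.append_left_injective v)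
        (coords x) :=
    coordsEquiv.apply_symm_apply _
  rw [h]; rfl

theorem strip_strip (v w : List ι) (x : (free k p N).Alg) :
    strip w (strip v x) = strip (v ++ w) x :=
  coords_ext fun _ => by simp

theorem coords_word_mul (v w : List ι) (x : (free k p N).Alg) :
    coords ((free k p N).word v * x) (v ++ w) = coords x w := by
  have h : Finsupp.lapply (v ++ w) ∘ₗ coords ∘ₗ LinearMap.mulLeft k ((free k p N).word v) =
      Finsupp.lapply w ∘ₗ coords := by
    classical
    refine word_ext _ fun y => ?_
    simp [← word_append, coords_word, Finsupp.single_apply]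
  exact LinearMap.congr_fun h x

theorem coords_word_mul_of_not_prefix {v w : List ι} (hvw : ¬ v <+: w) (x : (free k p N).Alg) :
    coords ((free k p N).word v * x) w = 0 := by
  have h : Finsupp.lapply w ∘ₗ coords ∘ₗ LinearMap.mulLeft k ((free k p N).word v) = 0 := by
    refine word_ext _ fun y => ?_
    have : v ++ y ≠ w := fun h => hvw ⟨y, h⟩
    simp [← word_append, coords_word, this]
  exact LinearMap.congr_fun h x

open Classical in
theorem strip_word_mul {v w : List ι} (h : v.length = w.length) (x : (free k p N).Alg) :
    strip v ((free k p N).word w * x) = if v = w then x else 0 := by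
  refine coords_ext fun y => ?_
  rw [coords_strip]
  split_ifs with hvw
  · subst hvw; exact coords_word_mul _ _ _
  · rw [coords_word_mul_of_not_prefix, map_zero, Finsupp.zero_apply]
    intro h'
    exact hvw (List.prefix_of_prefix_length_le (List.prefix_append v y) h' h.le |>.eq_of_length h)

theorem mem_deg_iff {x : (free k p N).Alg} {n : ℕ} :
    x ∈ (free k p N).deg n ↔ ∀ w, w.length ≠ n → coords x w = 0 := by
  constructor
  · intro hx w hw
    have h : (free k p N).deg n ≤ LinearMap.ker (Finsupp.lapply w ∘ₗ coords) := by
      rw [deg, Submodule.span_le]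
      rintro _ ⟨I, rfl⟩
      have : List.ofFn I ≠ w := fun h => hw (by rw [← h, List.length_ofFn])
      simp [mon_eq_word, coords_word, this]
    exact h hx
  · intro h
    have hx : x = (coords x).sum fun w c => c • (free k p N).word w :=
      (coordsEquiv.symm_apply_apply x).symm
    rw [hx]
    refine Submodule.sum_mem _ fun w hw => Submodule.smul_mem _ _ ?_
    by_cases hn : w.length = n
    · exact hn ▸ word_mem_deg _ w
    · exact absurd (h w hn) (Finsupp.mem_support_iff.1 hw)

theorem mul_mem_deg (S : HomRel k p N) {m n : ℕ} {x y : S.Alg} (hx : x ∈ S.deg m)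
    (hy : y ∈ S.deg n) : x * y ∈ S.deg (m + n) := by
  have h : S.deg m * S.deg n ≤ S.deg (m + n) := by
    rw [deg, deg, Submodule.span_mul_span, Submodule.span_le]
    rintro _ ⟨_, ⟨I, rfl⟩, _, ⟨J, rfl⟩, rfl⟩
    exact Submodule.subset_span ⟨Fin.append I J, (S.mon_append I J).symm⟩
  exact h (Submodule.mul_mem_mul hx hy)

theorem strip_mem_deg {v : List ι} {m n : ℕ} (h : v.length + m = n) {x : (free k p N).Alg}
    (hx : x ∈ (free k p N).deg n) : strip v x ∈ (free k p N).deg m := by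
  rw [mem_deg_iff] at hx ⊢
  intro w hw
  rw [coords_strip]
  refine hx _ ?_
  rw [List.length_append]
  omega

theorem strip_eq_zero {v : List ι} {n : ℕ} (h : n < v.length) {x : (free k p N).Alg}
    (hx : x ∈ (free k p N).deg n) : strip v x = 0 := by
  rw [mem_deg_iff] at hx
  refine coords_ext fun w => ?_
  rw [coords_strip, hx, map_zero, Finsupp.zero_apply]
  rw [List.length_append]
  omega

/-- Expansion of a tensor with respect to the first `d` factors. -/
theorem sum_mon_mul_strip {d m n : ℕ} (h : d + m = n) {x : (free k p N).Alg}
    (hx : x ∈ (free k p N).deg n) :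
    ∑ I : Fin d → ι, (free k p N).mon I * strip (List.ofFn I) x = x := by
  classical
  refine coords_ext fun w => ?_
  rw [map_sum, Finsupp.finsetSum_apply]
  by_cases hw : w.length = n
  · obtain ⟨I, v, rfl⟩ : ∃ (I : Fin d → ι) (v : List ι), w = List.ofFn I ++ v := by
      refine ⟨fun a => w[a], w.drop d, ?_⟩
      have : List.ofFn (fun a : Fin d => w[a]) = w.take d := by
        refine List.ext_getElem (by simp; omega) fun i h1 h2 => ?_
        simp
      rw [this, List.take_append_drop]
    rw [Finset.sum_eq_single I]
    · rw [mon_eq_word, coords_word_mul, coords_strip]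
    · intro J _ hJ
      rw [mon_eq_word, coords_word_mul_of_not_prefix]
      intro h'
      refine hJ (List.ofFn_injective ?_)
      exact (List.prefix_of_prefix_length_le h' (List.prefix_append _ v) (by simp)).eq_of_length
        (by simp)
    · simp
  · rw [mem_deg_iff.1 hx w hw]
    refine Finset.sum_eq_zero fun I _ => ?_
    have h1 := mul_mem_deg _ ((free k p N).mon_mem_deg I)
      (strip_mem_deg (v := List.ofFn I) (m := m) (by simpa using h) hx)
    exact mem_deg_iff.1 h1 w (by omega)

end HomRel
end Words

/-! ### Low degree relations of `A(V, R)` and its degree operators -/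

section Degrees

variable {k : Type u} [Field k] {ι : Type} [Fintype ι] {p : ι → ZMod 2} {N : ℕ}

namespace HomRel

/-- The coordinates of the part of degree `u.length + N + v.length` of an element of `T(V)` along
the words that start with `u` and end with `v`, as an `N`-tensor. -/
noncomputable def slice (u v : List ι) : (free k p N).Alg →ₗ[k] ((Fin N → ι) → k) :=
  LinearMap.pi fun I => Finsupp.lapply (u ++ List.ofFn I ++ v) ∘ₗ coords

theorem slice_apply (u v : List ι) (x : (free k p N).Alg) (I : Fin N → ι) :
    slice u v x I = coords x (u ++ List.ofFn I ++ v) := rfl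

theorem slice_strip (u v w : List ι) (x : (free k p N).Alg) :
    slice u v (strip w x) = slice (w ++ u) v x := by
  funext I
  simp [slice_apply]

theorem slice_rstrip (u v w : List ι) (x : (free k p N).Alg) :
    slice u v (rstrip w x) = slice u (v ++ w) x := by
  funext I
  simp [slice_apply]

theorem slice_of_mem_deg {n : ℕ} {u v : List ι} (h : u.length + N + v.length ≠ n)
    {x : (free k p N).Alg} (hx : x ∈ (free k p N).deg n) : slice u v x = 0 := by
  funext I
  refine mem_deg_iff.1 hx _ ?_
  simpa [add_assoc] using h

/-- The tensors without components of degree less than `N` whose component of degree `N` is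
a relation. -/
noncomputable def lowRel (R : HomRel k p N) : Submodule k (free k p N).Alg :=
  (⨅ (w : List ι) (_ : w.length < N), LinearMap.ker (Finsupp.lapply w ∘ₗ coords)) ⊓
    R.rel.comap (slice [] [])

theorem mem_lowRel {R : HomRel k p N} {x : (free k p N).Alg} :
    x ∈ R.lowRel ↔ (∀ w : List ι, w.length < N → coords x w = 0) ∧ slice [] [] x ∈ R.rel := by
  simp [lowRel, Submodule.mem_iInf]

theorem coords_gen_mul_of_lt {i : ι} {x : (free k p N).Alg} {w : List ι}
    (hx : ∀ v : List ι, v.length < w.length → coords x v = 0) :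
    coords ((free k p N).gen i * x) w = 0 := by
  classical
  by_cases h : [i] <+: w
  · obtain ⟨v, rfl⟩ := h
    have h1 := coords_word_mul [i] v x
    rw [word_cons, word_nil, mul_one] at h1
    rw [h1]
    exact hx v (by simp)
  · have h1 := coords_word_mul_of_not_prefix h x
    rwa [word_cons, word_nil, mul_one] at h1

theorem gen_mul_mem_lowRel (R : HomRel k p N) (i : ι) {x : (free k p N).Alg} (hx : x ∈ R.lowRel) :
    (free k p N).gen i * x ∈ R.lowRel := by
  rw [mem_lowRel] at hx ⊢
  refine ⟨fun w hw => coords_gen_mul_of_lt fun v hv => hx.1 v (hv.trans hw), ?_⟩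
  convert R.rel.zero_mem
  funext I
  exact coords_gen_mul_of_lt fun v hv => hx.1 v (by simpa using hv)

/-- The operator of left multiplication by `x_i` on the quotient of `T(V)` by `lowRel`. -/
noncomputable def lowMul (R : HomRel k p N) (i : ι) :
    Module.End k ((free k p N).Alg ⧸ R.lowRel) :=
  Submodule.mapQ R.lowRel R.lowRel (LinearMap.mulLeft k ((free k p N).gen i))
    fun _ hx => R.gen_mul_mem_lowRel i hx

theorem prod_lowMul (R : HomRel k p N) (w : List ι) (x : (free k p N).Alg) :
    (w.map R.lowMul).prod (R.lowRel.mkQ x) = R.lowRel.mkQ ((free k p N).word w * x) := by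
  induction w with
  | nil => simp [word_nil]
  | cons i w ih =>
    rw [List.map_cons, List.prod_cons, Module.End.mul_apply, ih, word_cons, mul_assoc]
    rfl

/-- The representation of `A(V, R)` on the quotient of `T(V)` by `lowRel`. -/
noncomputable def lowRep (R : HomRel k p N) :
    R.Alg →ₐ[k] Module.End k ((free k p N).Alg ⧸ R.lowRel) :=
  R.lift R.lowMul (by
    intro r hr
    refine LinearMap.ext fun x => ?_
    obtain ⟨x, rfl⟩ := R.lowRel.mkQ_surjective x
    have h1 : (∑ I, r I • (List.ofFn fun a => R.lowMul (I a)).prod) (R.lowRel.mkQ x) =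
        R.lowRel.mkQ (∑ I, r I • ((free k p N).word (List.ofFn I) * x)) := by
      rw [LinearMap.sum_apply, map_sum]
      refine Finset.sum_congr rfl fun I _ => ?_
      rw [LinearMap.smul_apply, map_smul, ← prod_lowMul, List.map_ofFn]
      rfl
    rw [h1, LinearMap.zero_apply, Submodule.mkQ_apply, Submodule.Quotient.mk_eq_zero, mem_lowRel]
    constructor
    · intro w hw
      rw [map_sum, Finsupp.finsetSum_apply]
      refine Finset.sum_eq_zero fun I _ => ?_
      rw [map_smul, Finsupp.smul_apply, coords_word_mul_of_not_prefix, smul_zero]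
      intro h
      have := h.length_le
      rw [List.length_ofFn] at this
      omega
    · convert R.rel.smul_mem (coords x []) hr
      funext J
      rw [slice_apply, List.nil_append, List.append_nil, map_sum, Finsupp.finsetSum_apply,
        Finset.sum_eq_single J]
      · rw [map_smul, Finsupp.smul_apply]
        have := coords_word_mul (List.ofFn J) [] x
        rw [List.append_nil] at this
        rw [this, smul_eq_mul, mul_comm]
        rfl
      · intro I _ hI
        rw [map_smul, Finsupp.smul_apply, coords_word_mul_of_not_prefix, smul_zero]
        intro h
        exact hI (List.ofFn_injective (h.eq_of_length (by simp)))
      · simp)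

/-- The canonical map `T(V) → A(V, R)`. -/
noncomputable def quot (R : HomRel k p N) : (free k p N).Alg →ₐ[k] R.Alg :=
  freeLift p N R.gen

theorem quot_word (R : HomRel k p N) (w : List ι) : R.quot ((free k p N).word w) = R.word w :=
  freeLift_word _ _

theorem quot_mon (R : HomRel k p N) {n : ℕ} (I : Fin n → ι) :
    R.quot ((free k p N).mon I) = R.mon I := by
  rw [mon_eq_word, mon_eq_word, quot_word]

/-- The relations of `A(V, R)` of degree less than `N` are trivial, and those of degree `N` are
given by `R`. -/
theorem mem_lowRel_of_quot_eq_zero (R : HomRel k p N) {x : (free k p N).Alg} (hx : R.quot x = 0) :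
    x ∈ R.lowRel := by
  have h : ∀ x, R.lowRep (R.quot x) (R.lowRel.mkQ 1) = R.lowRel.mkQ x := by
    intro x
    have : (LinearMap.applyₗ (R.lowRel.mkQ 1)) ∘ₗ R.lowRep.toLinearMap ∘ₗ R.quot.toLinearMap =
        R.lowRel.mkQ := by
      refine word_ext _ fun w => ?_
      change R.lowRep (R.quot ((free k p N).word w)) (R.lowRel.mkQ 1) = _
      rw [quot_word, word, map_list_prod, List.map_map]
      have e : (⇑R.lowRep ∘ R.gen) = R.lowMul := funext fun i => R.lift_gen _ _ i
      rw [e, prod_lowMul, mul_one]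
    exact LinearMap.congr_fun this x
  have h1 := h x
  rw [hx, map_zero, LinearMap.zero_apply] at h1
  exact (Submodule.Quotient.mk_eq_zero _).1 h1.symm

/-- The algebra morphism `A → A[t]` that multiplies the elements of degree `n` by `t ^ n`. -/
noncomputable def degHom (R : HomRel k p N) : R.Alg →ₐ[k] Polynomial R.Alg :=
  R.lift (fun i => Polynomial.monomial 1 (R.gen i)) (by
    intro r hr
    have h : ∀ {n : ℕ} (I : Fin n → ι),
        (List.ofFn fun a => Polynomial.monomial 1 (R.gen (I a))).prod =
        Polynomial.monomial n (R.mon I) := by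
      intro n I
      induction n with
      | zero => simp [mon_zero]
      | succ n ih =>
        obtain ⟨i, I, rfl⟩ := cons_surj I
        rw [List.ofFn_succ, List.prod_cons]
        simp only [Fin.cons_succ, Fin.cons_zero]
        rw [ih, Polynomial.monomial_mul_monomial, mon_cons, add_comm]
    simp only [h, Polynomial.smul_monomial, ← map_sum, R.sum_rel hr, map_zero])

theorem degHom_word (R : HomRel k p N) (w : List ι) :
    R.degHom (R.word w) = Polynomial.monomial w.length (R.word w) := by
  induction w with
  | nil => simp [word_nil]
  | cons i w ih =>
    rw [word_cons, map_mul, ih, degHom, lift_gen, Polynomial.monomial_mul_monomial,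
      List.length_cons,
      add_comm]

/-- The projection of `A` onto its component of degree `n`. -/
noncomputable def degProj (R : HomRel k p N) (n : ℕ) : R.Alg →ₗ[k] R.Alg :=
  (Polynomial.lcoeff R.Alg n).restrictScalars k ∘ₗ R.degHom.toLinearMap

theorem degProj_apply (R : HomRel k p N) (n : ℕ) (a : R.Alg) :
    R.degProj n a = (R.degHom a).coeff n := rfl

theorem degProj_word (R : HomRel k p N) (n : ℕ) (w : List ι) :
    R.degProj n (R.word w) = if w.length = n then R.word w else 0 := by
  rw [degProj_apply, degHom_word, Polynomial.coeff_monomial]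

theorem degProj_of_mem (R : HomRel k p N) {m n : ℕ} {a : R.Alg} (ha : a ∈ R.deg m) :
    R.degProj n a = if m = n then a else 0 := by
  have h : R.deg m ≤ LinearMap.ker (R.degProj n - if m = n then LinearMap.id else 0) := by
    rw [deg, Submodule.span_le]
    rintro _ ⟨I, rfl⟩
    rw [SetLike.mem_coe, LinearMap.mem_ker, LinearMap.sub_apply, mon_eq_word, degProj_word,
      List.length_ofFn]
    split_ifs <;> simp
  have := h ha
  rw [LinearMap.mem_ker, LinearMap.sub_apply, sub_eq_zero] at this
  rw [this]
  split_ifs <;> simp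

theorem degProj_mem (R : HomRel k p N) (n : ℕ) (a : R.Alg) : R.degProj n a ∈ R.deg n := by
  have h : LinearMap.range (R.degProj n) ≤ R.deg n := by
    rw [LinearMap.range_eq_map, ← R.span_mon, Submodule.map_span, Submodule.span_le]
    rintro _ ⟨_, ⟨m, I, rfl⟩, rfl⟩
    rw [mon_eq_word, degProj_word]
    split_ifs with h
    · exact h ▸ R.word_mem_deg _
    · exact Submodule.zero_mem _
  exact h ⟨a, rfl⟩

/-- Every element is the sum of its homogeneous components. -/
theorem exists_sum_degProj (R : HomRel k p N) (a : R.Alg) :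
    ∃ s, ∀ m, s ≤ m → ∑ n ∈ Finset.range m, R.degProj n a = a := by
  have h : a ∈ Submodule.span k {x : R.Alg | ∃ (n : ℕ) (I : Fin n → ι), x = R.mon I} := by
    rw [R.span_mon]; trivial
  induction h using Submodule.span_induction with
  | mem x h =>
    obtain ⟨n, I, rfl⟩ := h
    refine ⟨n + 1, fun m hm => ?_⟩
    rw [Finset.sum_eq_single n, mon_eq_word, degProj_word, if_pos (by simp)]
    · intro l _ hl
      rw [mon_eq_word, degProj_word, if_neg (by simpa using hl.symm)]
    · simp; omega
  | zero => exact ⟨0, fun m _ => by simp⟩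
  | add x y _ _ hx hy =>
    obtain ⟨s, hs⟩ := hx
    obtain ⟨t, ht⟩ := hy
    refine ⟨max s t, fun m hm => ?_⟩
    simp only [map_add, Finset.sum_add_distrib]
    rw [hs m (le_trans (le_max_left _ _) hm), ht m (le_trans (le_max_right _ _) hm)]
  | smul c x _ hx =>
    obtain ⟨s, hs⟩ := hx
    refine ⟨s, fun m hm => ?_⟩
    simp only [map_smul, ← Finset.smul_sum, hs m hm]

/-- The augmentation of `A`; this uses that the relations have positive degree. -/
noncomputable def augHom (R : HomRel k p N) (hN : 0 < N) : R.Alg →ₐ[k] k :=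
  R.lift (fun _ => 0) (by
    intro r hr
    refine Finset.sum_eq_zero fun I _ => ?_
    obtain ⟨n, rfl⟩ : ∃ n, N = n + 1 := ⟨N - 1, by omega⟩
    simp [List.ofFn_succ])

theorem augHom_word (R : HomRel k p N) (hN : 0 < N) (w : List ι) :
    R.augHom hN (R.word w) = if w.length = 0 then 1 else 0 := by
  cases w with
  | nil => simp [word_nil]
  | cons i w => simp [word_cons, augHom]

theorem degProj_zero (R : HomRel k p N) (hN : 0 < N) (a : R.Alg) :
    R.degProj 0 a = R.augHom hN a • (1 : R.Alg) := by
  have : R.degProj 0 = (R.augHom hN).toLinearMap.smulRight (1 : R.Alg) := by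
    refine R.word_ext fun w => ?_
    rw [degProj_word, LinearMap.smulRight_apply, AlgHom.toLinearMap_apply, augHom_word]
    split_ifs with h
    · rw [List.length_eq_zero_iff.1 h, word_nil, one_smul]
    · rw [zero_smul]
  rw [this]; rfl

theorem augHom_degProj (R : HomRel k p N) (hN : 0 < N) (n : ℕ) (a : R.Alg) :
    R.augHom hN (R.degProj n a) = if n = 0 then R.augHom hN a else 0 := by
  have : (R.augHom hN).toLinearMap ∘ₗ R.degProj n =
      if n = 0 then (R.augHom hN).toLinearMap else 0 := by
    refine R.word_ext fun w => ?_
    rw [LinearMap.comp_apply, degProj_word, AlgHom.toLinearMap_apply]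
    by_cases h1 : n = 0
    · subst h1
      rw [if_pos rfl, AlgHom.toLinearMap_apply, augHom_word]
      split_ifs with h2
      · rw [augHom_word, if_pos h2]
      · rw [map_zero]
    · rw [if_neg h1, LinearMap.zero_apply]
      split_ifs with h2
      · rw [augHom_word, if_neg (by omega)]
      · rw [map_zero]
  have h2 := LinearMap.congr_fun this a
  rw [LinearMap.comp_apply, AlgHom.toLinearMap_apply] at h2
  rw [h2]
  split_ifs <;> rfl

/-- The algebra `A` with its augmentation and its degree operators. -/
noncomputable def aug (R : HomRel k p N) (hN : 0 < N) : AugAlg k R.Alg where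
  ε := R.augHom hN
  π := R.degProj
  π_mul n a b := by
    rw [degProj_apply, map_mul, Polynomial.coeff_mul]
    rfl
  ε_π n a h := by
    rw [augHom_degProj, h, ite_self]

end HomRel
end Degrees

/-! ### The spaces `A^{!*}_n` in coordinates -/

section DualSub

variable {k : Type u} [Field k] {ι : Type} [Fintype ι] {p : ι → ZMod 2} {N : ℕ}

namespace HomRel

theorem sum_coords_mon {n : ℕ} {x : (free k p N).Alg} (hx : x ∈ (free k p N).deg n) :
    ∑ I : Fin n → ι, coords x (List.ofFn I) • (free k p N).mon I = x := by
  refine Eq.trans (Finset.sum_congr rfl fun I _ => ?_) (sum_mon_mul_strip (add_zero n) hx)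
  have h : strip (List.ofFn I) x = coords x (List.ofFn I) • (1 : (free k p N).Alg) := by
    refine coords_ext fun w => ?_
    rw [coords_strip, map_smul, ← word_nil, coords_word, Finsupp.smul_apply]
    cases w with
    | nil => simp
    | cons i w =>
      rw [mem_deg_iff.1 hx _ (by simp)]
      simp
  rw [h, mul_smul_comm, mul_one]

theorem mem_relT_mul_deg (R : HomRel k p N) {m : ℕ} {x : (free k p N).Alg} :
    x ∈ R.relT * (free k p N).deg m ↔
      x ∈ (free k p N).deg (N + m) ∧ ∀ v : List ι, v.length = m → slice [] v x ∈ R.rel := by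
  classical
  constructor
  · intro hx
    have hle : R.relT * (free k p N).deg m ≤ (free k p N).deg (N + m) ⊓
        ⨅ (v : List ι) (_ : v.length = m), R.rel.comap (slice [] v) := by
      rw [Submodule.mul_le]
      rintro _ ⟨r, hr, rfl⟩ b hb
      have hd : Fintype.linearCombination k (fun I : Fin N → ι => (free k p N).mon I) r ∈
          (free k p N).deg N := by
        rw [Fintype.linearCombination_apply]
        exact Submodule.sum_mem _ fun I _ => Submodule.smul_mem _ _ (mon_mem_deg _ I)
      refine ⟨mul_mem_deg _ hd hb, ?_⟩
      simp only [SetLike.mem_coe, Submodule.mem_iInf]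
      intro v hv
      have h : slice [] v (Fintype.linearCombination k
          (fun I : Fin N → ι => (free k p N).mon I) r * b) = coords b v • r := by
        funext I
        rw [Fintype.linearCombination_apply, Finset.sum_mul, slice_apply, List.nil_append, map_sum,
          Finsupp.finsetSum_apply, Finset.sum_eq_single I]
        · rw [smul_mul_assoc, map_smul, Finsupp.smul_apply, mon_eq_word, coords_word_mul,
            Pi.smul_apply, smul_eq_mul, smul_eq_mul, mul_comm]
        · intro J _ hJ
          rw [smul_mul_assoc, map_smul, Finsupp.smul_apply, mon_eq_word,
            coords_word_mul_of_not_prefix, smul_zero]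
          intro h'
          refine hJ (List.ofFn_injective ?_)
          exact (List.prefix_of_prefix_length_le h' (List.prefix_append _ v) (by simp)).eq_of_length
            (by simp)
        · simp
      rw [Submodule.mem_comap, h]
      exact R.rel.smul_mem _ hr
    have := hle hx
    simpa [Submodule.mem_iInf] using this
  · rintro ⟨hx, h⟩
    have e : x = ∑ J : Fin m → ι, Fintype.linearCombination k
        (fun I : Fin N → ι => (free k p N).mon I) (slice [] (List.ofFn J) x) *
          (free k p N).mon J := by
      simp only [Fintype.linearCombination_apply, Finset.sum_mul]
      rw [Finset.sum_comm]
      refine (sum_mon_mul_strip rfl hx).symm.trans (Finset.sum_congr rfl fun I _ => ?_)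
      have h1 : strip (List.ofFn I) x ∈ (free k p N).deg m := strip_mem_deg (by simp) hx
      rw [← sum_coords_mon h1, Finset.mul_sum]
      refine Finset.sum_congr rfl fun J _ => ?_
      rw [coords_strip, slice_apply, List.nil_append, mul_smul_comm,
        smul_mul_assoc]
    rw [e]
    exact Submodule.sum_mem _ fun J _ => Submodule.mul_mem_mul ⟨_, h _ (by simp), rfl⟩
      (mon_mem_deg _ J)

theorem mem_deg_mul_iff {X : Submodule k (free k p N).Alg} {i m : ℕ}
    (hX : X ≤ (free k p N).deg m) {x : (free k p N).Alg} :
    x ∈ (free k p N).deg i * X ↔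
      x ∈ (free k p N).deg (i + m) ∧ ∀ u : List ι, u.length = i → strip u x ∈ X := by
  classical
  constructor
  · intro hx
    have hle : (free k p N).deg i * X ≤ (free k p N).deg (i + m) ⊓
        ⨅ (u : List ι) (_ : u.length = i), X.comap (strip u) := by
      have h1 : (free k p N).deg i * X =
          Submodule.span k {x | ∃ I : Fin i → ι, x = (free k p N).mon I} * Submodule.span k X := by
        rw [Submodule.span_eq]; rfl
      rw [h1, Submodule.span_mul_span, Submodule.span_le]
      rintro _ ⟨_, ⟨I, rfl⟩, y, hy, rfl⟩
      refine ⟨mul_mem_deg _ (mon_mem_deg _ I) (hX hy), ?_⟩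
      simp only [SetLike.mem_coe, Submodule.mem_iInf, Submodule.mem_comap]
      intro u hu
      rw [mon_eq_word, strip_word_mul (by simpa using hu)]
      split_ifs
      · exact hy
      · exact X.zero_mem
    have := hle hx
    simpa [Submodule.mem_iInf] using this
  · rintro ⟨hx, h⟩
    rw [← sum_mon_mul_strip rfl hx]
    exact Submodule.sum_mem _ fun I _ => Submodule.mul_mem_mul (mon_mem_deg _ I) (h _ (by simp))

/-- The elements of `A^{!*}_n` are the tensors of degree `n` all of whose slices are relations. -/
theorem mem_dualSub_iff (R : HomRel k p N) {n : ℕ} {x : (free k p N).Alg} :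
    x ∈ R.dualSub n ↔ x ∈ (free k p N).deg n ∧ ∀ u v : List ι, slice u v x ∈ R.rel := by
  have key : ∀ i j : ℕ, x ∈ (free k p N).deg i * R.relT * (free k p N).deg j ↔
      x ∈ (free k p N).deg (i + N + j) ∧ ∀ u v : List ι, u.length = i → v.length = j →
        slice u v x ∈ R.rel := by
    intro i j
    rw [mul_assoc, mem_deg_mul_iff (fun y hy => (R.mem_relT_mul_deg.1 hy).1), ← add_assoc]
    refine and_congr_right fun hx => ⟨fun h u v hu hv => ?_, fun h u hu => ?_⟩
    · have := (R.mem_relT_mul_deg.1 (h u hu)).2 v hv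
      rwa [slice_strip, List.append_nil] at this
    · refine R.mem_relT_mul_deg.2 ⟨strip_mem_deg (by omega) hx, fun v hv => ?_⟩
      rw [slice_strip, List.append_nil]
      exact h u v hu hv
  simp only [dualSub, Submodule.mem_inf, Submodule.mem_iInf]
  refine and_congr_right fun hx => ⟨fun h u v => ?_, fun h i j hij => ?_⟩
  · by_cases hn : u.length + N + v.length = n
    · exact ((key _ _).1 (h _ _ hn)).2 u v rfl rfl
    · rw [slice_of_mem_deg hn hx]
      exact R.rel.zero_mem
  · exact (key i j).2 ⟨hij ▸ hx, fun u v _ _ => h u v⟩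

theorem dualSub_le_deg (R : HomRel k p N) (n : ℕ) : R.dualSub n ≤ (free k p N).deg n :=
  inf_le_left

theorem dualSub_eq_deg (R : HomRel k p N) {n : ℕ} (hn : n < N) :
    R.dualSub n = (free k p N).deg n := by
  refine le_antisymm (R.dualSub_le_deg n) fun x hx => R.mem_dualSub_iff.2 ⟨hx, fun u v => ?_⟩
  rw [slice_of_mem_deg (by omega) hx]
  exact R.rel.zero_mem

theorem strip_mem_dualSub (R : HomRel k p N) {v : List ι} {m n : ℕ} (h : v.length + m = n)
    {x : (free k p N).Alg} (hx : x ∈ R.dualSub n) : strip v x ∈ R.dualSub m := by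
  rw [mem_dualSub_iff] at hx ⊢
  refine ⟨strip_mem_deg h hx.1, fun u w => ?_⟩
  rw [slice_strip]
  exact hx.2 _ _

/-- The restriction of the operator `strip` to the spaces `A^{!*}_n`. -/
noncomputable def stripDual (R : HomRel k p N) {d m n : ℕ} (h : d + m = n) (I : Fin d → ι) :
    R.dualSub n →ₗ[k] R.dualSub m :=
  (strip (List.ofFn I)).restrict fun _ hx => R.strip_mem_dualSub (by simpa using h) hx

@[simp] theorem stripDual_coe (R : HomRel k p N) {d m n : ℕ} (h : d + m = n) (I : Fin d → ι)
    (x : R.dualSub n) : (R.stripDual h I x : (free k p N).Alg) = strip (List.ofFn I) x := rfl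

end HomRel
end DualSub

/-! ### The Koszul complex -/

section KoszulComplex

/-- A submodule that is stable under the degree operators. -/
@[reducible] noncomputable def DegMod.sub {k A : Type u} [Field k] [Ring A] [Algebra k A]
    {G : AugAlg k A} (M : DegMod G)
    (Z : Submodule A M.X) (hZ : ∀ n, ∀ z ∈ Z, M.π n z ∈ Z) : DegMod G where
  X := Z
  moduleBase := Submodule.module' Z
  isScalarTower := ⟨fun a b z => Subtype.ext (smul_assoc a b (z : M.X))⟩
  π n := (M.π n).restrict (p := Z.restrictScalars k) (q := Z.restrictScalars k) (hZ n)
  π_smul n a x := by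
    refine Subtype.ext ?_
    refine (M.π_smul n a x).trans ?_
    rw [AddSubmonoidClass.coe_finsetSum]
    rfl

variable {k : Type u} [Field k] {ι : Type} [Fintype ι] {p : ι → ZMod 2} {N : ℕ}

namespace HomRel

/-- The degree operators of `A ⊗ W`, where `W` is placed in degree `m`. -/
noncomputable def tensorDeg (R : HomRel k p N) (W : Type u) [AddCommGroup W] [Module k W]
    (m n : ℕ) : R.Alg ⊗[k] W →ₗ[k] R.Alg ⊗[k] W :=
  ∑ x ∈ antidiagonal n, TensorProduct.map (R.degProj x.1) (if x.2 = m then LinearMap.id else 0)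

section

variable (R : HomRel k p N) {W : Type u} [AddCommGroup W] [Module k W]

theorem tensorDeg_smul (m n : ℕ) (a : R.Alg) (x : R.Alg ⊗[k] W) :
    R.tensorDeg W m n (a • x) =
      ∑ y ∈ antidiagonal n, R.degProj y.1 a • R.tensorDeg W m y.2 x := by
  induction x with
  | zero => simp
  | add x y hx hy => simp only [smul_add, map_add, hx, hy, Finset.sum_add_distrib]
  | tmul b w =>
    have h : ∀ n, R.degProj n (a * b) =
        ∑ y ∈ antidiagonal n, R.degProj y.1 a * R.degProj y.2 b := by
      intro n
      rw [degProj_apply, map_mul, Polynomial.coeff_mul]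
      rfl
    simp only [tensorDeg, TensorProduct.smul_tmul', LinearMap.sum_apply, TensorProduct.map_tmul,
      Finset.smul_sum, smul_eq_mul, h, TensorProduct.sum_tmul]
    exact sum_antidiagonal_assoc n fun i j l => (R.degProj i a * R.degProj j b) ⊗ₜ[k]
      ((if l = m then LinearMap.id else 0 : W →ₗ[k] W) w)

theorem tensorDeg_add (m l : ℕ) :
    R.tensorDeg W m (l + m) = TensorProduct.map (R.degProj l) LinearMap.id := by
  rw [tensorDeg, Finset.sum_eq_single (l, m)]
  · simp
  · rintro ⟨i, j⟩ h hij
    rw [mem_antidiagonal] at h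
    have : j ≠ m := by
      rintro rfl
      exact hij (by simp_all)
    simp [this]
  · simp

theorem tensorDeg_of_lt {m n : ℕ} (h : n < m) : R.tensorDeg W m n = 0 := by
  refine Finset.sum_eq_zero fun x hx => ?_
  rw [mem_antidiagonal] at hx
  rw [if_neg (by omega), TensorProduct.map_zero_right]

theorem tensorDeg_tmul {l m n : ℕ} {a : R.Alg} (ha : a ∈ R.deg l) (w : W) :
    R.tensorDeg W m n (a ⊗ₜ w) = if l + m = n then a ⊗ₜ w else 0 := by
  by_cases h : n < m
  · rw [R.tensorDeg_of_lt h, if_neg (by omega), LinearMap.zero_apply]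
  · obtain ⟨j, rfl⟩ : ∃ j, n = j + m := ⟨n - m, by omega⟩
    rw [tensorDeg_add, TensorProduct.map_tmul, R.degProj_of_mem ha, LinearMap.id_apply]
    simp only [Nat.add_right_cancel_iff]
    split_ifs <;> simp

/-- Maps on `A ⊗ W` agree if they agree on the elements `x_w ⊗ y`. -/
theorem tensor_ext {Y : Type*} [AddCommGroup Y] [Module k Y] {f g : R.Alg ⊗[k] W →ₗ[k] Y}
    (h : ∀ (v : List ι) (y : W), f (R.word v ⊗ₜ y) = g (R.word v ⊗ₜ y)) : f = g :=
  TensorProduct.ext (R.word_ext fun v => LinearMap.ext fun y => h v y)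

theorem tensorDeg_tensorDeg (l m n : ℕ) (x : R.Alg ⊗[k] W) :
    R.tensorDeg W m l (R.tensorDeg W m n x) = if n = l then R.tensorDeg W m n x else 0 := by
  have : R.tensorDeg W m l ∘ₗ R.tensorDeg W m n = if n = l then R.tensorDeg W m n else 0 := by
    refine R.tensor_ext fun v y => ?_
    rw [LinearMap.comp_apply, R.tensorDeg_tmul (R.word_mem_deg v), apply_ite (R.tensorDeg W m l),
      R.tensorDeg_tmul (R.word_mem_deg v)]
    by_cases h1 : n = l
    · subst h1
      rw [if_pos rfl, R.tensorDeg_tmul (R.word_mem_deg v)]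
      split_ifs <;> simp
    · rw [if_neg h1, map_zero, LinearMap.zero_apply]
      split_ifs <;> first | rfl | omega
  have h := LinearMap.congr_fun this x
  rw [LinearMap.comp_apply] at h
  rw [h]
  split_ifs <;> rfl

theorem exists_sum_tensorDeg (m : ℕ) (x : R.Alg ⊗[k] W) :
    ∃ s, ∀ j, s ≤ j → ∑ n ∈ Finset.range j, R.tensorDeg W m n x = x := by
  induction x with
  | zero => exact ⟨0, fun m _ => by simp⟩
  | add x y hx hy =>
    obtain ⟨s, hs⟩ := hx
    obtain ⟨t, ht⟩ := hy
    refine ⟨max s t, fun m hm => ?_⟩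
    simp only [map_add, Finset.sum_add_distrib]
    rw [hs m (le_trans (le_max_left _ _) hm), ht m (le_trans (le_max_right _ _) hm)]
  | tmul a w =>
    obtain ⟨s, hs⟩ := R.exists_sum_degProj a
    refine ⟨s + m, fun j hj => ?_⟩
    obtain ⟨t, rfl⟩ : ∃ t, j = t + m := ⟨j - m, by omega⟩
    rw [add_comm t m, Finset.sum_range_add, Finset.sum_eq_zero, zero_add]
    · have : ∀ i, R.tensorDeg W m (m + i) (a ⊗ₜ w) = R.degProj i a ⊗ₜ w := by
        intro i
        rw [add_comm, tensorDeg_add]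
        rfl
      simp only [this, ← TensorProduct.sum_tmul]
      rw [hs t (by omega)]
    · intro i hi
      rw [R.tensorDeg_of_lt (Finset.mem_range.1 hi), LinearMap.zero_apply]

/-- A relation `∑ x_I ⊗ y_I = 0` in `A ⊗ W` gives relations in `T(V)`. -/
theorem sum_mem_lowRel {d : ℕ} {y : (Fin d → ι) → W}
    (h : ∑ I, R.mon I ⊗ₜ[k] y I = 0) (g : W →ₗ[k] k) :
    ∑ I, g (y I) • (free k p N).mon I ∈ R.lowRel := by
  refine R.mem_lowRel_of_quot_eq_zero ?_
  have h1 := congrArg (fun x => TensorProduct.rid k R.Alg (g.lTensor R.Alg x)) h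
  simpa [map_sum, quot_mon] using h1

/-- Tensors `∑ x_I ⊗ y_I` with words `I` of length less than `N` vanish only if all `y_I` do. -/
theorem eq_zero_of_sum_mon_tmul {d : ℕ} (hd : d < N) {y : (Fin d → ι) → W}
    (h : ∑ I, R.mon I ⊗ₜ[k] y I = 0) (I : Fin d → ι) : y I = 0 := by
  classical
  rw [← Module.forall_dual_apply_eq_zero_iff k]
  intro g
  have h1 := (mem_lowRel.1 (R.sum_mem_lowRel h g)).1 (List.ofFn I) (by simpa using hd)
  rw [map_sum, Finsupp.finsetSum_apply, Finset.sum_eq_single I] at h1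
  · simpa [mon_eq_word, coords_word] using h1
  · intro J _ hJ
    have : List.ofFn J ≠ List.ofFn I := fun h => hJ (List.ofFn_injective h)
    simp [mon_eq_word, coords_word, this]
  · simp

theorem rel_of_sum_mon_tmul {y : (Fin N → ι) → W}
    (h : ∑ I, R.mon I ⊗ₜ[k] y I = 0) (g : W →ₗ[k] k) : (fun I => g (y I)) ∈ R.rel := by
  classical
  convert (mem_lowRel.1 (R.sum_mem_lowRel h g)).2
  rename_i I
  rw [slice_apply, map_sum, Finsupp.finsetSum_apply, Finset.sum_eq_single I]
  · simp [mon_eq_word, coords_word]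
  · intro J _ hJ
    have : List.ofFn J ≠ List.ofFn I := fun h => hJ (List.ofFn_injective h)
    simp [mon_eq_word, coords_word, this]
  · simp

end

theorem sum_words {M : Type*} [AddCommMonoid M] {d e n : ℕ} (h : d + e = n) (F : List ι → M) :
    ∑ I : Fin d → ι, ∑ J : Fin e → ι, F (List.ofFn I ++ List.ofFn J) =
      ∑ I : Fin n → ι, F (List.ofFn I) := by
  subst h
  rw [← Finset.sum_product', Finset.univ_product_univ]
  refine Fintype.sum_equiv (Fin.appendEquiv d e) _ _ fun x => ?_
  rw [← List.ofFn_fin_append]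
  rfl

variable (R : HomRel k p N)

/-- The vanishing of `∑ x_I ⊗ y_I` in `A ⊗ A^{!*}_m` can be tested on the coordinates of
the `y_I`. -/
theorem sum_mon_tmul_eq_zero {d m : ℕ} {y : (Fin d → ι) → R.dualSub m}
    (h : ∀ v : List ι, ∑ I, coords (y I : (free k p N).Alg) v • R.mon I = 0) :
    ∑ I, R.mon I ⊗ₜ[k] y I = 0 := by
  refine Module.Flat.lTensor_preserves_injective_linearMap (M := R.Alg) (R.dualSub m).subtype
    (R.dualSub m).injective_subtype ?_
  rw [map_zero, map_sum]
  have e : ∀ I, (R.dualSub m).subtype.lTensor R.Alg (R.mon I ⊗ₜ[k] y I) =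
      ∑ J : Fin m → ι, (coords (y I : (free k p N).Alg) (List.ofFn J) • R.mon I) ⊗ₜ[k]
        (free k p N).mon J := by
    intro I
    rw [LinearMap.lTensor_tmul, Submodule.subtype_apply,
      ← sum_coords_mon (R.dualSub_le_deg m (y I).2), TensorProduct.tmul_sum]
    refine Finset.sum_congr rfl fun J _ => ?_
    rw [TensorProduct.tmul_smul, TensorProduct.smul_tmul',
      sum_coords_mon (R.dualSub_le_deg m (y I).2)]
  simp only [e]
  rw [Finset.sum_comm]
  refine Finset.sum_eq_zero fun J _ => ?_
  rw [← TensorProduct.sum_tmul, h (List.ofFn J), TensorProduct.zero_tmul]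

/-- The map `a ⊗ w ↦ ∑ a x_I ⊗ w_I`, where `w = ∑ x_I ⊗ w_I` with words `I` of length `d`. -/
noncomputable def kos {d m n : ℕ} (h : d + m = n) :
    R.Alg ⊗[k] R.dualSub n →ₗ[R.Alg] R.Alg ⊗[k] R.dualSub m :=
  ∑ I : Fin d → ι, TensorProduct.AlgebraTensorModule.map
    (LinearMap.toSpanSingleton R.Alg R.Alg (R.mon I)) (R.stripDual h I)

theorem kos_tmul {d m n : ℕ} (h : d + m = n) (a : R.Alg) (w : R.dualSub n) :
    R.kos h (a ⊗ₜ w) = ∑ I : Fin d → ι, (a * R.mon I) ⊗ₜ[k] R.stripDual h I w := by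
  simp [kos]

theorem kos_tensorDeg {d m n : ℕ} (h : d + m = n) (l : ℕ) (x : R.Alg ⊗[k] R.dualSub n) :
    R.kos h (R.tensorDeg _ n l x) = R.tensorDeg _ m l (R.kos h x) := by
  have : (R.kos h).restrictScalars k ∘ₗ R.tensorDeg _ n l =
      R.tensorDeg _ m l ∘ₗ (R.kos h).restrictScalars k := by
    refine R.tensor_ext fun v y => ?_
    rw [LinearMap.comp_apply, LinearMap.comp_apply, R.tensorDeg_tmul (R.word_mem_deg v),
      LinearMap.restrictScalars_apply, LinearMap.restrictScalars_apply, kos_tmul, map_sum]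
    have e : ∀ I : Fin d → ι, R.tensorDeg (R.dualSub m) m l
        ((R.word v * R.mon I) ⊗ₜ[k] R.stripDual h I y) = if v.length + n = l then
          (R.word v * R.mon I) ⊗ₜ[k] R.stripDual h I y else 0 := by
      intro I
      rw [R.tensorDeg_tmul (mul_mem_deg _ (R.word_mem_deg v) (R.mon_mem_deg I))]
      simp only [add_assoc, h]
    simp only [e]
    split_ifs
    · rw [kos_tmul]
    · simp
  exact LinearMap.congr_fun this x

/-- An element of degree `e + m` of `A ⊗ A^{!*}_m` comes from a tensor of degree `e + m`. -/
theorem exists_tensor_of_tensorDeg {e m : ℕ} {x : R.Alg ⊗[k] R.dualSub m}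
    (hx : R.tensorDeg _ m (e + m) x = x) :
    ∃ z ∈ (free k p N).deg (e + m), ∃ y : (Fin e → ι) → R.dualSub m,
      (∀ I, (y I : (free k p N).Alg) = strip (List.ofFn I) z) ∧ x = ∑ I, R.mon I ⊗ₜ[k] y I := by
  classical
  have h1 : ∃ y : (Fin e → ι) → R.dualSub m, x = ∑ I, R.mon I ⊗ₜ[k] y I := by
    let S : Submodule k (R.Alg ⊗[k] R.dualSub m) := LinearMap.range
      (∑ I : Fin e → ι, (TensorProduct.mk k R.Alg (R.dualSub m) (R.mon I)) ∘ₗ LinearMap.proj I)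
    have h2 : ∀ x, R.tensorDeg (R.dualSub m) m (e + m) x ∈ S := by
      intro x
      induction x with
      | zero => rw [map_zero]; exact S.zero_mem
      | add x y hx hy => rw [map_add]; exact S.add_mem hx hy
      | tmul a w =>
        rw [tensorDeg_add, TensorProduct.map_tmul, LinearMap.id_apply]
        have h3 : R.deg e ≤ S.comap ((TensorProduct.mk k R.Alg (R.dualSub m)).flip w) := by
          rw [deg, Submodule.span_le]
          rintro _ ⟨I, rfl⟩
          refine ⟨Pi.single I w, ?_⟩
          rw [LinearMap.sum_apply, Finset.sum_eq_single I]
          · simp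
          · intro J _ hJ
            simp [hJ]
          · simp
        exact h3 (R.degProj_mem e a)
    obtain ⟨y, hy⟩ := h2 x
    refine ⟨y, ?_⟩
    rw [← hx, ← hy, LinearMap.sum_apply]
    rfl
  obtain ⟨y, rfl⟩ := h1
  refine ⟨∑ I, (free k p N).mon I * (y I : (free k p N).Alg), ?_, y, fun I => ?_, rfl⟩
  · exact Submodule.sum_mem _ fun I _ => mul_mem_deg _ (mon_mem_deg _ I)
      (R.dualSub_le_deg m (y I).2)
  · rw [map_sum, Finset.sum_eq_single I]
    · rw [mon_eq_word, strip_word_mul rfl, if_pos rfl]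
    · intro J _ hJ
      rw [mon_eq_word, strip_word_mul (by simp), if_neg fun h => hJ (List.ofFn_injective h).symm]
    · simp

/-- The Koszul differential of `∑ x_I ⊗ z_I`, where the `z_I` are the components of a tensor `z`. -/
theorem kos_sum {d e f m n : ℕ} (h : d + m = n) (hf : e + d = f) {z : (free k p N).Alg}
    {y : (Fin e → ι) → R.dualSub n}
    (hy : ∀ I, (y I : (free k p N).Alg) = strip (List.ofFn I) z)
    {y' : (Fin f → ι) → R.dualSub m}
    (hy' : ∀ I, (y' I : (free k p N).Alg) = strip (List.ofFn I) z) :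
    R.kos h (∑ I, R.mon I ⊗ₜ[k] y I) = ∑ I, R.mon I ⊗ₜ[k] y' I := by
  refine Module.Flat.lTensor_preserves_injective_linearMap (M := R.Alg) (R.dualSub m).subtype
    (R.dualSub m).injective_subtype ?_
  have h1 := sum_words hf fun w : List ι => R.word w ⊗ₜ[k] strip w z
  simp only [map_sum, kos_tmul, LinearMap.lTensor_tmul, Submodule.subtype_apply, hy',
    stripDual_coe, hy, strip_strip, mon_eq_word, ← word_append]
  exact h1

theorem kos_kos {d e l m n : ℕ} (h : d + m = n) (h' : e + l = m) (hN : d + e = N)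
    (x : R.Alg ⊗[k] R.dualSub n) : R.kos h' (R.kos h x) = 0 := by
  induction x with
  | zero => simp
  | add x y hx hy => rw [map_add, map_add, hx, hy, add_zero]
  | tmul a w =>
    have e1 : a ⊗ₜ[k] w = a • ((1 : R.Alg) ⊗ₜ[k] w) := by
      rw [TensorProduct.smul_tmul', smul_eq_mul, mul_one]
    rw [e1, map_smul, map_smul, kos_tmul]
    simp only [one_mul]
    have hl : N + l = n := by omega
    rw [R.kos_sum h' hN (z := w) (y := fun I => R.stripDual h I w) (fun I => rfl)
      (y' := fun I => R.stripDual hl I w) (fun I => rfl), sum_mon_tmul_eq_zero, smul_zero]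
    intro v
    convert R.sum_rel ((R.mem_dualSub_iff.1 w.2).2 [] v) using 3
    simp [slice_apply]

/-- The Koszul differential is injective on `1 ⊗ A^{!*}_n` as long as it involves words of length
less than `N`. -/
theorem eq_zero_of_kos_one_tmul {d m n : ℕ} (h : d + m = n) (hd : d < N) {w : R.dualSub n}
    (hw : R.kos h (1 ⊗ₜ w) = 0) : w = 0 := by
  rw [kos_tmul] at hw
  simp only [one_mul] at hw
  have h1 := R.eq_zero_of_sum_mon_tmul hd hw
  refine Subtype.ext ?_
  rw [← sum_mon_mul_strip h (R.dualSub_le_deg n w.2)]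
  refine Finset.sum_eq_zero fun I _ => ?_
  rw [← R.stripDual_coe h, h1 I, ZeroMemClass.coe_zero, mul_zero]

end HomRel
end KoszulComplex

/-! ### Exactness of the Koszul complex -/

section Exactness

variable {k : Type u} [Field k] {ι : Type} [Fintype ι] {p : ι → ZMod 2} {N : ℕ}

namespace HomRel

variable (R : HomRel k p N) (hN : 0 < N)

/-- The term `A ⊗ A^{!*}_m` of the Koszul complex. -/
@[reducible] noncomputable def kosMod (m : ℕ) : DegMod (R.aug hN) :=
  DegMod.free (R.dualSub m) (R.tensorDeg (R.dualSub m) m) (R.tensorDeg_smul m)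

/-- The kernel of a Koszul differential is stable under the degree operators. -/
theorem ker_kos_stable {d m n : ℕ} (h : d + m = n) (l : ℕ) :
    ∀ z ∈ LinearMap.ker (R.kos h), R.tensorDeg (R.dualSub n) n l z ∈ LinearMap.ker (R.kos h) := by
  intro z hz
  rw [LinearMap.mem_ker] at hz ⊢
  rw [kos_tensorDeg, hz, map_zero]

/-- The kernel of the Koszul differential lies in `A_+ ⊗ A^{!*}_n`. -/
theorem ker_kos_le {d m n : ℕ} (h : d + m = n) (hd : d < N) {z : R.Alg ⊗[k] R.dualSub n}
    (hz : R.kos h z = 0) : ∃ y, (R.kosMod hN n).act y = z := by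
  let E : R.Alg ⊗[k] R.dualSub n →ₗ[k] R.dualSub n :=
    (TensorProduct.lid k _).toLinearMap ∘ₗ (R.augHom hN).toLinearMap.rTensor _
  -- the component of degree zero of `z` is `1 ⊗ E z`
  have h1 : ∀ z, (R.kosMod hN n).act (DegMod.contract (R.dualSub n) (R.aug hN) z) =
      z - 1 ⊗ₜ E z := by
    intro z
    induction z with
    | zero => simp
    | add x y hx hy =>
      rw [map_add, map_add, hx, hy, map_add, TensorProduct.tmul_add]
      abel
    | tmul a w =>
      change ((DegMod.toPlus (R.aug hN) a : R.Alg) • ((1 : R.Alg) ⊗ₜ[k] w)) =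
        a ⊗ₜ[k] w - 1 ⊗ₜ E (a ⊗ₜ[k] w)
      rw [DegMod.toPlus_coe, TensorProduct.smul_tmul', smul_eq_mul, mul_one, TensorProduct.sub_tmul]
      congr 1
      rw [TensorProduct.smul_tmul]
      rfl
  have h2 : TensorProduct.map (R.degProj d) LinearMap.id (R.kos h z) = R.kos h (1 ⊗ₜ E z) := by
    have e : TensorProduct.map (R.degProj d) LinearMap.id ∘ₗ (R.kos h).restrictScalars k =
        (R.kos h).restrictScalars k ∘ₗ TensorProduct.mk k _ _ 1 ∘ₗ E := by
      refine R.tensor_ext fun v y => ?_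
      change TensorProduct.map (R.degProj d) LinearMap.id (R.kos h (R.word v ⊗ₜ[k] y)) =
        R.kos h (1 ⊗ₜ (R.augHom hN (R.word v) • y))
      rw [kos_tmul, kos_tmul, map_sum]
      refine Finset.sum_congr rfl fun I _ => ?_
      rw [TensorProduct.map_tmul, LinearMap.id_apply, map_smul, augHom_word,
        R.degProj_of_mem (mul_mem_deg _ (R.word_mem_deg v) (R.mon_mem_deg I)), one_mul]
      by_cases hv : v.length = 0
      · rw [if_pos (by omega), if_pos hv, one_smul, List.length_eq_zero_iff.1 hv, word_nil, one_mul]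
      · rw [if_neg (by omega), if_neg hv, zero_smul, TensorProduct.zero_tmul,
          TensorProduct.tmul_zero]
    exact LinearMap.congr_fun e z
  rw [hz, map_zero] at h2
  refine ⟨_, (h1 z).trans ?_⟩
  rw [R.eq_zero_of_kos_one_tmul h hd h2.symm, TensorProduct.tmul_zero, sub_zero]

theorem vanish_ker_kos {d m n : ℕ} (h : d + m = n) (hd : d < N)
    {Z : Submodule R.Alg (R.Alg ⊗[k] R.dualSub m)}
    (hZ : ∀ l, ∀ z ∈ Z, R.tensorDeg (R.dualSub m) m l z ∈ Z)
    (hmem : ∀ x, R.kos h x ∈ Z) (hsurj : Z ≤ LinearMap.range (R.kos h)) {i l : ℕ}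
    (hv : ((R.kosMod hN m).sub Z hZ).BarVanish (i + 1) l) :
    ((R.kosMod hN n).sub (LinearMap.ker (R.kos h)) (R.ker_kos_stable h)).BarVanish i l := by
  refine DegMod.BarVanish.shift (F := R.kosMod hN n) (LinearMap.ker (R.kos h)).subtype
    ((R.kos h).codRestrict Z hmem) (fun _ _ => rfl) (fun l x => ?_) (Submodule.injective_subtype _)
    ?_ ?_ (DegMod.free_barAcyclic _ _ _) ?_ hv
  · exact Subtype.ext (R.kos_tensorDeg h l x)
  · rintro ⟨z, hz⟩
    obtain ⟨x, rfl⟩ := hsurj hz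
    exact ⟨x, rfl⟩
  · intro x
    constructor
    · intro hx
      exact ⟨⟨x, congrArg Subtype.val hx⟩, rfl⟩
    · rintro ⟨x, rfl⟩
      exact Subtype.ext x.2
  · rintro ⟨z, hz⟩
    exact R.ker_kos_le hN h hd hz

/-- A graded submodule `Z` with `Z_l = (A_+ Z)_l` for `l ≠ s` is generated in degree `s`. -/
theorem le_of_vanish {m s : ℕ} {Z S : Submodule R.Alg (R.Alg ⊗[k] R.dualSub m)}
    (hZ : ∀ l, ∀ z ∈ Z, R.tensorDeg (R.dualSub m) m l z ∈ Z)
    (hv : ∀ l, l ≠ s → ((R.kosMod hN m).sub Z hZ).BarVanish 0 l)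
    (hs : ∀ z ∈ Z, R.tensorDeg _ m s z = z → z ∈ S) : Z ≤ S := by
  have key : ∀ l, ∀ z ∈ Z, R.tensorDeg _ m l z ∈ S := by
    intro l
    induction l using Nat.strong_induction_on with
    | _ l ih =>
      intro z hz
      by_cases hl : l = s
      · subst hl
        exact hs _ (hZ _ z hz) (by rw [tensorDeg_tensorDeg, if_pos rfl])
      · obtain ⟨y, hy⟩ := hv l hl ⟨z, hz⟩
        have h1 : ∀ y, R.tensorDeg _ m l
            (((R.kosMod hN m).sub Z hZ).act y : R.Alg ⊗[k] R.dualSub m) ∈ S := by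
          intro y
          induction y using TensorProduct.induction_on with
          | zero => rw [map_zero, ZeroMemClass.coe_zero, map_zero]; exact S.zero_mem
          | add x y hx hy => rw [map_add, Submodule.coe_add, map_add]; exact S.add_mem hx hy
          | tmul a x =>
            rw [DegMod.act_tmul, Submodule.coe_smul, tensorDeg_smul]
            refine Submodule.sum_mem _ fun c hc => ?_
            rw [mem_antidiagonal] at hc
            by_cases h0 : c.1 = 0
            · have ha : R.augHom hN a = 0 := a.2
              rw [h0, R.degProj_zero hN, ha, zero_smul, zero_smul]
              exact S.zero_mem
            · exact S.smul_mem _ (ih c.2 (by omega) _ x.2)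
        have h2 := h1 y
        rw [hy] at h2
        change R.tensorDeg _ m l (R.tensorDeg _ m l z) ∈ S at h2
        rwa [tensorDeg_tensorDeg, if_pos rfl] at h2
  intro z hz
  obtain ⟨t, ht⟩ := R.exists_sum_tensorDeg m z
  rw [← ht t le_rfl]
  exact Submodule.sum_mem _ fun l _ => key l z hz

/-- The elements of lowest degree in the kernel of a Koszul differential.  The hypothesis `hext` is
needed only for those slices that start after fewer than `e` letters. -/
theorem mem_range_kos {d e l m n : ℕ} (h : d + l = m) (hde : d + e = N) (he : e + m = n)
    (hext : ∀ z ∈ (free k p N).deg n, (∀ v, slice [] v z ∈ R.rel) →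
      (∀ u v : List ι, e ≤ u.length → slice u v z ∈ R.rel) → z ∈ R.dualSub n)
    {x : R.Alg ⊗[k] R.dualSub m} (hx : R.kos h x = 0) (hdeg : R.tensorDeg _ m n x = x) :
    x ∈ LinearMap.range (R.kos he) := by
  subst he
  obtain ⟨z, hz, y, hy, rfl⟩ := R.exists_tensor_of_tensorDeg hdeg
  have h1 : ∀ u v : List ι, e ≤ u.length → slice u v z ∈ R.rel := by
    intro u v hu
    obtain ⟨I, w, rfl⟩ : ∃ (I : Fin e → ι) (w : List ι), u = List.ofFn I ++ w := by
      refine ⟨fun a => u[a], u.drop e, ?_⟩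
      have : List.ofFn (fun a : Fin e => u[a]) = u.take e := by
        refine List.ext_getElem (by simp; omega) fun i h1 h2 => ?_
        simp
      rw [this, List.take_append_drop]
    rw [← slice_strip, ← hy I]
    exact (R.mem_dualSub_iff.1 (y I).2).2 w v
  have hf : e + d = N := by omega
  let y' : (Fin N → ι) → (free k p N).Alg := fun I => strip (List.ofFn I) z
  have hy' : ∀ I, y' I ∈ R.dualSub l := by
    intro I
    refine R.mem_dualSub_iff.2 ⟨strip_mem_deg (by simp; omega) hz, fun u v => ?_⟩
    rw [slice_strip]
    exact h1 _ _ (by simp; omega)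
  have h2 := R.kos_sum h hf hy (y' := fun I => ⟨y' I, hy' I⟩) (fun I => rfl)
  rw [hx] at h2
  have h3 : z ∈ R.dualSub (e + m) := by
    refine hext z hz (fun v => ?_) h1
    have := R.rel_of_sum_mon_tmul h2.symm (Finsupp.lapply v ∘ₗ coords ∘ₗ (R.dualSub l).subtype)
    convert this using 1
    funext I
    simp [slice_apply, y']
  refine ⟨1 ⊗ₜ ⟨z, h3⟩, ?_⟩
  rw [kos_tmul]
  refine Finset.sum_congr rfl fun I _ => ?_
  rw [one_mul]
  congr 1
  exact Subtype.ext (hy I).symm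

/-- Exactness of the Koszul complex at `A ⊗ R` implies that, for tensors of degree less than `2 N`,
if the first and the last slices are relations, then so are those in between. -/
theorem slice_mem_of_exact (h2N : 2 ≤ N) {h : N - 1 + 1 = N} {h' : 1 + N = N + 1}
    (hex : LinearMap.ker (R.kos h) ≤ LinearMap.range (R.kos h')) :
    ∀ c < N, ∀ z ∈ (free k p N).deg (c + N), (∀ v, slice [] v z ∈ R.rel) →
      (∀ u : List ι, u.length = c → slice u [] z ∈ R.rel) → ∀ u v, slice u v z ∈ R.rel := by
  intro c
  induction c with
  | zero =>
    intro _ z hz h1 h2 u v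
    by_cases hu : u.length = 0
    · rw [List.length_eq_zero_iff.1 hu]
      exact h1 v
    · rw [slice_of_mem_deg (by omega) hz]
      exact R.rel.zero_mem
  | succ c ih =>
    intro hc z hz h1 h2
    have h3 : ∀ I : Fin (c + 1) → ι, strip (List.ofFn I) z ∈ R.dualSub N := by
      intro I
      have hd : strip (List.ofFn I) z ∈ (free k p N).deg N := strip_mem_deg (by simp) hz
      refine R.mem_dualSub_iff.2 ⟨hd, fun u v => ?_⟩
      by_cases huv : u.length + N + v.length = N
      · have hu : u = [] := List.length_eq_zero_iff.1 (by omega)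
        have hv : v = [] := List.length_eq_zero_iff.1 (by omega)
        subst hu hv
        rw [slice_strip, List.append_nil]
        exact h2 _ (by simp)
      · rw [slice_of_mem_deg huv hd]
        exact R.rel.zero_mem
    have hone : ∀ w : List ι, w.length = c + N → strip w z ∈ R.dualSub 1 := by
      intro w hw
      have hd : strip w z ∈ (free k p N).deg 1 := strip_mem_deg (by omega) hz
      rwa [R.dualSub_eq_deg (by omega)]
    let u₀ : R.Alg ⊗[k] R.dualSub N := ∑ I : Fin (c + 1) → ι, R.mon I ⊗ₜ[k] ⟨_, h3 I⟩
    have h4 : R.kos h u₀ = 0 := by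
      rw [R.kos_sum h (f := N + c) (by omega) (z := z) (fun I => rfl)
        (y' := fun I => ⟨strip (List.ofFn I) z, hone _ (by simp [add_comm])⟩) (fun I => rfl)]
      refine R.sum_mon_tmul_eq_zero fun v => ?_
      have e := sum_words (rfl : N + c = N + c) fun w : List ι => coords (strip w z) v • R.word w
      simp only [← mon_eq_word] at e
      rw [← e, Finset.sum_comm]
      refine Finset.sum_eq_zero fun P _ => ?_
      have e1 := R.sum_rel (h1 (List.ofFn P ++ v))
      have e2 := congrArg (· * R.mon P) e1
      simp only [Finset.sum_mul, zero_mul, smul_mul_assoc] at e2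
      rw [← e2]
      refine Finset.sum_congr rfl fun I _ => ?_
      rw [word_append, ← mon_eq_word, ← mon_eq_word, coords_strip, slice_apply, List.nil_append,
        List.append_assoc]
    obtain ⟨y, hy⟩ := hex h4
    have h5 : R.kos h' (R.tensorDeg _ (N + 1) (c + (N + 1)) y) = u₀ := by
      rw [kos_tensorDeg, hy, map_sum]
      refine Finset.sum_congr rfl fun I _ => ?_
      rw [R.tensorDeg_tmul (R.mon_mem_deg I), if_pos (by omega)]
    obtain ⟨z', hz', y', hy', e⟩ := R.exists_tensor_of_tensorDeg
      (x := R.tensorDeg _ (N + 1) (c + (N + 1)) y) (by rw [tensorDeg_tensorDeg, if_pos rfl])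
    have h6 : ∀ I : Fin (c + 1) → ι, strip (List.ofFn I) z' ∈ R.dualSub N := by
      intro I
      rw [List.ofFn_succ', List.concat_eq_append, ← strip_strip, ← hy']
      exact R.strip_mem_dualSub (by simp [add_comm]) (y' _).2
    rw [e, R.kos_sum h' rfl hy' (y' := fun I => ⟨_, h6 I⟩) (fun I => rfl), ← sub_eq_zero,
      ← Finset.sum_sub_distrib] at h5
    simp only [← TensorProduct.tmul_sub] at h5
    have h7 := R.eq_zero_of_sum_mon_tmul hc h5
    have h8 : ∀ I : Fin (c + 1) → ι, strip (List.ofFn I) z' = strip (List.ofFn I) z :=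
      fun I => congrArg Subtype.val (sub_eq_zero.1 (h7 I))
    have h9 : z' = z := by
      rw [← sum_mon_mul_strip rfl hz, ← sum_mon_mul_strip (d := c + 1) (m := N) (by omega) hz']
      simp only [h8]
    subst h9
    have h10 : ∀ u v : List ι, u.length = c → slice u v z' ∈ R.rel := by
      intro u v hu
      have e3 : u = List.ofFn fun a : Fin c => u[a] := by
        refine List.ext_getElem (by simp [hu]) fun i h1 h2 => ?_
        simp
      have := (R.mem_dualSub_iff.1 (y' fun a : Fin c => u[a]).2).2 [] v
      rwa [hy', ← e3, slice_strip, List.append_nil] at this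
    -- the slices that do not end with the last letter are treated by removing that letter
    intro u v
    rcases List.eq_nil_or_concat v with rfl | ⟨v, i, rfl⟩
    · by_cases hu : u.length = c + 1
      · exact h2 u hu
      · rw [slice_of_mem_deg (by simp; omega) hz]
        exact R.rel.zero_mem
    · rw [List.concat_eq_append, ← slice_rstrip]
      refine ih (by omega) _ ?_ ?_ ?_ u v
      · rw [mem_deg_iff] at hz ⊢
        intro w hw
        rw [coords_rstrip]
        exact hz _ (by simp; omega)
      · intro v
        rw [slice_rstrip]
        exact h1 _
      · intro u hu
        rw [slice_rstrip]
        exact h10 u _ hu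

end HomRel
end Exactness

/-! ### Exactness of the Koszul complex from the vanishing of bar homology -/

section Induction

/-- The difference `ν_N(i + 1) - ν_N(i)`. -/
def gap (N i : ℕ) : ℕ := if Even i then 1 else N - 1

theorem nu_two_mul (N a : ℕ) : nu N (2 * a) = a * N := by
  rw [nu, if_pos (even_two_mul a)]
  congr 1
  omega

theorem nu_two_mul_add_one (N a : ℕ) : nu N (2 * a + 1) = a * N + 1 := by
  rw [nu, if_neg (Nat.not_even_iff_odd.2 ⟨a, rfl⟩)]
  congr 2
  omega

theorem gap_add_nu {N : ℕ} (hN : 0 < N) (i : ℕ) : gap N i + nu N i = nu N (i + 1) := by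
  rcases Nat.even_or_odd' i with ⟨a, rfl | rfl⟩
  · rw [nu_two_mul, nu_two_mul_add_one, gap, if_pos (even_two_mul a), add_comm]
  · rw [nu_two_mul_add_one, show 2 * a + 1 + 1 = 2 * (a + 1) by ring, nu_two_mul, gap,
      if_neg (Nat.not_even_iff_odd.2 ⟨a, rfl⟩), add_mul]
    omega

theorem gap_add_gap {N : ℕ} (hN : 0 < N) (i : ℕ) : gap N i + gap N (i + 1) = N := by
  simp only [gap, Nat.even_add_one]
  split_ifs <;> omega

theorem gap_lt {N : ℕ} (h2N : 2 ≤ N) (i : ℕ) : gap N i < N := by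
  rw [gap]
  split_ifs <;> omega

variable {k : Type u} [Field k] {ι : Type} [Fintype ι] {p : ι → ZMod 2} {N : ℕ}

namespace HomRel

variable (R : HomRel k p N) (hN : 0 < N)

/-- The differential `A ⊗ A^{!*}_{ν(i + 1)} → A ⊗ A^{!*}_{ν(i)}` of the Koszul complex. -/
noncomputable def kosD (i : ℕ) :
    R.Alg ⊗[k] R.dualSub (nu N (i + 1)) →ₗ[R.Alg] R.Alg ⊗[k] R.dualSub (nu N i) :=
  R.kos (gap_add_nu hN i)

/-- The kernel of the `i`-th differential of the augmented Koszul complex; for `i = 0` it is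
`A_+ ⊗ A^{!*}_0`. -/
noncomputable def kosKer : (i : ℕ) → Submodule R.Alg (R.Alg ⊗[k] R.dualSub (nu N i))
  | 0 => LinearMap.range (R.kosMod hN (nu N 0)).act
  | i + 1 => LinearMap.ker (R.kosD hN i)

theorem kosKer_stable : (i l : ℕ) → ∀ z ∈ R.kosKer hN i,
    R.tensorDeg (R.dualSub (nu N i)) (nu N i) l z ∈ R.kosKer hN i
  | 0, l => by
    rintro _ ⟨y, rfl⟩
    exact ⟨_, (R.kosMod hN (nu N 0)).act_π l y⟩
  | i + 1, l => R.ker_kos_stable _ l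

theorem kosD_mem_kosKer (i : ℕ) (x : R.Alg ⊗[k] R.dualSub (nu N (i + 1))) :
    R.kosD hN i x ∈ R.kosKer hN i := by
  cases i with
  | zero =>
    have h : ∀ (n l d : ℕ) (h : d + l = n) (hd : d ≠ 0) (x : R.Alg ⊗[k] R.dualSub n),
        R.kos h x ∈ LinearMap.range (R.kosMod hN l).act := by
      intro n l d h hd x
      induction x with
      | zero => rw [map_zero]; exact Submodule.zero_mem _
      | add x y hx hy => rw [map_add]; exact Submodule.add_mem _ hx hy
      | tmul a w =>
        rw [kos_tmul]
        refine Submodule.sum_mem _ fun I _ => ?_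
        have hI : R.augHom hN (a * R.mon I) = 0 := by
          rw [map_mul, mon_eq_word, augHom_word, if_neg (by simpa using hd), mul_zero]
        refine ⟨(⟨a * R.mon I, hI⟩ : (R.aug hN).plus) ⊗ₜ (1 ⊗ₜ R.stripDual h I w), ?_⟩
        rw [DegMod.act_tmul]
        change ((a * R.mon I) • ((1 : R.Alg) ⊗ₜ[k] R.stripDual h I w)) = _
        rw [TensorProduct.smul_tmul', smul_eq_mul, mul_one]
    exact h _ _ _ _ (by simp [gap]) x
  | succ i =>
    exact LinearMap.mem_ker.2 (R.kos_kos _ _ (by rw [add_comm]; exact gap_add_gap hN i) x)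

/-- The bar homology of the kernel of the `i`-th differential of the augmented Koszul complex is
concentrated in the degrees prescribed by the jump function: in homological degree `j` it lives in
internal degree `ν_N(i + 1 + j)`. -/
def KerVanish (i : ℕ) : Prop :=
  ∀ j n, n ≠ nu N (i + 1 + j) →
    ((R.kosMod hN (nu N i)).sub (R.kosKer hN i) (R.kosKer_stable hN i)).BarVanish j n

theorem KerVanish.succ (h2N : 2 ≤ N) {i : ℕ} (h : R.KerVanish hN i)
    (hE : R.kosKer hN i ≤ LinearMap.range (R.kosD hN i)) : R.KerVanish hN (i + 1) := by
  intro j n hn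
  exact R.vanish_ker_kos hN (gap_add_nu hN i) (gap_lt h2N i) (R.kosKer_stable hN i)
    (R.kosD_mem_kosKer hN i) hE (h (j + 1) n (by convert hn using 2; ring))

theorem KerVanish.exact_zero (h2N : 2 ≤ N) (h : R.KerVanish hN 0) :
    R.kosKer hN 0 ≤ LinearMap.range (R.kosD hN 0) := by
  refine R.le_of_vanish hN (s := nu N 1) (R.kosKer_stable hN 0) (fun l hl => h 0 l hl) ?_
  have key : ∀ {d l n : ℕ} (h : d + l = n), n < N → ∀ z : R.Alg ⊗[k] R.dualSub l,
      R.tensorDeg _ l n z = z → z ∈ LinearMap.range (R.kos h) := by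
    rintro d l n rfl hn z hz
    obtain ⟨z, hz, y, hy, rfl⟩ := R.exists_tensor_of_tensorDeg hz
    refine ⟨1 ⊗ₜ ⟨z, by rwa [R.dualSub_eq_deg hn]⟩, ?_⟩
    rw [kos_tmul]
    refine Finset.sum_congr rfl fun I _ => ?_
    rw [one_mul]
    congr 1
    exact Subtype.ext (hy I).symm
  intro z _ hz
  exact key _ (by simp [nu]; omega) z hz

theorem KerVanish.exact_succ {i : ℕ} (h : R.KerVanish hN (i + 1))
    (hext : ∀ z ∈ (free k p N).deg (nu N (i + 2)), (∀ v, slice [] v z ∈ R.rel) →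
      (∀ u v : List ι, gap N (i + 1) ≤ u.length → slice u v z ∈ R.rel) →
      z ∈ R.dualSub (nu N (i + 2))) :
    R.kosKer hN (i + 1) ≤ LinearMap.range (R.kosD hN (i + 1)) := by
  refine R.le_of_vanish hN (s := nu N (i + 2)) (R.kosKer_stable hN (i + 1))
    (fun l hl => h 0 l hl) ?_
  intro z hz hz'
  exact R.mem_range_kos (gap_add_nu hN i) (gap_add_gap hN i) (gap_add_nu hN (i + 1)) hext hz hz'

/-- For even `i` the two conditions on the slices cover all slices, as `gap N i = 1`. -/
theorem mem_dualSub_nu_of_even {i : ℕ} (hi : Even i) (z : (free k p N).Alg)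
    (hz : z ∈ (free k p N).deg (nu N (i + 1))) (h1 : ∀ v, slice [] v z ∈ R.rel)
    (h2 : ∀ u v : List ι, gap N i ≤ u.length → slice u v z ∈ R.rel) :
    z ∈ R.dualSub (nu N (i + 1)) := by
  refine R.mem_dualSub_iff.2 ⟨hz, fun u v => ?_⟩
  rw [gap, if_pos hi] at h2
  rcases u with _ | ⟨i, u⟩
  · exact h1 v
  · exact h2 _ v (by simp)

theorem mem_dualSub_nu_two (z : (free k p N).Alg)
    (hz : z ∈ (free k p N).deg (nu N 2)) (h1 : ∀ v, slice [] v z ∈ R.rel) :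
    z ∈ R.dualSub (nu N 2) := by
  refine R.mem_dualSub_iff.2 ⟨hz, fun u v => ?_⟩
  rcases u with _ | ⟨i, u⟩
  · exact h1 v
  · rw [slice_of_mem_deg (n := nu N 2) (by simp [nu]; omega) hz]
    exact R.rel.zero_mem

/-- For odd `i` the conditions on the slices that start with the first letter or after at least
`N - 1` letters do not mention the slices in between.  Those are relations by exactness of the
Koszul complex at `A ⊗ R`. -/
theorem mem_dualSub_nu_of_odd (h2N : 2 ≤ N)
    (hE : R.kosKer hN 2 ≤ LinearMap.range (R.kosD hN 2)) {i : ℕ} (hi : Odd i) (z : (free k p N).Alg)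
    (hz : z ∈ (free k p N).deg (nu N (i + 1))) (h1 : ∀ v, slice [] v z ∈ R.rel)
    (h2 : ∀ u v : List ι, gap N i ≤ u.length → slice u v z ∈ R.rel) :
    z ∈ R.dualSub (nu N (i + 1)) := by
  obtain ⟨a, rfl⟩ := hi
  rcases a with _ | a
  · exact R.mem_dualSub_nu_two z hz h1
  have hEC : ∀ c < N, ∀ z ∈ (free k p N).deg (c + N), (∀ v, slice [] v z ∈ R.rel) →
      (∀ u : List ι, u.length = c → slice u [] z ∈ R.rel) → ∀ u v, slice u v z ∈ R.rel := by
    have aux : ∀ {d e n₁ n₂ n₃ : ℕ} (h : d + n₁ = n₂) (h' : e + n₂ = n₃), d = N - 1 → e = 1 →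
        n₁ = 1 → n₂ = N → LinearMap.ker (R.kos h) ≤ LinearMap.range (R.kos h') →
        ∀ c < N, ∀ z ∈ (free k p N).deg (c + N), (∀ v, slice [] v z ∈ R.rel) →
        (∀ u : List ι, u.length = c → slice u [] z ∈ R.rel) → ∀ u v, slice u v z ∈ R.rel := by
      rintro d e n₁ n₂ n₃ h h' rfl rfl rfl rfl hE
      obtain rfl : n₃ = n₂ + 1 := by omega
      exact R.slice_mem_of_exact h2N hE
    exact aux _ _ rfl rfl (by simp [nu]) (by simp [nu]) hE
  have hn : nu N (2 * (a + 1) + 1 + 1) = (a + 2) * N := by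
    exact nu_two_mul N (a + 2)
  have hg : gap N (2 * (a + 1) + 1) = N - 1 := by
    rw [gap, if_neg (Nat.not_even_iff_odd.2 ⟨_, rfl⟩)]
  rw [hg] at h2
  refine R.mem_dualSub_iff.2 ⟨hz, fun u v => ?_⟩
  rw [hn] at hz
  by_cases hu : N - 1 ≤ u.length
  · exact h2 u v hu
  by_cases huv : u.length + N + v.length = (a + 2) * N
  swap
  · rw [slice_of_mem_deg huv hz]
    exact R.rel.zero_mem
  have haN : (a + 2) * N = a * N + 2 * N := by ring
  -- cut off the letters after the first `2 N - 1`
  have hv : v = v.take (N - 1 - u.length) ++ v.drop (N - 1 - u.length) :=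
    (List.take_append_drop _ _).symm
  rw [hv, ← slice_rstrip]
  refine hEC (N - 1) (by omega) _ ?_ (fun v => ?_) (fun u hu => ?_) _ _
  · rw [mem_deg_iff] at hz ⊢
    intro w hw
    rw [coords_rstrip]
    refine hz _ ?_
    simp only [List.length_append, List.length_drop]
    omega
  · rw [slice_rstrip]
    exact h1 _
  · rw [slice_rstrip]
    exact h2 _ _ hu.ge

/-- If the bar homology of `A_+ ⊗ A^{!*}_0` is concentrated in the degrees prescribed by the jump
function, then the Koszul complex is exact. -/
theorem kosKer_le_range (h2N : 2 ≤ N) (h : R.KerVanish hN 0) (i : ℕ) :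
    R.kosKer hN i ≤ LinearMap.range (R.kosD hN i) := by
  have E0 := h.exact_zero R hN h2N
  have Q1 := h.succ R hN h2N E0
  have E1 := Q1.exact_succ R hN fun z hz h1 _ => R.mem_dualSub_nu_two z hz h1
  have Q2 := Q1.succ R hN h2N E1
  have E2 := Q2.exact_succ R hN (R.mem_dualSub_nu_of_even even_two)
  have key : ∀ i, R.KerVanish hN i ∧ R.kosKer hN i ≤ LinearMap.range (R.kosD hN i) := by
    intro i
    induction i with
    | zero => exact ⟨h, E0⟩
    | succ i ih =>
      have Q := ih.1.succ R hN h2N ih.2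
      refine ⟨Q, Q.exact_succ R hN ?_⟩
      rcases Nat.even_or_odd (i + 1) with hi | hi
      · exact R.mem_dualSub_nu_of_even hi
      · exact R.mem_dualSub_nu_of_odd hN h2N E2 hi
  exact (key i).2

end HomRel
end Induction

/-! ### Comparison with the bar complex of tensor powers -/

section TensorPowers

variable {k : Type u} [Field k] {A : Type u} [Ring A] [Algebra k A]

/-- The isomorphism `A ⊗ A^{⊗ n} → A^{⊗ (n + 1)}`, as a linear map. -/
noncomputable def tensorCons (k A : Type u) [Field k] [Ring A] [Algebra k A] (n : ℕ) :
    A ⊗[k] (⨂[k]^n A) →ₗ[k] ⨂[k]^(n + 1) A :=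
  TensorProduct.lift (PiTensorProduct.lift.toLinearMap ∘ₗ
    (PiTensorProduct.tprod k : MultilinearMap k (fun _ : Fin (n + 1) => A) _).curryLeft)

theorem tensorCons_tprod {n : ℕ} (a : A) (f : Fin n → A) :
    tensorCons k A n (a ⊗ₜ PiTensorProduct.tprod k f) =
      PiTensorProduct.tprod k (Fin.cons a f : Fin (n + 1) → A) := by
  simp only [tensorCons, TensorProduct.lift.tmul, LinearMap.comp_apply, LinearEquiv.coe_coe,
    PiTensorProduct.lift.tprod]
  rfl

theorem tensorCons_injective (n : ℕ) : Function.Injective (tensorCons k A n) := by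
  let g : A →ₗ[k] MultilinearMap k (fun _ : Fin n => A) (A ⊗[k] (⨂[k]^n A)) :=
    { toFun := fun a => (TensorProduct.mk k A _ a).compMultilinearMap (PiTensorProduct.tprod k)
      map_add' := fun a b => by ext; simp
      map_smul' := fun c a => by ext; simp [TensorProduct.smul_tmul'] }
  refine Function.LeftInverse.injective (g := PiTensorProduct.lift g.uncurryLeft) fun x => ?_
  have h1 : ∀ a y, PiTensorProduct.lift g.uncurryLeft (tensorCons k A n (a ⊗ₜ y)) = a ⊗ₜ y := by
    intro a y
    induction y using PiTensorProduct.induction_on with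
    | smul_tprod r f =>
      rw [TensorProduct.tmul_smul, map_smul, map_smul, tensorCons_tprod, PiTensorProduct.lift.tprod]
      rfl
    | add x y hx hy => simp only [TensorProduct.tmul_add, map_add, hx, hy]
  induction x with
  | zero => simp only [map_zero]
  | add x y hx hy => simp only [map_add, hx, hy]
  | tmul a y => exact h1 a y

theorem mulAt_zero_cons {n : ℕ} (a b : A) (y : ⨂[k]^n A) :
    mulAt k A (0 : Fin (n + 1)) (tensorCons k A (n + 1) (a ⊗ₜ tensorCons k A n (b ⊗ₜ y))) =
      tensorCons k A n ((a * b) ⊗ₜ y) := by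
  induction y using PiTensorProduct.induction_on with
  | smul_tprod r f =>
    simp only [TensorProduct.tmul_smul, map_smul, tensorCons_tprod, mulAt_tprod]
    congr 2
    funext l
    refine Fin.cases ?_ (fun l => ?_) l
    · simp [Fin.contractNth]
    · simp [Fin.contractNth]
  | add x y hx hy => simp only [TensorProduct.tmul_add, map_add, hx, hy]

theorem mulAt_succ_cons {n : ℕ} (j : Fin n) (a : A) (y : ⨂[k]^(n + 1) A) :
    mulAt k A j.succ (tensorCons k A (n + 1) (a ⊗ₜ y)) = tensorCons k A n (a ⊗ₜ mulAt k A j y) := by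
  induction y using PiTensorProduct.induction_on with
  | smul_tprod r f =>
    simp only [TensorProduct.tmul_smul, map_smul, tensorCons_tprod, mulAt_tprod]
    congr 2
    funext l
    refine Fin.cases ?_ (fun l => ?_) l
    · simp [Fin.contractNth]
    · simp [Fin.contractNth]
  | add x y hx hy => simp only [TensorProduct.tmul_add, map_add, hx, hy]

/-- The recursive form of the bar differential. -/
theorem barD_cons {n : ℕ} (a : A) (y : ⨂[k]^(n + 1) A) :
    barD k A (n + 1) (tensorCons k A (n + 1) (a ⊗ₜ y)) =
      mulAt k A (0 : Fin (n + 1)) (tensorCons k A (n + 1) (a ⊗ₜ y)) -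
        tensorCons k A n (a ⊗ₜ barD k A n y) := by
  rw [barD, Fin.sum_univ_succ, LinearMap.add_apply, sub_eq_add_neg, Fin.val_zero, pow_zero,
    one_smul,
    barD]
  congr 1
  simp only [LinearMap.sum_apply, LinearMap.smul_apply, mulAt_succ_cons, TensorProduct.tmul_sum,
    TensorProduct.tmul_smul, map_sum, map_smul, Fin.val_succ, pow_succ, mul_neg, mul_one, neg_smul,
    Finset.sum_neg_distrib]

namespace AugAlg

variable (G : AugAlg k A)

/-- The augmentation ideal as a coefficient module. -/
@[reducible] noncomputable def plusMod : DegMod G where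
  X := G.plus
  π := G.πPlus
  π_smul := G.πPlus_smul

variable {G} in
/-- The map `A_+ ⊗ M → A^{⊗ (n + 1)}` induced by a map `M → A^{⊗ n}`. -/
noncomputable def consMap {M : DegMod G} {n : ℕ} (f : M.X →ₗ[k] ⨂[k]^n A) :
    M.ext.X →ₗ[k] ⨂[k]^(n + 1) A :=
  tensorCons k A n ∘ₗ TensorProduct.map (G.plus.subtype.restrictScalars k) f

variable {G} in
theorem consMap_tmul {M : DegMod G} {n : ℕ} (f : M.X →ₗ[k] ⨂[k]^n A) (a : G.plus) (x : M.X) :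
    consMap f (a ⊗ₜ x) = tensorCons k A n ((a : A) ⊗ₜ f x) := rfl

variable {G} in
theorem consMap_smul {M : DegMod G} {n : ℕ} (f : M.X →ₗ[k] ⨂[k]^n A) (a : A) (x : M.ext.X) :
    consMap f (a • x) = mulAt k A 0 (tensorCons k A (n + 1) (a ⊗ₜ consMap f x)) := by
  induction x using TensorProduct.induction_on with
  | zero => simp only [smul_zero, map_zero, TensorProduct.tmul_zero]
  | add x y hx hy => simp only [smul_add, map_add, hx, hy, TensorProduct.tmul_add]
  | tmul b x =>
    rw [TensorProduct.smul_tmul', consMap_tmul, consMap_tmul, mulAt_zero_cons]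
    rfl

variable {G} in
theorem consMap_act {M : DegMod G} (f : M.X →ₗ[k] ⨂[k]^1 A)
    (hf : ∀ a x, f (a • x) = mulAt k A 0 (tensorCons k A 1 (a ⊗ₜ f x))) (x : M.ext.X) :
    f (M.act x) = barD k A 1 (consMap f x) := by
  induction x using TensorProduct.induction_on with
  | zero => simp only [map_zero]
  | add x y hx hy => simp only [map_add, hx, hy]
  | tmul a x =>
    have h0 : barD k A 0 = 0 := by simp [barD]
    rw [consMap_tmul, barD_cons, h0, LinearMap.zero_apply, TensorProduct.tmul_zero, map_zero,
      sub_zero, ← hf, DegMod.act_tmul]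

variable {G} in
theorem consMap_stepDiff {M : DegMod G} {n : ℕ} (d : M.ext.X →ₗ[A] M.X)
    (f : M.X →ₗ[k] ⨂[k]^(n + 1) A) (h : ∀ x, f (d x) = barD k A (n + 1) (consMap f x))
    (x : M.ext.ext.X) :
    consMap f (DegMod.stepDiff d x) = barD k A (n + 2) (consMap (consMap f) x) := by
  induction x using TensorProduct.induction_on with
  | zero => simp only [map_zero]
  | add x y hx hy => simp only [map_add, hx, hy]
  | tmul a x =>
    rw [consMap_tmul, barD_cons, ← consMap_smul, ← h, DegMod.stepDiff_apply, map_sub,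
      DegMod.act_tmul, DegMod.extMap_tmul, consMap_tmul]
    rfl

/-- The inclusion of `A_+` into the first tensor power. -/
noncomputable def plusIncl : G.plus →ₗ[k] ⨂[k]^1 A :=
  tensorCons k A 0 ∘ₗ (TensorProduct.mk k A _).flip (PiTensorProduct.tprod k ![]) ∘ₗ
    G.plus.subtype.restrictScalars k

theorem plusIncl_apply (a : G.plus) :
    G.plusIncl a = tensorCons k A 0 ((a : A) ⊗ₜ PiTensorProduct.tprod k ![]) := rfl

/-- The inclusion of `A_+^{⊗ (j + 1)}` into `A^{⊗ (j + 1)}`. -/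
noncomputable def barIncl : (j : ℕ) → (G.plusMod.bar j).X →ₗ[k] ⨂[k]^(j + 1) A
  | 0 => G.plusIncl
  | j + 1 => consMap (barIncl j)

theorem barIncl_injective (j : ℕ) : Function.Injective (G.barIncl j) := by
  induction j with
  | zero =>
    have h : Function.Injective (((TensorProduct.mk k A (⨂[k]^0 A)).flip
        (PiTensorProduct.tprod k (![] : Fin 0 → A)))) := by
      refine Function.Injective.of_comp (f := (TensorProduct.rid k A).toLinearMap ∘ₗ
        (PiTensorProduct.isEmptyEquiv (Fin 0)).toLinearMap.lTensor A) ?_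
      intro a b h
      simpa using h
    exact (tensorCons_injective 0).comp (h.comp Subtype.val_injective)
  | succ j ih =>
    exact (tensorCons_injective (j + 1)).comp
      (TensorProduct.map_injective_of_flat_flat _ _ Subtype.val_injective ih)

theorem barIncl_barDiff (j : ℕ) (x : (G.plusMod.bar j).ext.X) :
    G.barIncl j (G.plusMod.barDiff j x) = barD k A (j + 1) (consMap (G.barIncl j) x) := by
  induction j with
  | zero =>
    refine consMap_act (M := G.plusMod) G.plusIncl (fun a x => ?_) x
    rw [plusIncl_apply, plusIncl_apply, mulAt_zero_cons]
    rfl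
  | succ j ih => exact consMap_stepDiff _ _ ih x

end AugAlg
end TensorPowers

section TorComparison

variable {k : Type u} [Field k] {ι : Type} [Fintype ι] {p : ι → ZMod 2} {N : ℕ}

namespace HomRel

variable (R : HomRel k p N) (hN : 0 < N)

theorem tensorCons_mem_barSpace {j m n : ℕ} {a : R.Alg} (hm : 0 < m) (ha : a ∈ R.deg m)
    {x : ⨂[k]^j R.Alg} (hx : x ∈ R.barSpace j n) :
    tensorCons k R.Alg j (a ⊗ₜ x) ∈ R.barSpace (j + 1) (m + n) := by
  rw [barSpace] at hx
  induction hx using Submodule.span_induction with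
  | mem x hx =>
    obtain ⟨f, b, h1, rfl, h2, rfl⟩ := hx
    refine Submodule.subset_span ⟨Fin.cons m f, Fin.cons a b, ?_, ?_, ?_, tensorCons_tprod a b⟩
    · intro l
      refine Fin.cases ?_ (fun l => ?_) l
      · exact hm
      · exact h1 l
    · simp [Fin.sum_univ_succ]
    · intro l
      refine Fin.cases ?_ (fun l => ?_) l
      · exact ha
      · exact h2 l
  | zero => rw [TensorProduct.tmul_zero, map_zero]; exact Submodule.zero_mem _
  | add x y _ _ hx hy => rw [TensorProduct.tmul_add, map_add]; exact Submodule.add_mem _ hx hy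
  | smul c x _ hx => rw [TensorProduct.tmul_smul, map_smul]; exact Submodule.smul_mem _ c hx

theorem πPlus_zero (a : (R.aug hN).plus) : (R.aug hN).πPlus 0 a = 0 := by
  refine Subtype.ext ?_
  change R.degProj 0 a = 0
  have ha : R.augHom hN a = 0 := a.2
  rw [R.degProj_zero hN, ha, zero_smul]

theorem consMap_π_mem {M : DegMod (R.aug hN)} {j : ℕ} {f : M.X →ₗ[k] ⨂[k]^j R.Alg}
    (hf : ∀ n x, f (M.π n x) ∈ R.barSpace j n) (n : ℕ) (x : M.ext.X) :
    AugAlg.consMap f (M.ext.π n x) ∈ R.barSpace (j + 1) n := by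
  induction x using TensorProduct.induction_on with
  | zero => rw [map_zero, map_zero]; exact Submodule.zero_mem _
  | add x y hx hy => rw [map_add, map_add]; exact Submodule.add_mem _ hx hy
  | tmul a x =>
    rw [DegMod.ext_π_tmul, map_sum]
    refine Submodule.sum_mem _ fun c hc => ?_
    rw [mem_antidiagonal] at hc
    rw [← hc]
    rcases Nat.eq_zero_or_pos c.1 with h | h
    · rw [h, πPlus_zero, TensorProduct.zero_tmul, map_zero]
      exact Submodule.zero_mem _
    · rw [AugAlg.consMap_tmul]
      exact R.tensorCons_mem_barSpace h (R.degProj_mem c.1 a.1) (hf c.2 x)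

theorem barIncl_π_mem (j n : ℕ) (x : ((R.aug hN).plusMod.bar j).X) :
    (R.aug hN).barIncl j (((R.aug hN).plusMod.bar j).π n x) ∈ R.barSpace (j + 1) n := by
  induction j generalizing n with
  | zero =>
    rcases Nat.eq_zero_or_pos n with rfl | hn
    · have h : ∀ a, (R.aug hN).plusIncl ((R.aug hN).πPlus 0 a) ∈ R.barSpace 1 0 := by
        intro a
        rw [πPlus_zero, map_zero]
        exact Submodule.zero_mem _
      exact h x
    · exact R.tensorCons_mem_barSpace (n := 0) hn (R.degProj_mem n x.1)
        (Submodule.subset_span ⟨![], ![], by simp, by simp, by simp, rfl⟩)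
  | succ j ih => exact R.consMap_π_mem hN (fun n x => ih n x) n x

theorem barSpace_le_range (j n : ℕ) :
    R.barSpace (j + 1) n ≤ LinearMap.range ((R.aug hN).barIncl j) := by
  rw [barSpace, Submodule.span_le]
  rintro _ ⟨m, a, hm, -, ha, rfl⟩
  have hplus : ∀ l, R.augHom hN (a l) = 0 := by
    intro l
    have h1 := R.augHom_degProj hN (m l) (a l)
    rw [R.degProj_of_mem (ha l), if_pos rfl] at h1
    rw [h1, if_neg (hm l).ne']
  clear ha hm
  induction j with
  | zero =>
    refine ⟨(⟨a 0, hplus 0⟩ : (R.aug hN).plus), (tensorCons_tprod (a 0) ![]).trans ?_⟩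
    congr 1
    funext l
    refine Fin.cases rfl (fun l => l.elim0) l
  | succ j ih =>
    obtain ⟨y, hy⟩ := ih (Fin.tail m) (Fin.tail a) fun l => hplus l.succ
    refine ⟨(⟨a 0, hplus 0⟩ : (R.aug hN).plus) ⊗ₜ y, ?_⟩
    refine (congrArg (fun z => tensorCons k R.Alg (j + 1) (a 0 ⊗ₜ z)) hy).trans ?_
    rw [tensorCons_tprod, Fin.cons_self_tail]

/-- Vanishing of `Tor^A_{j + 1}(k, k)` in degree `n`, in terms of the bar complex with
coefficients in the augmentation ideal. -/
theorem barVanish_of_tor {j n : ℕ} (h : Subsingleton (R.Tor (j + 1) n)) :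
    (R.aug hN).plusMod.BarVanish j n := by
  have h1 : R.barCycles (j + 1) n ≤ R.barBoundaries (j + 1) n := by
    have h2 := Submodule.Quotient.subsingleton_iff.1 h
    intro x hx
    have h3 : (⟨x, hx⟩ : R.barCycles (j + 1) n) ∈
        (R.barBoundaries (j + 1) n).submoduleOf (R.barCycles (j + 1) n) := by
      rw [h2]; trivial
    exact h3
  have key : ∀ x, barD k R.Alg j ((R.aug hN).barIncl j
        (((R.aug hN).plusMod.bar j).π n x)) = 0 →
      ∃ y, (R.aug hN).plusMod.barDiff j y = ((R.aug hN).plusMod.bar j).π n x := by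
    intro x hx
    have h2 : (R.aug hN).barIncl j (((R.aug hN).plusMod.bar j).π n x) ∈ R.barCycles (j + 1) n := by
      refine ⟨R.barIncl_π_mem hN j n x, ?_⟩
      rw [SetLike.mem_coe, LinearMap.mem_ker]
      exact hx
    obtain ⟨y', hy', e⟩ := h1 h2
    obtain ⟨y, rfl⟩ := R.barSpace_le_range hN (j + 1) n hy'
    refine ⟨y, (R.aug hN).barIncl_injective j ?_⟩
    exact ((R.aug hN).barIncl_barDiff j y).trans e
  cases j with
  | zero => exact fun x => key x (by simp [barD])
  | succ j =>
    intro x hx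
    refine key x ?_
    have h2 := (R.aug hN).barIncl_barDiff j (((R.aug hN).plusMod.bar j).ext.π n x)
    rw [DegMod.barDiff_π, hx, map_zero, map_zero] at h2
    exact h2.symm

/-- The bar homology of `A_+ ⊗ A^{!*}_0` is the bar homology of `A_+`, hence it is concentrated in
the degrees prescribed by the jump function if `A` is `N`-Koszul. -/
theorem kerVanish_zero (hR : R.IsNKoszul) : R.KerVanish hN 0 := by
  intro j n hn
  have h0 : nu N 0 = 0 := nu_two_mul N 0 |>.trans (zero_mul N)
  have h1 : (1 : (free k p N).Alg) ∈ R.dualSub (nu N 0) := by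
    rw [h0, R.dualSub_eq_deg hN, ← word_nil]
    exact word_mem_deg _ []
  let φ : R.dualSub (nu N 0) →ₗ[k] k := Finsupp.lapply [] ∘ₗ coords ∘ₗ (R.dualSub (nu N 0)).subtype
  have hφ1 : φ ⟨1, h1⟩ = 1 := by
    change coords (1 : (free k p N).Alg) [] = 1
    rw [← word_nil, coords_word, Finsupp.single_eq_same]
  have hφ : ∀ w, w = φ w • ⟨1, h1⟩ := by
    intro w
    have hw : (w : (free k p N).Alg) ∈ (free k p N).deg 0 := by
      have := R.dualSub_le_deg _ w.2
      generalize (w : (free k p N).Alg) = x at this ⊢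
      rwa [h0] at this
    refine Subtype.ext (coords_ext fun v => ?_)
    change coords (w : (free k p N).Alg) v =
      coords (coords (w : (free k p N).Alg) [] • (1 : (free k p N).Alg)) v
    rw [← word_nil, map_smul, coords_word, Finsupp.smul_single, smul_eq_mul, mul_one]
    rcases v with _ | ⟨i, v⟩
    · rw [Finsupp.single_eq_same]
    · rw [Finsupp.single_eq_of_ne (by simp), mem_deg_iff.1 hw _ (by simp)]
  let f : (R.aug hN).plus →ₗ[R.Alg] R.Alg ⊗[k] R.dualSub (nu N 0) :=
    { toFun := fun a => (a : R.Alg) ⊗ₜ ⟨1, h1⟩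
      map_add' := fun a b => TensorProduct.add_tmul _ _ _
      map_smul' := fun a b => rfl }
  have hf : ∀ a, f a ∈ R.kosKer hN 0 := by
    intro a
    refine ⟨a ⊗ₜ (1 ⊗ₜ ⟨1, h1⟩), ?_⟩
    rw [DegMod.act_tmul]
    change ((a : R.Alg) • ((1 : R.Alg) ⊗ₜ[k] (⟨1, h1⟩ : R.dualSub (nu N 0)))) = _
    rw [TensorProduct.smul_tmul', smul_eq_mul, mul_one]
    rfl
  refine DegMod.BarVanish.of_bijective (M := (R.aug hN).plusMod) (f.codRestrict _ hf) ?_ ⟨?_, ?_⟩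
    (R.barVanish_of_tor hN (hR (j + 1) n ?_))
  · intro n x
    refine Subtype.ext ?_
    have e : R.tensorDeg (R.dualSub (nu N 0)) (nu N 0) n =
        TensorProduct.map (R.degProj n) LinearMap.id :=
      (congrArg (R.tensorDeg _ (nu N 0)) (by rw [h0, add_zero])).trans (R.tensorDeg_add (nu N 0) n)
    exact (LinearMap.congr_fun e (f x)).symm
  · intro a b hab
    have h2 := congrArg (fun z => TensorProduct.rid k R.Alg (φ.lTensor R.Alg z))
      (congrArg Subtype.val hab)
    have h3 : ∀ a, TensorProduct.rid k R.Alg (φ.lTensor R.Alg (f a)) = (a : R.Alg) := by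
      intro a
      change TensorProduct.rid k R.Alg (φ.lTensor R.Alg ((a : R.Alg) ⊗ₜ ⟨1, h1⟩)) = _
      rw [LinearMap.lTensor_tmul, hφ1, TensorProduct.rid_tmul, one_smul]
    exact Subtype.ext ((h3 a).symm.trans (h2.trans (h3 b)))
  · have h2 : LinearMap.range (R.kosMod hN (nu N 0)).act ≤ LinearMap.range f := by
      rintro _ ⟨y, rfl⟩
      induction y using TensorProduct.induction_on with
      | zero => rw [map_zero]; exact Submodule.zero_mem _
      | add x y hx hy => rw [map_add]; exact Submodule.add_mem _ hx hy
      | tmul a z =>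
        rw [DegMod.act_tmul]
        change (a : R.Alg) • (z : R.Alg ⊗[k] R.dualSub (nu N 0)) ∈ _
        induction z using TensorProduct.induction_on with
        | zero => rw [smul_zero]; exact Submodule.zero_mem _
        | add x y hx hy => rw [smul_add]; exact Submodule.add_mem _ hx hy
        | tmul b w =>
          have ha : R.augHom hN a = 0 := a.2
          have hb : R.augHom hN (φ w • ((a : R.Alg) * b)) = 0 := by
            rw [map_smul, map_mul, ha, zero_mul, smul_zero]
          refine ⟨(⟨_, hb⟩ : (R.aug hN).plus), ?_⟩
          change (φ w • ((a : R.Alg) * b)) ⊗ₜ[k] (⟨1, h1⟩ : R.dualSub (nu N 0)) = _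
          rw [TensorProduct.smul_tmul, ← hφ w]
          rfl
    rintro ⟨z, hz⟩
    obtain ⟨a, rfl⟩ := h2 hz
    exact ⟨a, rfl⟩
  · convert hn using 2
    ring

end HomRel
end TorComparison

/-! ### Exact sequences of supercomodules -/

theorem superProj_map {k : Type u} [Field k] {V W : Type*} [AddCommGroup V] [Module k V]
    [AddCommGroup W] [Module k W] (𝒱 : ZMod 2 → Submodule k V) [DirectSum.Decomposition 𝒱]
    (𝒲 : ZMod 2 → Submodule k W) [DirectSum.Decomposition 𝒲] (f : V →ₗ[k] W)
    (hf : ∀ r, ∀ v ∈ 𝒱 r, f v ∈ 𝒲 r) (r : ZMod 2) (v : V) :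
    superProj 𝒲 r (f v) = f (superProj 𝒱 r v) := by
  conv_lhs => rw [← sum_superProj 𝒱 v]
  rw [map_sum, map_sum, Finset.sum_eq_single r]
  · rw [superProj_of_mem 𝒲 (hf r _ (superProj_mem 𝒱 r v)), if_pos rfl]
  · intro s _ hs
    rw [superProj_of_mem 𝒲 (hf s _ (superProj_mem 𝒱 s v)), if_neg (Ne.symm hs)]
  · simp

/-- Naturality of the shuffle. -/
theorem superShuffle_map {k : Type u} [Field k] {B : Type u} [Ring B] [Algebra k B]
    (ℬ : ZMod 2 → Submodule k B) [GradedAlgebra ℬ] {M N M' N' : Type*}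
    [AddCommGroup M] [Module k M] [AddCommGroup N] [Module k N]
    [AddCommGroup M'] [Module k M'] [AddCommGroup N'] [Module k N']
    (𝒩 : ZMod 2 → Submodule k N) [DirectSum.Decomposition 𝒩]
    (𝒩' : ZMod 2 → Submodule k N') [DirectSum.Decomposition 𝒩'] (f : M →ₗ[k] M') (g : N →ₗ[k] N')
    (hg : ∀ r, ∀ v ∈ 𝒩 r, g v ∈ 𝒩' r) (x : (M ⊗[k] B) ⊗[k] (N ⊗[k] B)) :
    superShuffle ℬ M' N' 𝒩' (TensorProduct.map (f.rTensor B) (g.rTensor B) x) =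
      (TensorProduct.map f g).rTensor B (superShuffle ℬ M N 𝒩 x) := by
  have h : superShuffle ℬ M' N' 𝒩' ∘ₗ TensorProduct.map (f.rTensor B) (g.rTensor B) =
      (TensorProduct.map f g).rTensor B ∘ₗ superShuffle ℬ M N 𝒩 := by
    ext m b n c
    simp only [superShuffle, LinearMap.sum_apply, LinearMap.smul_apply, LinearMap.comp_apply,
      TensorProduct.map_tmul, LinearMap.lTensor_tmul, LinearMap.rTensor_tmul, LinearEquiv.coe_coe,
      TensorProduct.tensorTensorTensorComm_tmul, LinearMap.mul'_apply, map_sum, map_smul,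
      TensorProduct.AlgebraTensorModule.curry_apply, LinearMap.restrictScalars_apply,
      TensorProduct.curry_apply, superProj_map 𝒩 𝒩' g hg]
  exact LinearMap.congr_fun h x

section Images

variable {k : Type u} [Field k] {B : Type u} [Ring B] [Algebra k B] [Coalgebra k B]
  {ℬ : ZMod 2 → Submodule k B} [GradedAlgebra ℬ]

namespace SComod

theorem IsHom.range_graded {M N : SComod ℬ} {f : M.carrier →ₗ[k] N.carrier} (hf : IsHom f) :
    IsGradedSub N.grading (LinearMap.range f) := by
  rintro r _ ⟨m, rfl⟩
  exact ⟨_, (superProj_map M.grading N.grading f hf.even r m).symm⟩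

theorem IsHom.range_costable {M N : SComod ℬ} {f : M.carrier →ₗ[k] N.carrier} (hf : IsHom f) :
    Costable N.coact (LinearMap.range f) := by
  rintro _ ⟨m, rfl⟩
  refine ⟨f.rangeRestrict.rTensor B (M.coact m), ?_⟩
  rw [← LinearMap.comp_apply, ← LinearMap.rTensor_comp, hf.comm]
  rfl

/-- The image of a morphism of supercomodules. -/
noncomputable def IsHom.image {M N : SComod ℬ} {f : M.carrier →ₗ[k] N.carrier} (hf : IsHom f) :
    SComod ℬ :=
  SComod.ofSub N.grading N.coact N.coassoc N.counit N.even (LinearMap.range f)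
    inferInstance hf.range_graded hf.range_costable

/-- The inclusion of the image. -/
noncomputable def IsHom.imageIncl {M N : SComod ℬ} {f : M.carrier →ₗ[k] N.carrier}
    (hf : IsHom f) : hf.image.carrier →ₗ[k] N.carrier :=
  (LinearMap.range f).subtype

/-- The map onto the image. -/
noncomputable def IsHom.toImage {M N : SComod ℬ} {f : M.carrier →ₗ[k] N.carrier}
    (hf : IsHom f) : M.carrier →ₗ[k] hf.image.carrier :=
  f.rangeRestrict

theorem IsHom.imageIncl_isHom {M N : SComod ℬ} {f : M.carrier →ₗ[k] N.carrier}
    (hf : IsHom f) : IsHom (M := hf.image) (N := N) hf.imageIncl where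
  even _ _ h := h
  comm m := (subCoact_spec N.coact _ hf.range_costable m).symm

theorem IsHom.toImage_isHom {M N : SComod ℬ} {f : M.carrier →ₗ[k] N.carrier}
    (hf : IsHom f) : IsHom (M := M) (N := hf.image) hf.toImage where
  even r m h := hf.even r m h
  comm m := by
    refine rTensor_subtype_injective (LinearMap.range f) B ?_
    refine (subCoact_spec N.coact _ hf.range_costable (f.rangeRestrict m)).trans ?_
    change N.coact (f m) = (LinearMap.range f).subtype.rTensor B (f.rangeRestrict.rTensor B _)
    rw [hf.comm, ← LinearMap.rTensor_comp_apply]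
    rfl

theorem IsHom.isExtension {L M N : SComod ℬ} {f : L.carrier →ₗ[k] M.carrier}
    {g : M.carrier →ₗ[k] N.carrier} (hf : IsHom f) (hg : IsHom g) (h : Function.Exact f g) :
    IsExtension hf.image M hg.image := by
  refine ⟨_, _, hf.imageIncl_isHom, hg.toImage_isHom, Subtype.val_injective, fun m => ?_,
    g.surjective_rangeRestrict⟩
  constructor
  · intro hm
    obtain ⟨l, rfl⟩ := (h m).1 (congrArg Subtype.val hm)
    exact ⟨⟨_, l, rfl⟩, rfl⟩
  · rintro ⟨⟨_, l, rfl⟩, rfl⟩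
    exact Subtype.ext ((h _).2 ⟨l, rfl⟩)

end SComod

namespace GrothendieckRing

open SComod

variable [SuperBialgebra ℬ]

theorem cls_of_exact {L M N : SComod ℬ} {f : L.carrier →ₗ[k] M.carrier}
    {g : M.carrier →ₗ[k] N.carrier} (hf : IsHom f) (hg : IsHom g) (h : Function.Exact f g) :
    cls M = cls hg.image + cls hf.image := by
  rw [cls_extension (hf.isExtension hg h), add_comm]

theorem cls_of_injective {M N : SComod ℬ} {f : M.carrier →ₗ[k] N.carrier} (hf : IsHom f)
    (h : Function.Injective f) : cls M = cls hf.image :=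
  cls_eq hf.toImage_isHom ⟨fun _ _ e => h (congrArg Subtype.val e), f.surjective_rangeRestrict⟩

theorem cls_of_surjective {M N : SComod ℬ} {f : M.carrier →ₗ[k] N.carrier} (hf : IsHom f)
    (h : Function.Surjective f) : cls N = cls hf.image :=
  (cls_eq hf.imageIncl_isHom ⟨Subtype.val_injective, fun n => by
    obtain ⟨m, rfl⟩ := h n
    exact ⟨⟨_, m, rfl⟩, rfl⟩⟩).symm

end GrothendieckRing

end Images

/-! ### The Koszul differentials are morphisms of supercomodules -/

section Colinear

variable {k : Type u} [Field k] {ι : Type} [Fintype ι] {p : ι → ZMod 2} {N : ℕ}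

namespace HomRel

theorem coefSign_append {m n : ℕ} (I J : Fin m → ι) (I' J' : Fin n → ι) :
    coefSign p (Fin.append I I') (Fin.append J J') =
      (tpar p I + tpar p J) * tpar p I' + (coefSign p I J + coefSign p I' J') := by
  have h1 : ∀ (a : Fin m) (b : Fin n), Fin.castAdd n a < Fin.natAdd m b := by
    intro a b
    rw [Fin.lt_def, Fin.val_castAdd, Fin.val_natAdd]
    omega
  have h2 : ∀ (a : Fin m) (b : Fin n), ¬ Fin.natAdd m b < Fin.castAdd n a := fun a b =>
    (h1 a b).not_gt
  simp only [coefSign, Fin.sum_univ_add, Fin.append_left, Fin.append_right, h1, h2, if_true,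
    if_false, Finset.sum_add_distrib, Finset.sum_const_zero]
  simp only [Fin.lt_def, Fin.val_castAdd, Fin.val_natAdd, Nat.add_lt_add_iff_left]
  simp only [tpar, ← Finset.sum_add_distrib, Finset.sum_mul_sum]
  rw [add_zero, add_left_comm]

theorem zcoef_append (R : HomRel k p N) {m n : ℕ} (I J : Fin m → ι) (I' J' : Fin n → ι) :
    R.zcoef (Fin.append I I') (Fin.append J J') =
      sgn k ((tpar p I + tpar p J) * tpar p I') • (R.zcoef I J * R.zcoef I' J') := by
  have h : (fun a => (Fin.append I I' a, Fin.append J J' a)) =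
      Fin.append (fun a => (I a, J a)) (fun a => (I' a, J' a)) := by
    funext a
    refine Fin.addCases (fun a => ?_) (fun a => ?_) a <;> simp
  rw [zcoef, h, mon_append, coefSign_append, sgn_add, sgn_add, zcoef, zcoef, smul_mul_smul_comm,
    smul_smul]

theorem sum_append {M : Type*} [AddCommMonoid M] {m n : ℕ} (F : (Fin (m + n) → ι) → M) :
    ∑ I, F I = ∑ I : Fin m → ι, ∑ J : Fin n → ι, F (Fin.append I J) := by
  rw [← Finset.sum_product', Finset.univ_product_univ]
  exact (Fintype.sum_equiv (Fin.appendEquiv m n) _ _ fun _ => rfl).symm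

variable (R : HomRel k p N)

/-- The coaction of `end A` on `A ⊗ T(V)`. -/
noncomputable def ambCoact :
    R.Alg ⊗[k] (free k p N).Alg →ₗ[k] (R.Alg ⊗[k] (free k p N).Alg) ⊗[k] R.endo.Alg :=
  superShuffle R.endo.par R.Alg (free k p N).Alg (free k p N).par ∘ₗ
    TensorProduct.map (R.coactLin R R.coacts_self) (R.coactLin (free k p N) R.coacts_free)

theorem ambCoact_mon {l n : ℕ} (L : Fin l → ι) (J : Fin n → ι) :
    R.ambCoact (R.mon L ⊗ₜ (free k p N).mon J) = ∑ L' : Fin l → ι, ∑ J' : Fin n → ι,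
      (R.mon L' ⊗ₜ[k] (free k p N).mon J') ⊗ₜ[k]
        (sgn k ((tpar p L' + tpar p L) * tpar p J') • (R.zcoef L' L * R.zcoef J' J)) := by
  rw [ambCoact, LinearMap.comp_apply, TensorProduct.map_tmul, coactLin_mon, coactLin_mon,
    TensorProduct.sum_tmul, map_sum]
  refine Finset.sum_congr rfl fun L' _ => ?_
  rw [TensorProduct.tmul_sum, map_sum]
  refine Finset.sum_congr rfl fun J' _ => ?_
  rw [superShuffle_tmul R.endo.par (free k p N).par _ (R.zcoef_mem_par L' L)
    ((free k p N).mon_mem_par J'), TensorProduct.tmul_smul]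

/-- The map `a ⊗ x_I y ↦ a x_I ⊗ y`, with `I` of length `d`, on `A ⊗ T(V)`. -/
noncomputable def ambKos (d : ℕ) :
    R.Alg ⊗[k] (free k p N).Alg →ₗ[k] R.Alg ⊗[k] (free k p N).Alg :=
  ∑ I : Fin d → ι, TensorProduct.map (LinearMap.mulRight k (R.mon I)) (strip (List.ofFn I))

theorem ambKos_append {d e l : ℕ} (L : Fin l → ι) (I : Fin d → ι) (J : Fin e → ι) :
    R.ambKos d (R.mon L ⊗ₜ (free k p N).mon (Fin.append I J)) =
      R.mon (Fin.append L I) ⊗ₜ (free k p N).mon J := by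
  classical
  rw [ambKos, LinearMap.sum_apply, Finset.sum_eq_single I]
  · rw [TensorProduct.map_tmul, LinearMap.mulRight_apply, mon_append, mon_append,
      mon_eq_word (free k p N) I, strip_word_mul rfl, if_pos rfl]
  · intro P _ hP
    rw [TensorProduct.map_tmul, mon_append, mon_eq_word (free k p N) I, strip_word_mul (by simp),
      if_neg (fun h => hP (List.ofFn_injective h)), TensorProduct.tmul_zero]
  · simp

theorem ambKos_of_lt {d l n : ℕ} (h : n < d) (L : Fin l → ι) (J : Fin n → ι) :
    R.ambKos d (R.mon L ⊗ₜ (free k p N).mon J) = 0 := by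
  rw [ambKos, LinearMap.sum_apply]
  refine Finset.sum_eq_zero fun I _ => ?_
  rw [TensorProduct.map_tmul, strip_eq_zero (by simpa using h) ((free k p N).mon_mem_deg J),
    TensorProduct.tmul_zero]

theorem append_surj {m n : ℕ} (I : Fin (m + n) → ι) : ∃ J K, I = Fin.append J K :=
  ⟨_, _, (Fin.append_castAdd_natAdd (f := I)).symm⟩

theorem ambCoact_ambKos (d : ℕ) (x : R.Alg ⊗[k] (free k p N).Alg) :
    R.ambCoact (R.ambKos d x) = (R.ambKos d).rTensor R.endo.Alg (R.ambCoact x) := by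
  have h : R.ambCoact ∘ₗ R.ambKos d = (R.ambKos d).rTensor R.endo.Alg ∘ₗ R.ambCoact := by
    refine TensorProduct.ext (R.linearMap_ext fun l L => (free k p N).linearMap_ext fun n J => ?_)
    change R.ambCoact (R.ambKos d (R.mon L ⊗ₜ (free k p N).mon J)) =
      (R.ambKos d).rTensor R.endo.Alg (R.ambCoact (R.mon L ⊗ₜ (free k p N).mon J))
    by_cases hn : n < d
    · simp only [R.ambKos_of_lt hn, ambCoact_mon, map_sum, LinearMap.rTensor_tmul, map_zero,
        TensorProduct.zero_tmul, Finset.sum_const_zero]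
    · obtain ⟨e, rfl⟩ : ∃ e, n = d + e := ⟨n - d, by omega⟩
      obtain ⟨I, J, rfl⟩ := append_surj J
      rw [ambKos_append, ambCoact_mon, ambCoact_mon, sum_append, map_sum]
      refine Finset.sum_congr rfl fun L' _ => ?_
      rw [sum_append, map_sum]
      refine Finset.sum_congr rfl fun I' _ => ?_
      rw [map_sum]
      refine Finset.sum_congr rfl fun J' _ => ?_
      rw [LinearMap.rTensor_tmul, ambKos_append]
      congr 1
      simp only [zcoef_append, tpar_append, smul_mul_assoc, mul_smul_comm, smul_smul, ← sgn_add,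
        mul_assoc]
      congr 2
      ring
  exact LinearMap.congr_fun h x

theorem strip_mem_par {d : ℕ} (I : Fin d → ι) {r : ZMod 2} {x : (free k p N).Alg}
    (hx : x ∈ (free k p N).par r) : strip (List.ofFn I) x ∈ (free k p N).par (r - tpar p I) := by
  classical
  rw [par] at hx
  induction hx using Submodule.span_induction with
  | mem x hx =>
    obtain ⟨n, J, rfl, rfl⟩ := hx
    by_cases hn : n < d
    · rw [strip_eq_zero (by simpa using hn) ((free k p N).mon_mem_deg J)]
      exact Submodule.zero_mem _
    · obtain ⟨e, rfl⟩ : ∃ e, n = d + e := ⟨n - d, by omega⟩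
      obtain ⟨P, J, rfl⟩ := append_surj J
      rw [mon_append, mon_eq_word (free k p N) P, strip_word_mul (by simp)]
      split_ifs with h
      · rw [List.ofFn_injective h, tpar_append, add_sub_cancel_left]
        exact mon_mem_par _ J
      · exact Submodule.zero_mem _
  | zero => rw [map_zero]; exact Submodule.zero_mem _
  | add x y _ _ hx hy => rw [map_add]; exact Submodule.add_mem _ hx hy
  | smul c x _ hx => rw [map_smul]; exact Submodule.smul_mem _ c hx

/-- The inclusion of `A_l` into `A`. -/
noncomputable def degIncl (l : ℕ) : (R.comodDeg l).carrier →ₗ[k] R.Alg := (R.deg l).subtype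

/-- The identity map from the supercomodule `A^{!*}_n` to the subspace `A^{!*}_n` of `T(V)`. -/
noncomputable def dualIncl (n : ℕ) : (R.comodDual n).carrier →ₗ[k] R.dualSub n := LinearMap.id

/-- The right multiplication by a monomial, from `A_l` to `A_{l'}`. -/
noncomputable def mulMon {d l l' : ℕ} (hl : l + d = l') (I : Fin d → ι) :
    (R.comodDeg l).carrier →ₗ[k] (R.comodDeg l').carrier :=
  (LinearMap.mulRight k (R.mon I)).restrict (p := R.deg l) (q := R.deg l') fun a ha => by
    subst hl
    exact mul_mem_deg _ ha (R.mon_mem_deg I)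

/-- The operator `stripDual`, on the supercomodules. -/
noncomputable def stripComod {d m n : ℕ} (h : d + m = n) (I : Fin d → ι) :
    (R.comodDual n).carrier →ₗ[k] (R.comodDual m).carrier := R.stripDual h I

/-- The component `A_l ⊗ A^{!*}_n → A_{l'} ⊗ A^{!*}_m` of the Koszul differential. -/
noncomputable def kosDeg {d m n l l' : ℕ} (h : d + m = n) (hl : l + d = l') :
    (R.comodDeg l).carrier ⊗[k] (R.comodDual n).carrier →ₗ[k]
      (R.comodDeg l').carrier ⊗[k] (R.comodDual m).carrier :=
  ∑ I : Fin d → ι, TensorProduct.map (R.mulMon hl I) (R.stripComod h I)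

theorem degIncl_mem (l : ℕ) (a : (R.comodDeg l).carrier) : R.degIncl l a ∈ R.deg l :=
  (a : R.deg l).2

theorem degIncl_injective (l : ℕ) : Function.Injective (R.degIncl l) := Subtype.val_injective

theorem dualIncl_bijective (n : ℕ) : Function.Bijective (R.dualIncl n) := Function.bijective_id

/-- The inclusion of `A_l ⊗ A^{!*}_n` into `A ⊗ T(V)`. -/
noncomputable def ambIncl (l n : ℕ) : (R.comodDeg l).carrier ⊗[k] (R.comodDual n).carrier →ₗ[k]
    R.Alg ⊗[k] (free k p N).Alg :=
  TensorProduct.map (R.degIncl l) ((R.dualSub n).subtype ∘ₗ R.dualIncl n)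

theorem ambIncl_injective (l n : ℕ) : Function.Injective (R.ambIncl l n) :=
  TensorProduct.map_injective_of_flat_flat _ _ (R.degIncl_injective l)
    (Subtype.val_injective.comp (R.dualIncl_bijective n).1)

theorem kosDeg_tmul {d m n l l' : ℕ} (h : d + m = n) (hl : l + d = l')
    (a : (R.comodDeg l).carrier) (w : (R.comodDual n).carrier) :
    ∃ (a' : (Fin d → ι) → (R.comodDeg l').carrier) (w' : (Fin d → ι) → (R.comodDual m).carrier),
      R.kosDeg h hl (a ⊗ₜ w) = ∑ I, a' I ⊗ₜ w' I ∧
      (∀ I, R.degIncl l' (a' I) = R.degIncl l a * R.mon I) ∧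
      ∀ I, R.dualIncl m (w' I) = R.stripDual h I (R.dualIncl n w) := by
  refine ⟨fun I => R.mulMon hl I a, fun I => R.stripComod h I w, ?_, fun I => rfl,
    fun I => rfl⟩
  rw [kosDeg, LinearMap.sum_apply]
  rfl

theorem ambIncl_kosDeg {d m n l l' : ℕ} (h : d + m = n) (hl : l + d = l')
    (x : (R.comodDeg l).carrier ⊗[k] (R.comodDual n).carrier) :
    R.ambIncl l' m (R.kosDeg h hl x) = R.ambKos d (R.ambIncl l n x) := by
  induction x with
  | zero => simp only [map_zero]
  | add x y hx hy => simp only [map_add, hx, hy]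
  | tmul a w =>
    obtain ⟨a', w', e, ha, hw⟩ := R.kosDeg_tmul h hl a w
    rw [e, map_sum, ambIncl, ambIncl, TensorProduct.map_tmul, ambKos, LinearMap.sum_apply]
    refine Finset.sum_congr rfl fun I _ => ?_
    rw [TensorProduct.map_tmul, TensorProduct.map_tmul, ha, LinearMap.comp_apply, hw]
    rfl

theorem ambIncl_coact (l n : ℕ) (x : (R.comodDeg l).carrier ⊗[k] (R.comodDual n).carrier) :
    (R.ambIncl l n).rTensor R.endo.Alg
      (SComod.tensorCoact (R.comodDeg l) (R.comodDual n) x) = R.ambCoact (R.ambIncl l n x) := by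
  have h := superShuffle_map R.endo.par (R.comodDual n).grading (free k p N).par
    (R.degIncl l) ((R.dualSub n).subtype ∘ₗ R.dualIncl n) (fun _ _ h => h)
    (TensorProduct.map (R.comodDeg l).coact (R.comodDual n).coact x)
  refine h.symm.trans ?_
  rw [ambCoact, LinearMap.comp_apply]
  congr 1
  rw [ambIncl, ← LinearMap.comp_apply, ← LinearMap.comp_apply, ← TensorProduct.map_comp,
    ← TensorProduct.map_comp]
  congr 2
  · exact LinearMap.ext fun a => subCoact_spec _ _ (R.deg_costable R R.coacts_self l) a
  · exact LinearMap.ext fun a => subCoact_spec _ _ (R.dualSub_costable n) a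

theorem kosDeg_isHom {d m n l l' : ℕ} (h : d + m = n) (hl : l + d = l') :
    SComod.IsHom (M := (R.comodDeg l).tensor (R.comodDual n))
      (N := (R.comodDeg l').tensor (R.comodDual m)) (R.kosDeg h hl) where
  even r x hx := by
    have hle : tensorGrading (R.comodDeg l).grading (R.comodDual n).grading r ≤
        (tensorGrading (R.comodDeg l').grading (R.comodDual m).grading r).comap
          (R.kosDeg h hl) := by
      conv_lhs => rw [tensorGrading]
      rw [Submodule.span_le]
      rintro _ ⟨s, t, a, w, rfl, ha, hw, rfl⟩
      rw [SetLike.mem_coe, Submodule.mem_comap]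
      obtain ⟨a', w', e, ha', hw'⟩ := R.kosDeg_tmul h hl a w
      rw [e]
      refine Submodule.sum_mem _ fun I _ => tmul_mem_tensorGrading (s := s + tpar p I)
        (t := t - tpar p I) ?_ ?_ (by abel)
      · have h1 : R.degIncl l' (a' I) ∈ R.par (s + tpar p I) := by
          rw [ha']
          exact SetLike.mul_mem_graded ha (R.mon_mem_par I)
        exact h1
      · have h1 : (R.dualIncl m (w' I) : (free k p N).Alg) ∈ (free k p N).par (t - tpar p I) := by
          rw [hw']
          exact strip_mem_par I hw
        exact h1
    exact hle hx
  comm x := by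
    have hinj : Function.Injective ((R.ambIncl l' m).rTensor R.endo.Alg) :=
      Module.Flat.rTensor_preserves_injective_linearMap _ (R.ambIncl_injective l' m)
    refine hinj ((R.ambIncl_coact l' m _).trans ?_)
    rw [ambIncl_kosDeg, ambCoact_ambKos, ← ambIncl_coact, ← LinearMap.rTensor_comp_apply,
      ← LinearMap.rTensor_comp_apply]
    congr 2
    exact LinearMap.ext fun y => (R.ambIncl_kosDeg h hl y).symm

/-- The inclusion of `A_l ⊗ A^{!*}_n` into `A ⊗ A^{!*}_n`; its image is the component of degree
`l + n`, and it intertwines `kosDeg` with `kos`. -/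
noncomputable def kosIncl (l n : ℕ) : (R.comodDeg l).carrier ⊗[k] (R.comodDual n).carrier →ₗ[k]
    R.Alg ⊗[k] R.dualSub n :=
  TensorProduct.map (R.degIncl l) (R.dualIncl n)

theorem kosIncl_injective (l n : ℕ) : Function.Injective (R.kosIncl l n) :=
  TensorProduct.map_injective_of_flat_flat _ _ (R.degIncl_injective l) (R.dualIncl_bijective n).1

theorem kosIncl_kosDeg {d m n l l' : ℕ} (h : d + m = n) (hl : l + d = l')
    (x : (R.comodDeg l).carrier ⊗[k] (R.comodDual n).carrier) :
    R.kosIncl l' m (R.kosDeg h hl x) = R.kos h (R.kosIncl l n x) := by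
  induction x with
  | zero => simp only [map_zero]
  | add x y hx hy => simp only [map_add, hx, hy]
  | tmul a w =>
    obtain ⟨a', w', e, ha, hw⟩ := R.kosDeg_tmul h hl a w
    rw [e, map_sum, kosIncl, kosIncl, TensorProduct.map_tmul, kos_tmul]
    refine Finset.sum_congr rfl fun I _ => ?_
    rw [TensorProduct.map_tmul, ha, hw]

theorem tensorDeg_kosIncl (l n : ℕ) (x : (R.comodDeg l).carrier ⊗[k] (R.comodDual n).carrier) :
    R.tensorDeg _ n (l + n) (R.kosIncl l n x) = R.kosIncl l n x := by
  induction x with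
  | zero => simp only [map_zero]
  | add x y hx hy => simp only [map_add, hx, hy]
  | tmul a w =>
    rw [kosIncl, TensorProduct.map_tmul, R.tensorDeg_tmul (l := l) (R.degIncl_mem l a),
      if_pos rfl]

theorem exists_kosIncl {l n : ℕ} (x : R.Alg ⊗[k] R.dualSub n) :
    ∃ y, R.kosIncl l n y = R.tensorDeg _ n (l + n) x := by
  induction x with
  | zero => exact ⟨0, by simp only [map_zero]⟩
  | add x y hx hy =>
    obtain ⟨x', hx⟩ := hx
    obtain ⟨y', hy⟩ := hy
    exact ⟨x' + y', by rw [map_add, map_add, hx, hy]⟩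
  | tmul a w =>
    refine ⟨(⟨R.degProj l a, R.degProj_mem l a⟩ : R.deg l) ⊗ₜ[k] w, ?_⟩
    rw [tensorDeg_add]
    rfl

end HomRel
end Colinear

/-! ### The Euler characteristic of the Koszul complex -/

section Euler

variable {k : Type u} [Field k] {ι : Type} [Fintype ι] {p : ι → ZMod 2} {N : ℕ}

namespace HomRel

open GrothendieckRing SComod

variable (R : HomRel k p N) (hN : 0 < N)

/-- The components of the Koszul complex are exact. -/
theorem kosDeg_exact {i l l' l'' : ℕ}
    (hE : R.kosKer hN (i + 1) ≤ LinearMap.range (R.kosD hN (i + 1)))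
    (hl : l + gap N (i + 1) = l') (hl' : l' + gap N i = l'') :
    Function.Exact (R.kosDeg (gap_add_nu hN (i + 1)) hl) (R.kosDeg (gap_add_nu hN i) hl') := by
  intro x
  constructor
  · intro hx
    have h1 : R.kosIncl l' (nu N (i + 1)) x ∈ R.kosKer hN (i + 1) := by
      refine LinearMap.mem_ker.2 ?_
      rw [kosD, ← R.kosIncl_kosDeg (gap_add_nu hN i) hl', hx, map_zero]
    obtain ⟨y, hy⟩ := hE h1
    obtain ⟨z, hz⟩ := R.exists_kosIncl (l := l) y
    refine ⟨z, R.kosIncl_injective _ _ ?_⟩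
    have hn := gap_add_nu hN (i + 1)
    rw [R.kosIncl_kosDeg, hz, kos_tensorDeg,
      show l + nu N (i + 1 + 1) = l' + nu N (i + 1) by omega]
    refine (congrArg _ hy).trans (R.tensorDeg_kosIncl _ _ x)
  · rintro ⟨z, rfl⟩
    refine R.kosIncl_injective _ _ ?_
    rw [R.kosIncl_kosDeg, R.kosIncl_kosDeg, map_zero,
      R.kos_kos _ _ (by rw [add_comm]; exact gap_add_gap hN i)]

theorem kosDeg_injective {i l l' : ℕ}
    (hE : R.kosKer hN (i + 1) ≤ LinearMap.range (R.kosD hN (i + 1)))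
    (hl : l + gap N i = l') (hlt : l + nu N (i + 1) < nu N (i + 2)) :
    Function.Injective (R.kosDeg (gap_add_nu hN i) hl) := by
  rw [injective_iff_map_eq_zero]
  intro x hx
  have h1 : R.kosIncl l (nu N (i + 1)) x ∈ R.kosKer hN (i + 1) := by
    refine LinearMap.mem_ker.2 ?_
    rw [kosD, ← R.kosIncl_kosDeg (gap_add_nu hN i) hl, hx, map_zero]
  obtain ⟨y, hy⟩ := hE h1
  refine R.kosIncl_injective _ _ ?_
  rw [map_zero, ← R.tensorDeg_kosIncl, ← hy, kosD, ← kos_tensorDeg, R.tensorDeg_of_lt hlt,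
    LinearMap.zero_apply, map_zero]

theorem kosDeg_surjective {l l' : ℕ} (hE : R.kosKer hN 0 ≤ LinearMap.range (R.kosD hN 0))
    (hl : l + gap N 0 = l') : Function.Surjective (R.kosDeg (gap_add_nu hN 0) hl) := by
  intro x
  have h1 : R.kosIncl l' (nu N 0) x ∈ R.kosKer hN 0 := by
    induction x with
    | zero => rw [map_zero]; exact Submodule.zero_mem _
    | add x y hx hy => rw [map_add]; exact Submodule.add_mem _ hx hy
    | tmul a w =>
      have ha : R.augHom hN (R.degIncl l' a) = 0 := by
        have h1 := R.augHom_degProj hN l' (R.degIncl l' a)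
        rw [R.degProj_of_mem (R.degIncl_mem l' a), if_pos rfl] at h1
        rw [h1, if_neg (by rw [← hl]; simp [gap])]
      refine ⟨(⟨_, ha⟩ : (R.aug hN).plus) ⊗ₜ (1 ⊗ₜ R.dualIncl _ w), ?_⟩
      rw [DegMod.act_tmul]
      change (R.degIncl l' a) • ((1 : R.Alg) ⊗ₜ[k] R.dualIncl _ w) = _
      rw [TensorProduct.smul_tmul', smul_eq_mul, mul_one]
      rfl
  obtain ⟨y, hy⟩ := hE h1
  obtain ⟨z, hz⟩ := R.exists_kosIncl (l := l) y
  refine ⟨z, R.kosIncl_injective _ _ ?_⟩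
  have hn := gap_add_nu hN 0
  rw [R.kosIncl_kosDeg, hz, kos_tensorDeg, show l + nu N (0 + 1) = l' + nu N 0 by omega]
  exact (congrArg _ hy).trans (R.tensorDeg_kosIncl _ _ x)

/-- The class of the component of degree `n` of the `i`-th term of the Koszul complex. -/
noncomputable def kosCls (n i : ℕ) : GrothendieckRing R.endo.par :=
  if nu N i ≤ n then cls (R.comodDeg (n - nu N i)) * cls (R.comodDual (nu N i)) else 0

/-- The class of the image of the component of degree `n` of the `i`-th differential of the Koszul
complex. -/
noncomputable def kosImgCls (n i : ℕ) : GrothendieckRing R.endo.par :=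
  if h : nu N (i + 1) ≤ n then
    cls (R.kosDeg_isHom (gap_add_nu hN i) (l := n - nu N (i + 1)) (l' := n - nu N i) (by
      have := gap_add_nu hN i
      omega)).image
  else 0

theorem kosCls_zero {n : ℕ} (hn : 0 < n) (hE : R.kosKer hN 0 ≤ LinearMap.range (R.kosD hN 0)) :
    R.kosCls n 0 = R.kosImgCls hN n 0 := by
  have h0 : nu N 0 = 0 := (nu_two_mul N 0).trans (zero_mul N)
  have h1 : nu N (0 + 1) = 1 := (nu_two_mul_add_one N 0).trans (by rw [zero_mul])
  rw [kosCls, kosImgCls, if_pos (by omega), dif_pos (by omega), cls_mul_cls]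
  exact cls_of_surjective _ (R.kosDeg_surjective hN hE _)

theorem kosCls_succ {n i : ℕ} (hE : R.kosKer hN (i + 1) ≤ LinearMap.range (R.kosD hN (i + 1))) :
    R.kosCls n (i + 1) = R.kosImgCls hN n i + R.kosImgCls hN n (i + 1) := by
  have h1 := gap_add_nu hN i
  have h2 := gap_add_nu hN (i + 1)
  rw [kosCls, kosImgCls, kosImgCls]
  by_cases hn : nu N (i + 1) ≤ n
  · rw [if_pos hn, dif_pos hn, cls_mul_cls]
    by_cases hn' : nu N (i + 1 + 1) ≤ n
    · rw [dif_pos hn']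
      exact cls_of_exact _ _ (R.kosDeg_exact hN hE (by omega) (by omega))
    · rw [dif_neg hn', add_zero]
      refine cls_of_injective _ (R.kosDeg_injective hN hE (by omega) ?_)
      change _ < nu N (i + 1 + 1)
      omega
  · rw [if_neg hn, dif_neg hn, dif_neg (by omega), add_zero]

theorem sum_kosCls_range {n : ℕ} (hn : 0 < n)
    (hE : ∀ i, R.kosKer hN i ≤ LinearMap.range (R.kosD hN i)) (m : ℕ) :
    ∑ i ∈ Finset.range (m + 1), (-1) ^ i * R.kosCls n i = (-1) ^ m * R.kosImgCls hN n m := by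
  induction m with
  | zero => rw [Finset.sum_range_one, R.kosCls_zero hN hn (hE 0)]
  | succ m ih =>
    rw [Finset.sum_range_succ, ih, R.kosCls_succ hN (hE (m + 1)), pow_succ]
    simp only [mul_neg, mul_one, neg_mul, mul_add]
    abel

theorem le_nu (h2N : 2 ≤ N) (i : ℕ) : i ≤ nu N i := by
  rcases Nat.even_or_odd' i with ⟨a, rfl | rfl⟩
  · rw [nu_two_mul, mul_comm]
    exact Nat.mul_le_mul_left a h2N
  · rw [nu_two_mul_add_one, mul_comm]
    exact Nat.add_le_add_right (Nat.mul_le_mul_left a h2N) 1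

/-- The Euler characteristic of a component of positive degree of the Koszul complex is zero. -/
theorem sum_kosCls (h2N : 2 ≤ N) {n : ℕ} (hn : 0 < n)
    (hE : ∀ i, R.kosKer hN i ≤ LinearMap.range (R.kosD hN i)) :
    ∑ i ∈ Finset.range (n + 1), (-1) ^ i * R.kosCls n i = 0 := by
  rw [R.sum_kosCls_range hN hn hE, kosImgCls, dif_neg, mul_zero]
  have := le_nu h2N (n + 1)
  omega

end HomRel
end Euler

/-! ### The Poincaré series -/

section JumpSums

variable {Q : Type*} [Ring Q] {N : ℕ}

theorem nu_mod (h2N : 2 ≤ N) (i : ℕ) : nu N i % N = i % 2 := by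
  rcases Nat.even_or_odd' i with ⟨a, rfl | rfl⟩
  · rw [nu_two_mul, Nat.mul_mod_left, Nat.mul_mod_right]
  · rw [nu_two_mul_add_one, Nat.mul_add_mod', Nat.mul_add_mod, Nat.mod_eq_of_lt (by omega)]

theorem nu_injective (h2N : 2 ≤ N) : Function.Injective (nu N) := by
  refine (strictMono_nat_of_lt_succ fun i => ?_).injective
  have h1 := gap_add_nu (by omega : 0 < N) i
  have h2 : 0 < gap N i := by
    rw [gap]
    split_ifs <;> omega
  omega

theorem exists_nu_eq (m : ℕ) (h : m % N = 0 ∨ m % N = 1) : ∃ i, nu N i = m := by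
  have hm := Nat.div_add_mod' m N
  rcases h with h | h
  · exact ⟨2 * (m / N), by rw [nu_two_mul]; omega⟩
  · exact ⟨2 * (m / N) + 1, by rw [nu_two_mul_add_one]; omega⟩

/-- The coefficients of a product with a series supported in the degrees congruent to `0` or `1`
modulo `N`, as sums over the values of the jump function. -/
theorem sum_antidiagonal_jump (h2N : 2 ≤ N) (a w : ℕ → Q) (n : ℕ) :
    ∑ x ∈ antidiagonal n, a x.1 *
      (if x.2 % N = 0 ∨ x.2 % N = 1 then (-1) ^ (x.2 % N) * w x.2 else 0) =
    ∑ i ∈ Finset.range (n + 1),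
      (-1) ^ i * (if nu N i ≤ n then a (n - nu N i) * w (nu N i) else 0) := by
  classical
  set G : ℕ → Q := fun m => a (n - m) *
    (if m % N = 0 ∨ m % N = 1 then (-1) ^ (m % N) * w m else 0) with hG
  have h1 : ∑ x ∈ antidiagonal n, a x.1 *
      (if x.2 % N = 0 ∨ x.2 % N = 1 then (-1) ^ (x.2 % N) * w x.2 else 0) =
      ∑ m ∈ Finset.range (n + 1), G m := by
    rw [← Finset.Nat.sum_antidiagonal_swap, Finset.Nat.sum_antidiagonal_eq_sum_range_succ_mk]
    rfl
  have h2 : ∀ i, (-1) ^ i * (if nu N i ≤ n then a (n - nu N i) * w (nu N i) else 0) =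
      if nu N i ≤ n then G (nu N i) else 0 := by
    intro i
    have h3 : (-1 : Q) ^ i = (-1) ^ (nu N i % N) := by
      rw [nu_mod h2N, neg_one_pow_eq_pow_mod_two]
    have h4 : nu N i % N = 0 ∨ nu N i % N = 1 := by
      rw [nu_mod h2N]
      omega
    split_ifs with h
    · rw [hG]
      dsimp only
      rw [if_pos h4, h3, ← mul_assoc, ← mul_assoc,
        ((Commute.neg_one_left (a (n - nu N i))).pow_left _).eq]
    · rw [mul_zero]
  rw [h1, Finset.sum_congr rfl fun i _ => h2 i, ← Finset.sum_filter,
    ← Finset.sum_image (f := G) fun i _ j _ e => nu_injective h2N e]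
  symm
  refine Finset.sum_subset ?_ ?_
  · intro m hm
    simp only [Finset.mem_image, Finset.mem_filter] at hm
    obtain ⟨i, ⟨_, hi⟩, rfl⟩ := hm
    exact Finset.mem_range.2 (by omega)
  · intro m hm hm'
    rw [hG]
    dsimp only
    rw [if_neg, mul_zero]
    intro h
    obtain ⟨i, rfl⟩ := exists_nu_eq m h
    have := HomRel.le_nu h2N i
    rw [Finset.mem_range] at hm
    exact hm' (Finset.mem_image_of_mem _ (Finset.mem_filter.2
      ⟨Finset.mem_range.2 (by omega), by omega⟩))

theorem evalNeg_jumpSeries (a : ℕ → Q) :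
    evalNeg (jumpSeries N (PowerSeries.mk a)) =
      PowerSeries.mk fun m => if m % N = 0 ∨ m % N = 1 then (-1) ^ (m % N) * a m else 0 := by
  refine PowerSeries.ext fun m => ?_
  rw [evalNeg, jumpSeries, PowerSeries.coeff_mk, PowerSeries.coeff_mk, PowerSeries.coeff_mk,
    PowerSeries.coeff_mk]
  split_ifs
  · have h : m + (m - m % N) = 2 * (m - m % N) + m % N := by
      have := Nat.mod_le m N
      omega
    rw [← mul_assoc, ← pow_add, h, pow_add, pow_mul, neg_one_sq, one_pow, one_mul]
  · rw [mul_zero]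

end JumpSums

section Series

/-- A supercomodule spanned by a nonzero even coinvariant is trivial. -/
theorem GrothendieckRing.cls_eq_one {k : Type u} [Field k] {B : Type u} [Ring B] [Algebra k B]
    [Coalgebra k B] {ℬ : ZMod 2 → Submodule k B} [GradedAlgebra ℬ] [SuperBialgebra ℬ]
    (M : SComod ℬ) (e : M.carrier) (h0 : e ≠ 0) (he : e ∈ M.grading 0)
    (hc : M.coact e = e ⊗ₜ 1) (hs : ∀ x, ∃ c : k, x = c • e) : cls M = 1 := by
  refine (cls_eq (V := SComod.unit) (W := M) (f := LinearMap.toSpanSingleton k M.carrier e)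
    ⟨?_, ?_⟩ ⟨?_, ?_⟩).symm
  · intro r m hm
    by_cases hr : r = 0
    · subst hr
      exact Submodule.smul_mem _ _ he
    · change m ∈ (if r = 0 then ⊤ else ⊥ : Submodule k k) at hm
      rw [if_neg hr, Submodule.mem_bot] at hm
      rw [hm, map_zero]
      exact Submodule.zero_mem _
  · intro c
    change M.coact (c • e) = (LinearMap.toSpanSingleton k M.carrier e).rTensor B (c ⊗ₜ 1)
    rw [map_smul, hc, LinearMap.rTensor_tmul, LinearMap.toSpanSingleton_apply,
      TensorProduct.smul_tmul']
  · intro c d h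
    exact smul_left_injective k h0 h
  · intro x
    obtain ⟨c, rfl⟩ := hs x
    exact ⟨c, rfl⟩

variable {k : Type u} [Field k] {ι : Type} [Fintype ι] {p : ι → ZMod 2} {N : ℕ}

namespace HomRel

open GrothendieckRing SComod

theorem exists_smul_one_of_mem_deg_zero (S : HomRel k p N) {x : S.Alg} (hx : x ∈ S.deg 0) :
    ∃ c : k, x = c • 1 := by
  have h : S.deg 0 ≤ Submodule.span k {(1 : S.Alg)} := by
    rw [deg, Submodule.span_le]
    rintro _ ⟨I, rfl⟩
    rw [mon_zero]
    exact Submodule.mem_span_singleton_self 1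
  obtain ⟨c, hc⟩ := Submodule.mem_span_singleton.1 (h hx)
  exact ⟨c, hc.symm⟩

theorem coactLin_one (R S : HomRel k p N) (h : R.Coacts S) : R.coactLin S h 1 = 1 ⊗ₜ 1 := by
  have h1 := R.coactLin_mon S h (![] : Fin 0 → ι)
  simpa [mon_zero, zcoef_zero] using h1

theorem alg_one_ne_zero (S : HomRel k p N) (hN : 0 < N) : (1 : S.Alg) ≠ 0 := by
  intro h
  have := congrArg (S.augHom hN) h
  rw [map_one, map_zero] at this
  exact one_ne_zero this

variable (R : HomRel k p N)

theorem one_mem_deg_zero : (1 : R.Alg) ∈ R.deg 0 := by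
  rw [← word_nil]
  exact R.word_mem_deg []

theorem cls_comodDeg_zero (hN : 0 < N) : cls (R.comodDeg 0) = 1 := by
  let e : R.deg 0 := ⟨1, R.one_mem_deg_zero⟩
  refine cls_eq_one _ e ?_ ?_ ?_ ?_
  · exact fun h => R.alg_one_ne_zero hN (congrArg Subtype.val h)
  · exact (SetLike.GradedOne.one_mem : (1 : R.Alg) ∈ R.par 0)
  · refine rTensor_subtype_injective (R.deg 0) R.endo.Alg ?_
    refine (subCoact_spec _ _ (R.deg_costable R R.coacts_self 0) e).trans ?_
    exact R.coactLin_one R _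
  · rintro ⟨x, hx⟩
    obtain ⟨c, rfl⟩ := R.exists_smul_one_of_mem_deg_zero hx
    exact ⟨c, rfl⟩

theorem cls_comodDual_zero (hN : 0 < N) : cls (R.comodDual 0) = 1 := by
  let e : R.dualSub 0 := ⟨1, by rw [R.dualSub_eq_deg hN]; exact one_mem_deg_zero _⟩
  refine cls_eq_one _ e ?_ ?_ ?_ ?_
  · exact fun h => (free k p N).alg_one_ne_zero hN (congrArg Subtype.val h)
  · exact (SetLike.GradedOne.one_mem : (1 : (free k p N).Alg) ∈ (free k p N).par 0)
  · refine rTensor_subtype_injective (R.dualSub 0) R.endo.Alg ?_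
    refine (subCoact_spec _ _ (R.dualSub_costable 0) e).trans ?_
    exact R.coactLin_one (free k p N) _
  · rintro ⟨x, hx⟩
    obtain ⟨c, rfl⟩ := (free k p N).exists_smul_one_of_mem_deg_zero (R.dualSub_le_deg 0 hx)
    exact ⟨c, rfl⟩

/-- The first identity of the theorem: a coefficient of positive degree of the product is an Euler
characteristic of the Koszul complex. -/
theorem poincare_mul (h2N : 2 ≤ N) (hR : R.IsNKoszul) :
    R.poincare * (PowerSeries.mk fun m => if m % N = 0 ∨ m % N = 1 then
      (-1) ^ (m % N) * cls (R.comodDual m) else 0) = 1 := by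
  have hN : 0 < N := by omega
  refine PowerSeries.ext fun n => ?_
  rw [PowerSeries.coeff_mul, PowerSeries.coeff_one]
  simp only [poincare, PowerSeries.coeff_mk]
  rw [sum_antidiagonal_jump h2N (fun l => cls (R.comodDeg l)) (fun m => cls (R.comodDual m))]
  rcases Nat.eq_zero_or_pos n with rfl | hn
  · have h0 : nu N 0 = 0 := (nu_two_mul N 0).trans (zero_mul N)
    rw [if_pos rfl, Finset.sum_range_one, pow_zero, one_mul, h0, if_pos le_rfl,
      R.cls_comodDeg_zero hN, R.cls_comodDual_zero hN, one_mul]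
  · rw [if_neg hn.ne']
    exact R.sum_kosCls hN h2N hn (R.kosKer_le_range hN h2N (R.kerVanish_zero hN hR))

end HomRel
end Series

/-! ### Supercharacters -/

section Supercharacters

variable {k : Type u} [Field k] {B : Type u} [Ring B] [Algebra k B] [Coalgebra k B]
  {ℬ : ZMod 2 → Submodule k B} [GradedAlgebra ℬ]

namespace SComod

/-- The endomorphism `m ↦ ∑ φ(m_1) (-1) ^ |m_0| m_0` of a supercomodule, for a functional `φ`. -/
noncomputable def superAct (M : SComod ℬ) (φ : B →ₗ[k] k) : M.carrier →ₗ[k] M.carrier :=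
  (∑ r : ZMod 2, sgn k r • superProj M.grading r) ∘ₗ (TensorProduct.rid k M.carrier).toLinearMap ∘ₗ
    φ.lTensor M.carrier ∘ₗ M.coact

theorem superAct_of_coact (M : SComod ℬ) (φ : B →ₗ[k] k) {κ : Type*} [Fintype κ]
    (b : κ → M.carrier) (q : κ → ZMod 2) (hb : ∀ i, b i ∈ M.grading (q i)) (c : κ → B)
    {m : M.carrier} (hm : M.coact m = ∑ i, b i ⊗ₜ c i) :
    M.superAct φ m = ∑ i, (φ (c i) * sgn k (q i)) • b i := by
  have h : ∀ i, (∑ r : ZMod 2, sgn k r • superProj M.grading r) (b i) = sgn k (q i) • b i := by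
    intro i
    rw [LinearMap.sum_apply, Finset.sum_eq_single (q i)]
    · rw [LinearMap.smul_apply, superProj_of_mem _ (hb i), if_pos rfl]
    · intro r _ hr
      rw [LinearMap.smul_apply, superProj_of_mem _ (hb i), if_neg hr, smul_zero]
    · simp
  simp only [superAct, LinearMap.comp_apply, hm, map_sum, LinearMap.lTensor_tmul,
    LinearEquiv.coe_coe, TensorProduct.rid_tmul, map_smul, h, smul_smul]

theorem trace_superAct (M : SComod ℬ) (φ : B →ₗ[k] k) {κ : Type*} [Fintype κ]
    (b : Module.Basis κ k M.carrier) (q : κ → ZMod 2) (hb : ∀ i, b i ∈ M.grading (q i))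
    (c : κ → κ → B) (hc : ∀ j, M.coact (b j) = ∑ i, b i ⊗ₜ c i j) :
    LinearMap.trace k M.carrier (M.superAct φ) = φ (∑ i, sgn k (q i) • c i i) := by
  classical
  rw [LinearMap.trace_eq_matrix_trace k b, Matrix.trace, map_sum]
  refine Finset.sum_congr rfl fun j _ => ?_
  rw [Matrix.diag_apply, LinearMap.toMatrix_apply, M.superAct_of_coact φ b q hb _ (hc j), map_smul,
    smul_eq_mul, mul_comm]
  simp [Finsupp.single_apply]

/-- The supercharacter can be computed in any homogeneous basis. -/
theorem scharVal_eq (M : SComod ℬ) {κ : Type*} [Fintype κ]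
    (b : Module.Basis κ k M.carrier) (q : κ → ZMod 2) (hb : ∀ i, b i ∈ M.grading (q i))
    (c : κ → κ → B) (hc : ∀ j, M.coact (b j) = ∑ i, b i ⊗ₜ c i j) :
    M.scharVal = ∑ i, sgn k (q i) • c i i := by
  rw [← sub_eq_zero, ← Module.forall_dual_apply_eq_zero_iff k]
  intro φ
  rw [map_sub, sub_eq_zero, ← M.trace_superAct φ b q hb c hc]
  exact (M.trace_superAct φ M.basis (fun i => i.1) M.basis_mem M.coef M.coact_basis).symm

theorem superAct_map {M N : SComod ℬ} {f : M.carrier →ₗ[k] N.carrier} (hf : IsHom f)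
    (φ : B →ₗ[k] k) : N.superAct φ ∘ₗ f = f ∘ₗ M.superAct φ := by
  refine M.basis.ext fun j => ?_
  rw [LinearMap.comp_apply, LinearMap.comp_apply,
    M.superAct_of_coact φ M.basis (fun i => i.1) M.basis_mem _ (M.coact_basis j),
    N.superAct_of_coact φ (fun i => f (M.basis i)) (fun i => i.1)
      (fun i => hf.even _ _ (M.basis_mem i)) (fun i => M.coef i j), map_sum]
  · simp only [map_smul]
  · rw [hf.comm, coact_basis, map_sum]
    rfl

theorem scharVal_extension {U V W : SComod ℬ} (h : IsExtension U V W) :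
    V.scharVal = U.scharVal + W.scharVal := by
  obtain ⟨f, g, hf, hg, h1, h2, h3⟩ := h
  obtain ⟨s, hs⟩ := g.exists_rightInverse_of_surjective (LinearMap.range_eq_top.2 h3)
  obtain ⟨r₀, hr₀⟩ := f.exists_leftInverse_of_injective (LinearMap.ker_eq_bot.2 h1)
  -- the retraction onto `U` that vanishes on the image of the section `s`
  obtain ⟨r, hr⟩ : ∃ r, r = r₀ ∘ₗ (LinearMap.id - s ∘ₗ g) := ⟨_, rfl⟩
  have hfg : g ∘ₗ f = 0 := h2.linearMap_comp_eq_zero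
  have hrf : r ∘ₗ f = LinearMap.id := by
    rw [hr, LinearMap.comp_assoc, LinearMap.sub_comp, LinearMap.comp_assoc, hfg,
      LinearMap.comp_zero,
      sub_zero, LinearMap.id_comp, hr₀]
  have hid : f ∘ₗ r + s ∘ₗ g = LinearMap.id := by
    refine LinearMap.ext fun v => ?_
    have hv : g (v - s (g v)) = 0 := by
      rw [map_sub, ← LinearMap.comp_apply g s, hs, LinearMap.id_apply, sub_self]
    obtain ⟨u, hu⟩ := (h2 _).1 hv
    have hru : r v = u := by
      rw [hr]
      change r₀ (v - s (g v)) = u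
      rw [← hu, ← LinearMap.comp_apply, hr₀, LinearMap.id_apply]
    rw [LinearMap.add_apply, LinearMap.comp_apply, LinearMap.comp_apply, hru, hu,
      sub_add_cancel, LinearMap.id_apply]
  rw [← sub_eq_zero, ← Module.forall_dual_apply_eq_zero_iff k]
  intro φ
  have ht : ∀ M : SComod ℬ, φ M.scharVal = LinearMap.trace k M.carrier (M.superAct φ) := fun M =>
    (M.trace_superAct φ M.basis (fun i => i.1) M.basis_mem M.coef M.coact_basis).symm
  rw [map_sub, map_add, ht, ht, ht, sub_eq_zero]
  calc LinearMap.trace k _ (V.superAct φ)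
      = LinearMap.trace k _ (V.superAct φ ∘ₗ (f ∘ₗ r + s ∘ₗ g)) := by
        rw [hid, LinearMap.comp_id]
    _ = LinearMap.trace k _ ((f ∘ₗ U.superAct φ) ∘ₗ r) +
        LinearMap.trace k _ ((V.superAct φ ∘ₗ s) ∘ₗ g) := by
        rw [LinearMap.comp_add, map_add, ← superAct_map hf]
        rfl
    _ = LinearMap.trace k _ (U.superAct φ) + LinearMap.trace k _ (W.superAct φ) := by
        rw [LinearMap.trace_comp_comm' r (f ∘ₗ _), LinearMap.trace_comp_comm' g (_ ∘ₗ s),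
          ← LinearMap.comp_assoc, ← LinearMap.comp_assoc, hrf, LinearMap.id_comp, ← superAct_map hg,
          LinearMap.comp_assoc, hs, LinearMap.comp_id]

theorem schar_extension {U V W : SComod ℬ} (h : IsExtension U V W) :
    V.schar = U.schar + W.schar := by
  refine Subtype.ext ?_
  rw [Submodule.coe_add]
  exact scharVal_extension h

variable [SuperBialgebra ℬ]

theorem scharVal_tensor (M N : SComod ℬ) :
    (M.tensor N).scharVal = M.scharVal * N.scharVal := by
  rw [(M.tensor N).scharVal_eq (M.basis.tensorProduct N.basis) (fun x => x.1.1 + x.2.1)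
    (fun x => ?_) (tensorCoef M N) (tensorCoact_basis M N)]
  · rw [scharVal, scharVal, Finset.sum_mul_sum, ← Finset.sum_product', Finset.univ_product_univ]
    refine Finset.sum_congr rfl fun x _ => ?_
    rw [tensorCoef, zmod_two_add_self, zero_mul, sgn_zero, one_smul, sgn_add, smul_mul_smul_comm]
  · rw [Module.Basis.tensorProduct_apply]
    exact tmul_mem_tensorGrading (M.basis_mem _) (N.basis_mem _) rfl

theorem scharVal_unit : (unit : SComod ℬ).scharVal = 1 := by
  rw [(unit : SComod ℬ).scharVal_eq (Module.Basis.singleton PUnit.{1} k) (fun _ => 0)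
    (fun i => ?_) (fun _ _ => 1) fun j => ?_]
  · simp
  · change _ ∈ (if (0 : ZMod 2) = 0 then ⊤ else ⊥ : Submodule k k)
    rw [if_pos rfl]
    trivial
  · simp

end SComod

variable [SuperBialgebra ℬ]

variable (ℬ) in
/-- The supercharacter, as a morphism of rings on the Grothendieck ring. -/
noncomputable def scharHom : GrothendieckRing ℬ →+* ℬ 0 :=
  { GrothendieckRing.lift SComod.schar fun _ _ _ h => SComod.schar_extension h with
    map_one' := by
      change GrothendieckRing.lift _ _ 1 = 1
      rw [GrothendieckRing.one_eq, GrothendieckRing.lift_cls]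
      exact Subtype.ext SComod.scharVal_unit
    map_mul' := fun x y => by
      change GrothendieckRing.lift _ _ (x * y) =
        GrothendieckRing.lift _ _ x * GrothendieckRing.lift _ _ y
      induction x using GrothendieckRing.induction with
      | zero => rw [zero_mul, map_zero, zero_mul]
      | neg x hx =>
        rw [neg_mul, map_neg, map_neg, hx]
        exact Subtype.ext (neg_mul _ _).symm
      | add x x' hx hx' => rw [add_mul, map_add, map_add, hx, hx', add_mul]
      | cls V =>
        induction y using GrothendieckRing.induction with
        | zero => rw [mul_zero, map_zero, mul_zero]
        | neg y hy =>
          rw [mul_neg, map_neg, map_neg, hy]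
          exact Subtype.ext (mul_neg _ _).symm
        | add y y' hy hy' => rw [mul_add, map_add, map_add, hy, hy', mul_add]
        | cls W =>
          rw [GrothendieckRing.cls_mul_cls, GrothendieckRing.lift_cls, GrothendieckRing.lift_cls,
            GrothendieckRing.lift_cls]
          exact Subtype.ext (SComod.scharVal_tensor V W) }

theorem scharHom_cls (V : SComod ℬ) : scharHom ℬ (GrothendieckRing.cls V) = V.schar :=
  GrothendieckRing.lift_cls SComod.schar (fun _ _ _ h => SComod.schar_extension h) V

end Supercharacters

end NKoszul

theorem proposition5p1 {k : Type u} [Field k] (h2 : (2 : k) ≠ 0) {ι : Type} [Fintype ι]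
    (p : ι → ZMod 2) {N : ℕ} (hN : 2 ≤ N) (R : NKoszul.HomRel k p N) (hR : R.IsNKoszul) :
    R.poincare * NKoszul.evalNeg (NKoszul.jumpSeries N R.poincareDual) = 1 ∧
    (PowerSeries.mk fun l => (R.comodDeg l).schar) *
      (PowerSeries.mk fun m => if m % N = 0 ∨ m % N = 1 then
        (-1) ^ (m % N) * (R.comodDual m).schar else 0) = 1 := by
  have h := R.poincare_mul hN hR
  constructor
  · rw [NKoszul.HomRel.poincareDual, NKoszul.evalNeg_jumpSeries]
    exact h
  · have h' := congrArg (PowerSeries.map (NKoszul.scharHom R.endo.par)) h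
    rw [map_mul, map_one] at h'
    rw [← h']
    congr 1
    · refine PowerSeries.ext fun l => ?_
      rw [PowerSeries.coeff_map, NKoszul.HomRel.poincare, PowerSeries.coeff_mk,
        PowerSeries.coeff_mk, NKoszul.scharHom_cls]
    · refine PowerSeries.ext fun m => ?_
      rw [PowerSeries.coeff_map, PowerSeries.coeff_mk, PowerSeries.coeff_mk,
        apply_ite (NKoszul.scharHom R.endo.par), map_zero,
        map_mul, map_pow, map_neg, map_one, NKoszul.scharHom_cls]
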